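/- Let $(M,c)$ be a smooth (Hausdorff) conformal manifold of dimension $m$, where either $m\ge 3$, or $m=2$ and $M$ is endowed with a fixed Möbius structure $\mathcal M$, i.e. a linear differential operator $\mathcal M:C^\infty(L)\to C^\infty(S^2_0M\otimes L)$ ($L$ the line bundle of densities of weight $1$) such that $\mathcal M-\mathrm{Hess}^\nabla_0$ is a scalar operator for some Weyl structure $\nabla$, where $\mathrm{Hess}^\nabla_0$ is the symmetric trace-free part of the Hessian of $\nabla$ on $L$. Here a Weyl structure is a torsion-free connection on $TM$ with $\nabla c=0$. Let $N\subset M$ be a submanifold of dimension $n$ (embedded, or more generally immersed), with normal bundle $\nu$, so $TM|_N=TN\oplus\nu$; write $A^N$ and $A^\perp$ for the tangential and normal components of $A\in TM|_N$. For a Weyl structure $\nabla$ on $M$, let: * $R^\nabla_{X,Y}=[\nabla_X,\nabla_Y]-\nabla_{[X,Y]}$, $\mathrm{Ric}^\nabla(X,Y)=\mathrm{tr}(R^\nabla_{\cdot,X}Y)$, $\mathrm{scal}^\nabla=\mathrm{tr}_c\,\mathrm{Ric}^\nabla$, and $F^\nabla(X,Y)=\frac1m\mathrm{tr}\,R^\nabla_{X,Y}$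 (the Faraday form); * $h^\nabla=h_0^\nabla+\frac1{2m(m-1)}\mathrm{scal}^\nabla\,c-\frac12F^\nabla$ be the Schouten-Weyl tensor, where $h^\nabla_0$ is $\frac1{m-2}$ times the symmetric trace-free part of $\mathrm{Ric}^\nabla$ if $m\ge3$, and $h_0^\nabla=\mathcal M-\mathrm{Hess}^\nabla_0$ if $m=2$; * $\nabla^N_XY=(\nabla_XY)^N$ and $\nabla^\perp_X\xi=(\nabla_X\xi)^\perp$ be the induced connections on $TN$ and $\nu$ (for $X,Y$ tangent to $N$ and $\xi$ normal), which induce connections, all written $\nabla$, on the tensor bundles below; * $B_0$ be the trace-free part of $B^\nabla(X,Y)=(\nabla_XY)^\perp$, and $H^\nabla\in\nu^*$, $H^\nabla(\xi)=-\frac1n\mathrm{tr}\big((\nabla_\cdot\xi)^N\big)$, the mean curvature; * $(\delta^\nabla B_0)(X)=\mathrm{tr}^c_{TN}\big((\nabla_\cdot B_0)(X,\cdot)\big)\in L^{-2}\otimes\nu\simeq\nu^*$. Then there is a tensor $\mu:TN\to\nu^*$ (the mixed Schouten-Weyl tensor) such that for every Weyl structure $\nabla$ on $M$, all $p\in N$,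 $X\in T_pN$ and $\xi\in\nu_p$, $$\mu_X(\xi)=h^\nabla(X,\xi)-(\nabla_XH^\nabla)(\xi)+\frac1{n-1}(\delta^\nabla B_0)(X)(\xi),$$ where the last term is omitted if $n=1$. In other words, the right-hand side does not depend on the Weyl structure $\nabla$; it depends only on $(M,c)$ (and $\mathcal M$, if $m=2$) and on the submanifold $N$, and is thus a conformal invariant of it. -/

import Mathlib

open scoped Manifold ContDiff

noncomputable section

namespace ConformalGeometry

section Traces

variable {V W : Type*} [AddCommGroup V] [Module ℝ V] [AddCommGroup W] [Module ℝ W] {k : ℕ}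

/-- The trace of a (linear) map `A : V → V`, computed in the basis `b`. -/
def endTrace (b : Module.Basis (Fin k) ℝ V) (A : V → V) : ℝ :=
  ∑ i, b.repr (A (b i)) i

/-- The trace `∑ β^{ij} T(b_i, b_j)` of a (bilinear) map `T` with respect to a scalar product `β`,
where `(β^{ij})` is the inverse of the Gram matrix of `β` in the basis `b`. -/
def metricTrace (b : Module.Basis (Fin k) ℝ V) (β : V → V → ℝ) (T : V → V → W) : W :=
  ∑ i, ∑ j, (Matrix.of fun r s => β (b r) (b s))⁻¹ i j • T (b i) (b j)

end Traces

/-- The basis of `T_x M` given by the standard basis of the model space. -/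
def stdBasis (m : ℕ) {M : Type*} [TopologicalSpace M] [ChartedSpace (EuclideanSpace ℝ (Fin m)) M]
    (x : M) : Module.Basis (Fin m) ℝ (TangentSpace (𝓡 m) x) :=
  (EuclideanSpace.basisFun (Fin m) ℝ).toBasis

/-- Smooth Riemannian metrics on `M`. -/
abbrev RiemMetric (m : ℕ) (M : Type*) [TopologicalSpace M]
    [ChartedSpace (EuclideanSpace ℝ (Fin m)) M] [IsManifold (𝓡 m) ∞ M] :=
  Bundle.ContMDiffRiemannianMetric (𝓡 m) ∞ (EuclideanSpace ℝ (Fin m))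
    (fun x : M => TangentSpace (𝓡 m) x)

/-- A conformal structure on `M`, as a full conformal class of Riemannian metrics: the metrics of
the class are those of the form `e^{2u} g` with `u` smooth.

The line bundle `L` of densities of weight `1` is the bundle associated with the `ℝ₊`-principal
bundle of the metrics of the class: each `g` in the class has the form `g = l_g⁻² c` for a unique
positive section `l_g` of `L`, with `l_{e^{2u} g} = e^{-u} l_g`, and every section of `L` is
`f · l_g` for a unique function `f`. -/
structure ConformalStructure (m : ℕ) (M : Type*) [TopologicalSpace M]
    [ChartedSpace (EuclideanSpace ℝ (Fin m)) M] [IsManifold (𝓡 m) ∞ M] where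
  metrics : Set (RiemMetric m M)
  nonempty : metrics.Nonempty
  mem_iff : ∀ g ∈ metrics, ∀ g' : RiemMetric m M,
    g' ∈ metrics ↔ ∃ u : M → ℝ, ContMDiff (𝓡 m) 𝓘(ℝ) ∞ u ∧
      ∀ (x : M) (v w : TangentSpace (𝓡 m) x),
        g'.inner x v w = Real.exp (2 * u x) * g.inner x v w

section Ambient

variable {m : ℕ} {M : Type*} [TopologicalSpace M] [ChartedSpace (EuclideanSpace ℝ (Fin m)) M]
  [IsManifold (𝓡 m) ∞ M]

/-- The vector field `Y` on `M` is differentiable at `x`. -/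
abbrev FieldDiffAt (Y : ∀ x : M, TangentSpace (𝓡 m) x) (x : M) : Prop :=
  MDifferentiableAt (𝓡 m) ((𝓡 m).prod 𝓘(ℝ, EuclideanSpace ℝ (Fin m)))
    (fun y => (⟨y, Y y⟩ : TangentBundle (𝓡 m) M)) x

/-- A Weyl structure on `(M, c)`: a smooth torsion-free connection `∇` on `TM` with `∇ c = 0`.
In terms of a metric `g` of the class the latter says that `∇_X g = α(X) g` for some 1-form `α`.
The value of `cov Y x` at `v` is `(∇_v Y)(x)`. -/
structure WeylStructure (c : ConformalStructure m M) where
  cov : CovariantDerivative (𝓡 m) (EuclideanSpace ℝ (Fin m))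
    (fun x : M => TangentSpace (𝓡 m) x)
  smooth : CovariantDerivative.ContMDiffCovariantDerivative cov ∞
  torsion_free : cov.torsion = 0
  conformal : ∀ g : c.metrics, ∃ α : ∀ x : M, TangentSpace (𝓡 m) x →L[ℝ] ℝ,
    ∀ (Y Z : ∀ x : M, TangentSpace (𝓡 m) x) (x : M), FieldDiffAt Y x → FieldDiffAt Z x →
      ∀ v : TangentSpace (𝓡 m) x,
        mvfderiv (𝓡 m) (fun y => g.1.inner y (Y y) (Z y)) x v =
          g.1.inner x (cov Y x v) (Z x) + g.1.inner x (Y x) (cov Z x v)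
            + α x v * g.1.inner x (Y x) (Z x)

namespace WeylStructure

variable {c : ConformalStructure m M} (D : WeylStructure c)

/-- The 1-form `α` with `∇ g = α ⊗ g`. -/
def gaugeForm (g : c.metrics) : ∀ x : M, TangentSpace (𝓡 m) x →L[ℝ] ℝ :=
  Classical.choose (D.conformal g)

/-- The connection induced on `L`: since `∇ l_g = -½ α l_g`, one has
`∇_v (f l_g) = (df(v) - ½ α(v) f) l_g`, and this is the coefficient of `l_g`. -/
def covL (g : c.metrics) (f : M → ℝ) (x : M) (v : TangentSpace (𝓡 m) x) : ℝ :=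
  mvfderiv (𝓡 m) f x v - (1 / 2) * D.gaugeForm g x v * f x

/-- The Hessian `Hess^∇(X, Y) l = ∇_X ∇_Y l - ∇_{∇_X Y} l` of the section `l = f l_g` of `L`,
as the coefficient of `l_g`. -/
def hessL (g : c.metrics) (f : M → ℝ) (x : M) (v w : TangentSpace (𝓡 m) x) : ℝ :=
  let Y := FiberBundle.extend (EuclideanSpace ℝ (Fin m)) w
  D.covL g (fun y => D.covL g f y (Y y)) x v - D.covL g f x (D.cov Y x v)

end WeylStructure

/-- The symmetric trace-free part of a bilinear form `A` on `T_x M`, with respect to `g`. -/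
def symTraceFree (g : RiemMetric m M) (x : M)
    (A : TangentSpace (𝓡 m) x → TangentSpace (𝓡 m) x → ℝ) (v w : TangentSpace (𝓡 m) x) : ℝ :=
  (A v w + A w v) / 2
    - (1 / (m : ℝ)) * metricTrace (stdBasis m x) (fun a b => g.inner x a b) A * g.inner x v w

/-- A Möbius structure on `(M, c)`: a differential operator
`𝓜 : C^∞(L) → C^∞(S²₀M ⊗ L)` such that `𝓜 - Hess₀^∇` is a scalar operator for some (equivalently,
any) Weyl structure `∇`. Here `Hess₀^∇` is the symmetric trace-free part of the Hessian on `L`.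
Sections of `L` are written as `f l_g`, and `op g f` is the coefficient of `l_g` in
`𝓜 (f l_g)`. -/
structure MobiusStructure (c : ConformalStructure m M) where
  op : c.metrics → C^∞⟮𝓡 m, M; 𝓘(ℝ), ℝ⟯ →
    ∀ x : M, TangentSpace (𝓡 m) x →L[ℝ] TangentSpace (𝓡 m) x →L[ℝ] ℝ
  smooth : ∀ g f, ContMDiff (𝓡 m)
    ((𝓡 m).prod 𝓘(ℝ, EuclideanSpace ℝ (Fin m) →L[ℝ] EuclideanSpace ℝ (Fin m) →L[ℝ] ℝ)) ∞
    (fun x => Bundle.TotalSpace.mk'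
      (EuclideanSpace ℝ (Fin m) →L[ℝ] EuclideanSpace ℝ (Fin m) →L[ℝ] ℝ)
      (E := fun x : M => TangentSpace (𝓡 m) x →L[ℝ] TangentSpace (𝓡 m) x →L[ℝ] ℝ) x (op g f x))
  /-- The value of the operator on a section of `L` does not depend on the way it is written:
  if `g' = e^{2u} g` and `f' = e^u f`, so that `f' l_{g'} = f l_g`, then the values agree. -/
  equivariant : ∀ (g g' : c.metrics) (u f f' : C^∞⟮𝓡 m, M; 𝓘(ℝ), ℝ⟯),
    (∀ (x : M) (v w : TangentSpace (𝓡 m) x),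
      g'.1.inner x v w = Real.exp (2 * u x) * g.1.inner x v w) →
    (∀ x, f' x = Real.exp (u x) * f x) →
    ∀ (x : M) (v w : TangentSpace (𝓡 m) x), op g' f' x v w = Real.exp (u x) * op g f x v w
  /-- `𝓜 = Hess₀^∇ + h` for some Weyl structure `∇` and some section `h` of `S²₀M`. -/
  exists_weyl : ∃ (D : WeylStructure c)
    (h : ∀ x : M, TangentSpace (𝓡 m) x →L[ℝ] TangentSpace (𝓡 m) x →L[ℝ] ℝ),
    (∀ x v w, h x v w = h x w v) ∧
    (∀ (g : c.metrics) (x : M),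
      metricTrace (stdBasis m x) (fun a b => g.1.inner x a b) (fun a b => h x a b) = 0) ∧
    ∀ (g : c.metrics) (f : C^∞⟮𝓡 m, M; 𝓘(ℝ), ℝ⟯) (x : M) (v w : TangentSpace (𝓡 m) x),
      op g f x v w = symTraceFree g.1 x (D.hessL g f x) v w + h x v w * f x

/-- The structure needed for every Weyl structure on `(M, c)` to have a Schouten-Weyl tensor:
either `dim M ≥ 3`, and then nothing is added, or `dim M = 2` and `M` carries a Möbius structure. -/
inductive RigidStructure (c : ConformalStructure m M) : Type _
  | ofDim (hm : 3 ≤ m) : RigidStructure c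
  | ofMobius (hm : m = 2) (𝓜 : MobiusStructure c) : RigidStructure c

namespace WeylStructure

variable {c : ConformalStructure m M} (D : WeylStructure c)

/-- The curvature `R_{u,v} w = ∇_U ∇_V W - ∇_V ∇_U W - ∇_{[U,V]} W`, where `U, V, W` are local
extensions of `u, v, w`. -/
def curvature (x : M) (u v w : TangentSpace (𝓡 m) x) : TangentSpace (𝓡 m) x :=
  let U := FiberBundle.extend (EuclideanSpace ℝ (Fin m)) u
  let V := FiberBundle.extend (EuclideanSpace ℝ (Fin m)) v
  let W := FiberBundle.extend (EuclideanSpace ℝ (Fin m)) w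
  D.cov (fun y => D.cov W y (V y)) x u - D.cov (fun y => D.cov W y (U y)) x v
    - D.cov W x (VectorField.mlieBracket (𝓡 m) U V x)

/-- The Ricci tensor `Ric(v, w) = tr (R_{·,v} w)`. -/
def ricci (x : M) (v w : TangentSpace (𝓡 m) x) : ℝ :=
  endTrace (stdBasis m x) fun u => D.curvature x u v w

/-- The Faraday form `F`: the identity component of `R_{v,w} = R_{v,w}^{skew} + F(v, w) id`. -/
def faraday (x : M) (v w : TangentSpace (𝓡 m) x) : ℝ :=
  (1 / (m : ℝ)) * endTrace (stdBasis m x) fun u => D.curvature x v w u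

/-- The scalar curvature `tr_c Ric`, a density of weight `-2`, written in the metric `g`. -/
def scal (g : c.metrics) (x : M) : ℝ :=
  metricTrace (stdBasis m x) (fun a b => g.1.inner x a b) (D.ricci x)

/-- The section `h₀^{𝓜,∇} = 𝓜 - Hess₀^∇` of `S²₀M`, evaluated on the section `l_g` of `L`. -/
def mobiusSchouten (𝓜 : MobiusStructure c) (g : c.metrics) (x : M)
    (v w : TangentSpace (𝓡 m) x) : ℝ :=
  𝓜.op g (ContMDiffMap.const 1) x v w - symTraceFree g.1 x (D.hessL g (fun _ => 1) x) v w

/-- The trace-free symmetric part `h₀` of the Schouten-Weyl tensor: it is `1 / (m - 2)` times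
the trace-free symmetric part of the Ricci tensor if `m ≥ 3`, and it is determined by the Möbius
structure if `m = 2`. -/
def schoutenTraceFree (S : RigidStructure c) (g : c.metrics) (x : M)
    (v w : TangentSpace (𝓡 m) x) : ℝ :=
  match S with
  | .ofDim _ => (1 / ((m : ℝ) - 2)) * symTraceFree g.1 x (D.ricci x) v w
  | .ofMobius _ 𝓜 => D.mobiusSchouten 𝓜 g x v w

/-- The Schouten-Weyl tensor `h^∇ = h₀ + (1 / (2m(m-1))) scal^∇ c - ½ F^∇`. -/
def schouten (S : RigidStructure c) (g : c.metrics) (x : M) (v w : TangentSpace (𝓡 m) x) : ℝ :=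
  D.schoutenTraceFree S g x v w
    + (1 / (2 * (m : ℝ) * ((m : ℝ) - 1))) * D.scal g x * g.1.inner x v w
    - (1 / 2) * D.faraday x v w

end WeylStructure

end Ambient

section Submanifold

variable {m n : ℕ} {M : Type*} [TopologicalSpace M] [ChartedSpace (EuclideanSpace ℝ (Fin m)) M]
  [IsManifold (𝓡 m) ∞ M]
  {N : Type*} [TopologicalSpace N] [ChartedSpace (EuclideanSpace ℝ (Fin n)) N]
  [IsManifold (𝓡 n) ∞ N]

/-- The differential of `ι` at `p`. -/
abbrev dmap (ι : N → M) (p : N) : TangentSpace (𝓡 n) p →L[ℝ] TangentSpace (𝓡 m) (ι p) :=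
  mfderiv (𝓡 n) (𝓡 m) ι p

/-- The normal space `ν_p = (T_p N)^⊥ ⊆ T_p M` (orthogonality depends only on the conformal
class). -/
def normalSpace (c : ConformalStructure m M) (ι : N → M) (p : N) :
    Submodule ℝ (TangentSpace (𝓡 m) (ι p)) where
  carrier := {ξ | ∀ g ∈ c.metrics, ∀ v : TangentSpace (𝓡 n) p,
    g.inner (ι p) ξ (dmap ι p v) = 0}
  add_mem' := by
    intro a b ha hb g hg v
    simp [ha g hg v, hb g hg v]
  zero_mem' := by
    intro g _ v
    simp
  smul_mem' := by
    intro r a ha g hg v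
    simp [ha g hg v]

/-- The metric induced on `N` by a metric `g` on `M`. -/
def inducedMetric (g : RiemMetric m M) (ι : N → M) (p : N) (v w : TangentSpace (𝓡 n) p) : ℝ :=
  g.inner (ι p) (dmap ι p v) (dmap ι p w)

/-- The tangential component `u^N` of `u`: the orthogonal projection to `T_p N`, given by
`∑ G^{ij} g(u, b_i) b_j` in a basis `b` of `T_p N` with Gram matrix `G`. -/
def tangentPart (g : RiemMetric m M) (ι : N → M) (p : N) (u : TangentSpace (𝓡 m) (ι p)) :
    TangentSpace (𝓡 n) p :=
  metricTrace (stdBasis n p) (inducedMetric g ι p) fun a b => g.inner (ι p) u (dmap ι p a) • b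

/-- The normal component `u^⊥` of `u`. -/
def normalPart (g : RiemMetric m M) (ι : N → M) (p : N) (u : TangentSpace (𝓡 m) (ι p)) :
    TangentSpace (𝓡 m) (ι p) :=
  u - dmap (n := n) ι p (tangentPart g ι p u)

/-- The image of a vector field on `N` as a section of `TM` along `N`. -/
def push (ι : N → M) (Y : ∀ p : N, TangentSpace (𝓡 n) p) (p : N) : TangentSpace (𝓡 m) (ι p) :=
  dmap (n := n) ι p (Y p)

/-- An extension of a normal vector `ξ` at `p` to a section of the normal bundle, which is smooth
near `p`. -/
def normalExtend (g : RiemMetric m M) (ι : N → M) (p : N) (ξ : TangentSpace (𝓡 m) (ι p)) (q : N) :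
    TangentSpace (𝓡 m) (ι q) :=
  normalPart (n := n) g ι q (FiberBundle.extend (EuclideanSpace ℝ (Fin m)) ξ (ι q))

namespace WeylStructure

variable {c : ConformalStructure m M} (D : WeylStructure c) (g : c.metrics) (ι : N → M)

/-- The derivative `∇_v Z` of a section `Z` of `TM` along `N` in the direction of `v ∈ T_p N`
(pull-back connection): if `Z = ∑ Z^i E_i` in a local frame `E_i` of `TM` around `p`, then
`∇_v Z = ∑ dZ^i(v) E_i + Z^i ∇_{v} E_i`. -/
def covAlong (Z : ∀ q : N, TangentSpace (𝓡 m) (ι q)) (p : N) (v : TangentSpace (𝓡 n) p) :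
    TangentSpace (𝓡 m) (ι p) :=
  let e := trivializationAt (EuclideanSpace ℝ (Fin m)) (fun x : M => TangentSpace (𝓡 m) x) (ι p)
  let b := (EuclideanSpace.basisFun (Fin m) ℝ).toBasis
  ∑ i, (mvfderiv (𝓡 n) (fun q => e.localFrameCoeff (𝓡 m) b i (ι q) (Z q)) p v
          • e.localFrame b i (ι p)
        + e.localFrameCoeff (𝓡 m) b i (ι p) (Z p)
          • D.cov (e.localFrame b i) (ι p) (dmap ι p v))

/-- The induced Weyl structure on `N`: `∇^N_v Y = (∇_v Y)^N`. -/
def covTangent (Y : ∀ q : N, TangentSpace (𝓡 n) q) (p : N) (v : TangentSpace (𝓡 n) p) :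
    TangentSpace (𝓡 n) p :=
  tangentPart g.1 ι p (D.covAlong ι (push ι Y) p v)

/-- The connection on the normal bundle: `∇^⊥_v ξ = (∇_v ξ)^⊥`. -/
def covNormal (ξ : ∀ q : N, TangentSpace (𝓡 m) (ι q)) (p : N) (v : TangentSpace (𝓡 n) p) :
    TangentSpace (𝓡 m) (ι p) :=
  normalPart (n := n) g.1 ι p (D.covAlong ι ξ p v)

/-- The fundamental form `B^∇(v, w) = (∇_v W)^⊥`, with `W` a local extension of `w` to a vector
field on `N`. -/
def fundamentalForm (p : N) (v w : TangentSpace (𝓡 n) p) : TangentSpace (𝓡 m) (ι p) :=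
  normalPart (n := n) g.1 ι p
    (D.covAlong ι (push ι (FiberBundle.extend (EuclideanSpace ℝ (Fin n)) w)) p v)

/-- The trace-free part `B₀` of the fundamental form. -/
def fundamentalFormTraceFree (p : N) (v w : TangentSpace (𝓡 n) p) : TangentSpace (𝓡 m) (ι p) :=
  D.fundamentalForm g ι p v w
    - (inducedMetric g.1 ι p v w / (n : ℝ)) •
        metricTrace (stdBasis n p) (inducedMetric g.1 ι p) (D.fundamentalForm g ι p)

/-- The mean curvature `H^∇ ∈ ν^*`, `H^∇(ξ) = -(1/n) tr ((∇_· ξ)^N)`, with `ξ` extended to a local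
section of the normal bundle. -/
def meanCurvature (p : N) (ξ : TangentSpace (𝓡 m) (ι p)) : ℝ :=
  -(1 / (n : ℝ)) * endTrace (stdBasis n p) fun v =>
    tangentPart g.1 ι p (D.covAlong ι (normalExtend (n := n) g.1 ι p ξ) p v)

/-- The covariant derivative of the mean curvature, as a section of `ν^*`:
`(∇_v H)(ξ) = v(H(ξ)) - H(∇^⊥_v ξ)`, with `ξ` extended to a local section of the normal bundle. -/
def covMeanCurvature (p : N) (v : TangentSpace (𝓡 n) p) (ξ : TangentSpace (𝓡 m) (ι p)) : ℝ :=
  let Ξ := normalExtend (n := n) g.1 ι p ξ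
  mvfderiv (𝓡 n) (fun q => D.meanCurvature (n := n) g ι q (Ξ q)) p v
    - D.meanCurvature (n := n) g ι p (D.covNormal g ι Ξ p v)

/-- The covariant derivative of `B₀`, as a section of `T^*N ⊗ T^*N ⊗ ν`:
`(∇_u B₀)(v, w) = ∇^⊥_u (B₀(V, W)) - B₀(∇^N_u V, w) - B₀(v, ∇^N_u W)`, with `V, W` local extensions
of `v, w` to vector fields on `N`. -/
def covFundamentalFormTraceFree (p : N) (u v w : TangentSpace (𝓡 n) p) :
    TangentSpace (𝓡 m) (ι p) :=
  let V := FiberBundle.extend (EuclideanSpace ℝ (Fin n)) v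
  let W := FiberBundle.extend (EuclideanSpace ℝ (Fin n)) w
  D.covNormal g ι (fun q => D.fundamentalFormTraceFree g ι q (V q) (W q)) p u
    - D.fundamentalFormTraceFree g ι p (D.covTangent g ι V p u) w
    - D.fundamentalFormTraceFree g ι p v (D.covTangent g ι W p u)

/-- The codifferential `(δ^∇ B₀)(v) = tr^c_{TN} ((∇_· B₀)(v, ·)) ∈ ν ⊗ L⁻² ≃ ν^*`, evaluated
on `ξ`. -/
def codiffFundamentalForm (p : N) (v : TangentSpace (𝓡 n) p) (ξ : TangentSpace (𝓡 m) (ι p)) : ℝ :=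
  g.1.inner (ι p)
    (metricTrace (stdBasis n p) (inducedMetric g.1 ι p) fun a b =>
      D.covFundamentalFormTraceFree g ι p a v b) ξ

/-- The mixed Schouten-Weyl tensor computed with the Weyl structure `∇`:
`μ_X(ξ) = h^∇(X, ξ) - (∇_X H^∇)(ξ) + (1 / (n - 1)) (δ^∇ B₀)(X)(ξ)`, the last term being omitted if
`n = 1`. The metric `g` of the conformal class serves only to express weighted quantities. -/
def mixedSchoutenWeyl (S : RigidStructure c) (p : N) (X : TangentSpace (𝓡 n) p)
    (ξ : TangentSpace (𝓡 m) (ι p)) : ℝ :=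
  D.schouten S g (ι p) (dmap ι p X) ξ - D.covMeanCurvature (n := n) g ι p X ξ
    + if n = 1 then 0 else (1 / ((n : ℝ) - 1)) * D.codiffFundamentalForm (n := n) g ι p X ξ

end WeylStructure

end Submanifold

end ConformalGeometry

end

/-!
The formula is written with a metric `g` of the conformal class and a Weyl structure `D`, and the
main point is that replacing `D` by another Weyl structure `D'` has no effect.

As for Levi-Civita connections, torsion-freeness and compatibility with the conformal class force
`D'_v Y = D_v Y + θ(v) Y + θ(Y) v - g(v, Y) θ^♯` for a 1-form `θ` (`lee`, `cov_change`), where `θ^♯`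
(`leeVec`) is the vector field dual to `θ`. It is smooth, so this equation may be differentiated,
which gives the change of the curvature (`curvature_change`) and then of the Schouten-Weyl tensor on
pairs of orthogonal vectors, namely `-∇θ + θ ⊗ θ` (`schouten_change`). The pairs `(X, ξ)` with `X`
tangent and `ξ` normal are of this kind, and all multiples of `g` drop out on them.

On the submanifold, the second fundamental form changes by a multiple of the induced metric, hence
`B₀` is unchanged, and the mean curvature vector changes by the normal part of `-θ^♯`. Let `τ` be
the tangential part of `θ^♯`. Then `∇H` changes by `-∇θ + θ ⊗ θ + ⟨B₀(X, τ), ξ⟩`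
(`covMeanCurvature_change`): writing the normal part of `θ^♯` as `θ^♯ - τ`, the derivative of `τ`
has the normal component `B(X, τ)`. The codifferential of `B₀` changes by
`(n - 1) ⟨B₀(X, τ), ξ⟩` (`codiffFundamentalForm_change`). So the three changes cancel
(`mixedSchoutenWeyl_change`). For `n = 1` the form `B₀` vanishes, being a multiple of its trace, and
the last term is not needed.

It remains to see that for one Weyl structure the expression is bilinear in `X` and `ξ`
(`exists_mixedSchoutenWeyl_eq`) and that it does not depend on `g` (`mixedSchoutenWeyl_rescale`). If
`m ≥ 3`, any Weyl structure serves. If `m = 2`, one chooses a Weyl structure for which the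
difference of the Möbius structure and the Hessian is a scalar operator, so that the Schouten-Weyl
tensor is given by this operator and the Faraday form (`exists_schouten_eq`). If there is no Weyl
structure, there is nothing to show. Bilinearity is not immediate since derivatives of tensors
are computed with extensions of vectors; it follows from the Leibniz rule for the connection
along the immersion.
-/

noncomputable section

namespace ConformalGeometry

set_option linter.unusedSectionVars false

open Filter Topology Bundle

/-! ### Smooth germs along a map -/

section SmoothGerms

variable {m n : ℕ} {M : Type*} [TopologicalSpace M] [ChartedSpace (EuclideanSpace ℝ (Fin m)) M]
  [IsManifold (𝓡 m) ∞ M]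
  {N : Type*} [TopologicalSpace N] [ChartedSpace (EuclideanSpace ℝ (Fin n)) N]
  [IsManifold (𝓡 n) ∞ N]

/-- The function `h` is smooth on a neighbourhood of `p`. -/
def SmoothFun (n : ℕ) {N : Type*} [TopologicalSpace N]
    [ChartedSpace (EuclideanSpace ℝ (Fin n)) N] (h : N → ℝ) (p : N) : Prop :=
  ∀ᶠ q in 𝓝 p, ContMDiffAt (𝓡 n) 𝓘(ℝ) ∞ h q

/-- The section `Z` of `TM` along the map `f : N → M` is smooth on a neighbourhood of `p`. -/
def SmoothAlong {m : ℕ} (n : ℕ) {M : Type*} [TopologicalSpace M]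
    [ChartedSpace (EuclideanSpace ℝ (Fin m)) M] [IsManifold (𝓡 m) ∞ M] {N : Type*}
    [TopologicalSpace N] [ChartedSpace (EuclideanSpace ℝ (Fin n)) N] (f : N → M)
    (Z : ∀ q : N, TangentSpace (𝓡 m) (f q)) (p : N) : Prop :=
  ∀ᶠ q in 𝓝 p, ContMDiffAt (𝓡 n) ((𝓡 m).prod 𝓘(ℝ, EuclideanSpace ℝ (Fin m))) ∞
    (fun q => (⟨f q, Z q⟩ : TangentBundle (𝓡 m) M)) q

/-- The vector field `Y` on `M` is smooth on a neighbourhood of `x`. -/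
abbrev SmoothField (m : ℕ) {M : Type*} [TopologicalSpace M]
    [ChartedSpace (EuclideanSpace ℝ (Fin m)) M] [IsManifold (𝓡 m) ∞ M]
    (Y : ∀ x : M, TangentSpace (𝓡 m) x) (x : M) : Prop :=
  SmoothAlong m (fun y : M => y) Y x

namespace SmoothFun

variable {h k : N → ℝ} {p : N}

theorem mdiffAt (hh : SmoothFun n h p) : MDifferentiableAt (𝓡 n) 𝓘(ℝ) h p :=
  hh.self_of_nhds.mdifferentiableAt (by simp)

theorem near (hh : SmoothFun n h p) : ∀ᶠ q in 𝓝 p, SmoothFun n h q :=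
  hh.eventually_nhds

theorem congr (hh : SmoothFun n h p) (hk : ∀ᶠ q in 𝓝 p, k q = h q) : SmoothFun n k p := by
  filter_upwards [hh, hk.eventually_nhds] with q h1 h2
  exact h1.congr_of_eventuallyEq h2

theorem const (c : ℝ) : SmoothFun n (fun _ : N => c) p :=
  Eventually.of_forall fun _ => contMDiffAt_const

theorem sub (hh : SmoothFun n h p) (hk : SmoothFun n k p) : SmoothFun n (fun q => h q - k q) p := by
  filter_upwards [hh, hk] with q h1 h2
  exact ContMDiffAt.sub h1 h2

theorem mul (hh : SmoothFun n h p) (hk : SmoothFun n k p) : SmoothFun n (fun q => h q * k q) p := by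
  filter_upwards [hh, hk] with q h1 h2
  exact ContMDiffAt.mul h1 h2

theorem sum {ι : Type*} {s : Finset ι} {f : ι → N → ℝ} (hf : ∀ i ∈ s, SmoothFun n (f i) p) :
    SmoothFun n (fun q => ∑ i ∈ s, f i q) p := by
  have : ∀ᶠ q in 𝓝 p, ∀ i ∈ s, ContMDiffAt (𝓡 n) 𝓘(ℝ) ∞ (f i) q :=
    (Finset.eventually_all s).2 hf
  filter_upwards [this] with q hq
  exact contMDiffAt_finsetSum hq

theorem prod {ι : Type*} {s : Finset ι} {f : ι → N → ℝ} (hf : ∀ i ∈ s, SmoothFun n (f i) p) :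
    SmoothFun n (fun q => ∏ i ∈ s, f i q) p := by
  have : ∀ᶠ q in 𝓝 p, ∀ i ∈ s, ContMDiffAt (𝓡 n) 𝓘(ℝ) ∞ (f i) q :=
    (Finset.eventually_all s).2 hf
  filter_upwards [this] with q hq
  exact contMDiffAt_finsetProd hq

theorem inv (hh : SmoothFun n h p) (h0 : h p ≠ 0) : SmoothFun n (fun q => (h q)⁻¹) p := by
  have h1 : ∀ᶠ q in 𝓝 p, h q ≠ 0 :=
    hh.self_of_nhds.continuousAt.eventually_ne h0
  filter_upwards [hh, h1] with q h2 h3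
  exact (contDiffAt_inv ℝ h3).contMDiffAt.comp q h2

end SmoothFun

namespace SmoothAlong

variable {f : N → M} {Z Z' : ∀ q : N, TangentSpace (𝓡 m) (f q)} {p : N} {h : N → ℝ}

theorem near (hZ : SmoothAlong n f Z p) : ∀ᶠ q in 𝓝 p, SmoothAlong n f Z q :=
  hZ.eventually_nhds

theorem congr (hZ : SmoothAlong n f Z p) (hk : ∀ᶠ q in 𝓝 p, Z' q = Z q) : SmoothAlong n f Z' p := by
  filter_upwards [hZ, hk.eventually_nhds] with q h1 h2
  refine h1.congr_of_eventuallyEq ?_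
  filter_upwards [h2] with r hr
  rw [hr]

theorem of_linear
    (hf : ∀ᶠ q in 𝓝 p, ContMDiffAt (𝓡 n) (𝓡 m) ∞ f q)
    (h : ∀ᶠ q in 𝓝 p, ContMDiffAt (𝓡 n) 𝓘(ℝ, EuclideanSpace ℝ (Fin m)) ∞
      (fun r => (trivializationAt (EuclideanSpace ℝ (Fin m)) (fun x : M => TangentSpace (𝓡 m) x)
        (f q) ⟨f r, Z r⟩).2) q) : SmoothAlong n f Z p := by
  filter_upwards [hf, h] with q h1 h2
  rw [contMDiffAt_totalSpace]
  exact ⟨h1, h2⟩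

theorem base (hZ : SmoothAlong n f Z p) : ∀ᶠ q in 𝓝 p, ContMDiffAt (𝓡 n) (𝓡 m) ∞ f q := by
  filter_upwards [hZ] with q h1
  rw [contMDiffAt_totalSpace] at h1
  exact h1.1

theorem fiber (hZ : SmoothAlong n f Z p) : ∀ᶠ q in 𝓝 p,
    ContMDiffAt (𝓡 n) 𝓘(ℝ, EuclideanSpace ℝ (Fin m)) ∞
      (fun r => (trivializationAt (EuclideanSpace ℝ (Fin m)) (fun x : M => TangentSpace (𝓡 m) x)
        (f q) ⟨f r, Z r⟩).2) q := by
  filter_upwards [hZ] with q h1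
  rw [contMDiffAt_totalSpace] at h1
  exact h1.2

theorem eventually_mem_baseSet {q : N} (hf : ContMDiffAt (𝓡 n) (𝓡 m) ∞ f q) :
    ∀ᶠ r in 𝓝 q, f r ∈ (trivializationAt (EuclideanSpace ℝ (Fin m))
      (fun x : M => TangentSpace (𝓡 m) x) (f q)).baseSet :=
  hf.continuousAt.eventually_mem
    ((trivializationAt _ _ _).open_baseSet.mem_nhds (FiberBundle.mem_baseSet_trivializationAt' _))

theorem add (hZ : SmoothAlong n f Z p) (hZ' : SmoothAlong n f Z' p) :
    SmoothAlong n f (fun q => Z q + Z' q) p := by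
  refine of_linear hZ.base ?_
  filter_upwards [hZ.fiber, hZ'.fiber, hZ.base] with q h1 h2 h3
  refine (h1.add h2).congr_of_eventuallyEq ?_
  filter_upwards [eventually_mem_baseSet h3] with r hr
  exact (Trivialization.linear ℝ _ hr).1 (Z r) (Z' r)

theorem smul (hh : SmoothFun n h p) (hZ : SmoothAlong n f Z p) :
    SmoothAlong n f (fun q => h q • Z q) p := by
  refine of_linear hZ.base ?_
  filter_upwards [hZ.fiber, hh, hZ.base] with q h1 h2 h3
  refine (h2.smul h1).congr_of_eventuallyEq ?_
  filter_upwards [eventually_mem_baseSet h3] with r hr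
  exact (Trivialization.linear ℝ _ hr).2 (h r) (Z r)

theorem const_smul (c : ℝ) (hZ : SmoothAlong n f Z p) : SmoothAlong n f (fun q => c • Z q) p :=
  smul (SmoothFun.const c) hZ

theorem sub (hZ : SmoothAlong n f Z p) (hZ' : SmoothAlong n f Z' p) :
    SmoothAlong n f (fun q => Z q - Z' q) p := by
  refine (hZ.add (hZ'.const_smul (-1))).congr (Eventually.of_forall fun q => ?_)
  module

theorem zero (hf : ∀ᶠ q in 𝓝 p, ContMDiffAt (𝓡 n) (𝓡 m) ∞ f q) :
    SmoothAlong n f (fun q => (0 : TangentSpace (𝓡 m) (f q))) p := by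
  refine of_linear hf ?_
  filter_upwards [hf] with q h3
  refine (contMDiffAt_const (c := 0)).congr_of_eventuallyEq ?_
  filter_upwards [eventually_mem_baseSet h3] with r hr
  exact (Trivialization.linear ℝ _ hr).map_zero

theorem sum {ι : Type*} {s : Finset ι} {Z : ι → ∀ q : N, TangentSpace (𝓡 m) (f q)}
    (hf : ∀ᶠ q in 𝓝 p, ContMDiffAt (𝓡 n) (𝓡 m) ∞ f q)
    (hZ : ∀ i ∈ s, SmoothAlong n f (Z i) p) : SmoothAlong n f (fun q => ∑ i ∈ s, Z i q) p := by
  classical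
  induction s using Finset.induction_on with
  | empty => simpa using zero hf
  | insert a s ha ih =>
    simp only [Finset.sum_insert ha]
    exact (hZ a (by simp)).add (ih fun i hi => hZ i (by simp [hi]))

theorem inner (g : RiemMetric m M) (hZ : SmoothAlong n f Z p) (hZ' : SmoothAlong n f Z' p) :
    SmoothFun n (fun q => g.inner (f q) (Z q) (Z' q)) p := by
  filter_upwards [hZ, hZ', hZ.base] with q h1 h2 h3
  have : ContMDiffAt (𝓡 n) ((𝓡 m).prod 𝓘(ℝ)) ∞
      (fun q => TotalSpace.mk' ℝ (E := Bundle.Trivial M ℝ) (f q) (g.inner (f q) (Z q) (Z' q))) q :=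
    ContMDiffAt.clm_bundle_apply₂ (F₁ := EuclideanSpace ℝ (Fin m))
      (F₂ := EuclideanSpace ℝ (Fin m)) (g.contMDiff.contMDiffAt.comp q h3) h1 h2
  simp only [contMDiffAt_totalSpace] at this
  exact this.2

theorem comp {Y : ∀ x : M, TangentSpace (𝓡 m) x} (hf : ContMDiff (𝓡 n) (𝓡 m) ∞ f)
    (hY : SmoothField m Y (f p)) : SmoothAlong n f (fun q => Y (f q)) p := by
  filter_upwards [hf.continuous.continuousAt.eventually hY] with q h1
  exact ContMDiffAt.comp q (g := fun y : M => (⟨y, Y y⟩ : TangentBundle (𝓡 m) M)) h1 (hf q)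

theorem push {V : ∀ q : N, TangentSpace (𝓡 n) q} (hf : ContMDiff (𝓡 n) (𝓡 m) ∞ f)
    (hV : SmoothField n V p) : SmoothAlong n f (push (m := m) f V) p := by
  filter_upwards [hV] with q h1
  exact (hf.contMDiff_tangentMap (m := ∞) (by simp)).contMDiffAt.comp q h1

/-- Along `f`, smooth sections and vector fields have smooth frame coefficients. -/
theorem coeff (hZ : SmoothAlong n f Z p) {ι : Type*} [Fintype ι]
    (b : Module.Basis ι ℝ (EuclideanSpace ℝ (Fin m))) (i : ι)
    (e : Trivialization (EuclideanSpace ℝ (Fin m))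
      (TotalSpace.proj : TangentBundle (𝓡 m) M → M)) [MemTrivializationAtlas e]
    (he : f p ∈ e.baseSet) :
    SmoothFun n (fun q => e.localFrameCoeff (𝓡 m) b i (f q) (Z q)) p := by
  have hev : ∀ᶠ q in 𝓝 p, f q ∈ e.baseSet :=
    hZ.base.self_of_nhds.continuousAt.eventually_mem (e.open_baseSet.mem_nhds he)
  filter_upwards [hZ, hev.eventually_nhds] with q h1 h2
  rw [e.contMDiffAt_iff (by rw [e.mem_source]; exact h2.self_of_nhds)] at h1
  let l : EuclideanSpace ℝ (Fin m) →L[ℝ] ℝ := (b.coord i).toContinuousLinearMap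
  refine (l.contMDiff.contMDiffAt.comp q h1.2).congr_of_eventuallyEq ?_
  filter_upwards [h2] with r hr
  have := e.localFrameCoeff_apply_of_mem_baseSet (I := 𝓡 m) b hr
    (FiberBundle.extend (EuclideanSpace ℝ (Fin m)) (Z r)) i
  rw [FiberBundle.extend_apply_self] at this
  rw [this]
  simp [l, Bundle.Trivialization.basisAt]

end SmoothAlong

theorem SmoothField.fieldDiffAt {Y : ∀ x : M, TangentSpace (𝓡 m) x} {x : M}
    (hY : SmoothField m Y x) : FieldDiffAt Y x :=
  hY.self_of_nhds.mdifferentiableAt (by simp)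

theorem SmoothField.extend {x : M} (v : TangentSpace (𝓡 m) x) :
    SmoothField m (FiberBundle.extend (EuclideanSpace ℝ (Fin m)) v) x := by
  obtain ⟨s, hs, h⟩ := FiberBundle.exists_contMDiffOn_extend (𝓡 m) (EuclideanSpace ℝ (Fin m))
    (k := ∞) v
  filter_upwards [eventually_mem_nhds_iff.2 hs] with y hy
  exact h.contMDiffAt hy

theorem SmoothField.localFrame {ι : Type*} {x : M}
    (b : Module.Basis ι ℝ (EuclideanSpace ℝ (Fin m))) (i : ι)
    (e : Trivialization (EuclideanSpace ℝ (Fin m))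
      (TotalSpace.proj : TangentBundle (𝓡 m) M → M)) [MemTrivializationAtlas e]
    (he : x ∈ e.baseSet) : SmoothField m (e.localFrame b i) x := by
  filter_upwards [e.open_baseSet.mem_nhds he] with y hy
  exact contMDiffAt_localFrame_of_mem ∞ e b i hy

/-- The derivative of a smooth function along a smooth vector field is smooth. -/
theorem SmoothFun.mvfderiv {h : N → ℝ} {V : ∀ q : N, TangentSpace (𝓡 n) q} {p : N}
    (hh : SmoothFun n h p) (hV : SmoothField n V p) :
    SmoothFun n (fun q => mvfderiv (𝓡 n) h q (V q)) p := by
  filter_upwards [hh, hV] with q h1 h2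
  have h3 := ContMDiffAt.mfderiv_const (m := ∞) h1 (by simp)
  have h4 := ContMDiffAt.clm_apply_of_inCoordinates (b₁ := fun q : N => q) (v := V)
    (b₂ := h) (ϕ := fun q => mfderiv (𝓡 n) 𝓘(ℝ) h q) h3 h2 h1
  exact (contMDiff_snd_tangentBundle_modelSpace ℝ 𝓘(ℝ, ℝ)).contMDiffAt.comp q h4

end SmoothGerms

/-! ### Traces with respect to a scalar product -/

section LinearAlgebra

variable {V W W' : Type*} [AddCommGroup V] [Module ℝ V] [AddCommGroup W] [Module ℝ W]
  [AddCommGroup W'] [Module ℝ W'] {k : ℕ}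

/-- `β` is a scalar product. -/
structure IsScalarProduct (β : V → V → ℝ) : Prop where
  bilin : IsBilinearMap ℝ β
  symm : ∀ v w, β v w = β w v
  pos : ∀ v, v ≠ 0 → 0 < β v v

namespace IsScalarProduct

variable {β : V → V → ℝ} (hβ : IsScalarProduct β) (b : Module.Basis (Fin k) ℝ V)
include hβ

theorem sub_left (v w z : V) : β (v - w) z = β v z - β w z := by
  rw [sub_eq_add_neg, hβ.bilin.add_left, ← neg_one_smul ℝ w, hβ.bilin.smul_left]
  simp [sub_eq_add_neg]

theorem sum_left {ι : Type*} (s : Finset ι) (f : ι → V) (z : V) :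
    β (∑ i ∈ s, f i) z = ∑ i ∈ s, β (f i) z :=
  map_sum (hβ.bilin.toLinearMap.flip z) f s

theorem sum_right {ι : Type*} (s : Finset ι) (f : ι → V) (z : V) :
    β z (∑ i ∈ s, f i) = ∑ i ∈ s, β z (f i) :=
  map_sum (hβ.bilin.toLinearMap z) f s

theorem eq_of_forall {v w : V} (h : ∀ z, β v z = β w z) : v = w := by
  by_contra hne
  have h1 := hβ.pos (v - w) (sub_ne_zero.2 hne)
  rw [hβ.sub_left, h, sub_self] at h1
  exact lt_irrefl _ h1

theorem eq_of_basis {v w : V} (h : ∀ i, β v (b i) = β w (b i)) : v = w := by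
  refine hβ.eq_of_forall fun z => ?_
  rw [← b.sum_repr z, hβ.sum_right, hβ.sum_right]
  simp only [hβ.bilin.smul_right, h]

theorem gram_det_ne_zero : (Matrix.of fun r s => β (b r) (b s)).det ≠ 0 := by
  intro h0
  obtain ⟨x, hx, h⟩ := Matrix.exists_mulVec_eq_zero_iff.2 h0
  have h1 : ∑ i, x i • b i = 0 := by
    refine hβ.eq_of_basis b fun i => ?_
    have h2 := congrFun h i
    simp only [Matrix.mulVec, dotProduct, Matrix.of_apply, Pi.zero_apply] at h2
    have h3 : β 0 (b i) = 0 := by simpa using hβ.bilin.smul_left 0 0 (b i)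
    rw [h3, hβ.sum_left, ← h2]
    refine Finset.sum_congr rfl fun j _ => ?_
    rw [hβ.bilin.smul_left, hβ.symm, smul_eq_mul, mul_comm]
  exact hx (funext fun i => Fintype.linearIndependent_iff.1 b.linearIndependent x h1 i)

theorem gram_inv_mul (i l : Fin k) :
    ∑ j, (Matrix.of fun r s => β (b r) (b s))⁻¹ i j * β (b j) (b l) = if i = l then 1 else 0 := by
  have h := Matrix.nonsing_inv_mul (Matrix.of fun r s => β (b r) (b s))
    (isUnit_iff_ne_zero.2 (hβ.gram_det_ne_zero b))
  have h2 := congrFun (congrFun h i) l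
  rwa [Matrix.mul_apply, Matrix.one_apply] at h2

theorem gram_inv_symm (i j : Fin k) :
    (Matrix.of fun r s => β (b r) (b s))⁻¹ i j = (Matrix.of fun r s => β (b r) (b s))⁻¹ j i := by
  have h : (Matrix.of fun r s => β (b r) (b s)).transpose = Matrix.of fun r s => β (b r) (b s) := by
    ext r s
    simp [hβ.symm]
  conv_lhs => rw [← h, ← Matrix.transpose_nonsing_inv]
  rfl

/-- The trace of `φ ⊗ id` is the vector that represents the linear form `φ`. -/
theorem metricTrace_smul_apply (φ : V →ₗ[ℝ] ℝ) (v : V) :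
    β (metricTrace b β fun a c => φ a • c) v = φ v := by
  have key : ∀ l, β (metricTrace b β fun a c => φ a • c) (b l) = φ (b l) := by
    intro l
    simp only [metricTrace, hβ.sum_left, hβ.bilin.smul_left, smul_eq_mul]
    rw [← Finset.sum_congr rfl fun i _ => Finset.sum_congr rfl fun j _ =>
      (by ring : φ (b i) * ((Matrix.of fun r s => β (b r) (b s))⁻¹ i j * β (b j) (b l)) = _)]
    simp only [← Finset.mul_sum, hβ.gram_inv_mul b]
    simp
  conv_rhs => rw [← b.sum_repr v, map_sum]
  conv_lhs => rw [← b.sum_repr v, hβ.sum_right]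
  simp only [hβ.bilin.smul_right, key, map_smul]

theorem metricTrace_smul_eq (φ : V →ₗ[ℝ] ℝ) {t : V} (ht : ∀ v, β t v = φ v) :
    (metricTrace b β fun a c => φ a • c) = t :=
  hβ.eq_of_forall fun z => by rw [hβ.metricTrace_smul_apply b, ht]

theorem metricTrace_flip (T : V → V → W) :
    (metricTrace b β fun a c => T c a) = metricTrace b β T := by
  simp only [metricTrace]
  rw [Finset.sum_comm]
  exact Finset.sum_congr rfl fun i _ => Finset.sum_congr rfl fun j _ => by
    rw [hβ.gram_inv_symm b]

omit hβ in
theorem map_metricTrace (L : W →ₗ[ℝ] W') (T : V → V → W) :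
    L (metricTrace b β T) = metricTrace b β fun a c => L (T a c) := by
  simp only [metricTrace, map_sum, map_smul]

omit hβ in
theorem metricTrace_add (T T' : V → V → W) :
    (metricTrace b β fun a c => T a c + T' a c) = metricTrace b β T + metricTrace b β T' := by
  simp only [metricTrace, smul_add, Finset.sum_add_distrib]

omit hβ in
theorem metricTrace_sub (T T' : V → V → W) :
    (metricTrace b β fun a c => T a c - T' a c) = metricTrace b β T - metricTrace b β T' := by
  simp only [metricTrace, smul_sub, Finset.sum_sub_distrib]

omit hβ in
theorem metricTrace_smul (r : ℝ) (T : V → V → W) :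
    (metricTrace b β fun a c => r • T a c) = r • metricTrace b β T := by
  simp only [metricTrace, Finset.smul_sum]
  exact Finset.sum_congr rfl fun i _ => Finset.sum_congr rfl fun j _ => smul_comm _ _ _

theorem metricTrace_left (τ : V) (T : V →ₗ[ℝ] W) :
    (metricTrace b β fun a c => β τ a • T c) = T τ := by
  have h := hβ.metricTrace_smul_eq b (hβ.bilin.toLinearMap τ) (t := τ) fun v => rfl
  conv_rhs => rw [← h, map_metricTrace]
  simp only [map_smul]
  rfl

theorem metricTrace_right (τ : V) (T : V →ₗ[ℝ] W) :
    (metricTrace b β fun a c => β τ c • T a) = T τ := by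
  rw [hβ.metricTrace_flip b (fun a c => β τ a • T c), hβ.metricTrace_left]

theorem sum_gram_inv_smul (x : V) :
    ∑ i, (∑ j, (Matrix.of fun r s => β (b r) (b s))⁻¹ i j * β (b j) x) • b i = x := by
  have h := hβ.metricTrace_right b x LinearMap.id
  simp only [metricTrace, LinearMap.id_apply, smul_smul, ← Finset.sum_smul] at h
  conv_rhs => rw [← h]
  exact Finset.sum_congr rfl fun i _ => by
    congr 1
    exact Finset.sum_congr rfl fun j _ => by rw [hβ.symm x]

/-- The trace of a bilinear map with respect to a scalar product does not depend on the basis. -/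
theorem metricTrace_basis (b' : Module.Basis (Fin k) ℝ V) {T : V → V → W}
    (hT : IsBilinearMap ℝ T) : metricTrace b' β T = metricTrace b β T := by
  let d : Fin k → V := fun i => ∑ j, (Matrix.of fun r s => β (b r) (b s))⁻¹ i j • b j
  have h1 : ∀ x, ∑ i, β (d i) x • b i = x := by
    intro x
    conv_rhs => rw [← hβ.sum_gram_inv_smul b x]
    simp only [d, hβ.sum_left, hβ.bilin.smul_left, smul_eq_mul]
  have h2 : ∀ x y, T x y = ∑ i, β (d i) x • T (b i) y := by
    intro x y
    conv_lhs => rw [← h1 x]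
    have := map_sum (hT.toLinearMap.flip y) (fun i => β (d i) x • b i) Finset.univ
    refine this.trans (Finset.sum_congr rfl fun i _ => ?_)
    exact hT.smul_left _ _ _
  have h3 : metricTrace b' β T = ∑ i, metricTrace b' β (fun a c => β (d i) a • T (b i) c) := by
    simp only [metricTrace]
    conv_rhs => rw [Finset.sum_comm]
    refine Finset.sum_congr rfl fun r _ => ?_
    conv_rhs => rw [Finset.sum_comm]
    refine Finset.sum_congr rfl fun s _ => ?_
    rw [h2, Finset.smul_sum]
  rw [h3]
  have h4 : ∀ i, metricTrace b' β (fun a c => β (d i) a • T (b i) c) = T (b i) (d i) :=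
    fun i => hβ.metricTrace_left b' (d i) (hT.toLinearMap (b i))
  rw [Finset.sum_congr rfl fun i _ => h4 i]
  simp only [metricTrace]
  refine Finset.sum_congr rfl fun i _ => ?_
  have := map_sum (hT.toLinearMap (b i))
    (fun j => (Matrix.of fun r s => β (b r) (b s))⁻¹ i j • b j) Finset.univ
  refine this.trans (Finset.sum_congr rfl fun j _ => ?_)
  exact hT.smul_right _ _ _

theorem metricTrace_self : metricTrace b β β = k := by
  have h : ∀ i, ∑ j, (Matrix.of fun r s => β (b r) (b s))⁻¹ i j • β (b i) (b j) = 1 := by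
    intro i
    have := hβ.gram_inv_mul b i i
    simp only [if_true] at this
    rw [← this]
    exact Finset.sum_congr rfl fun j _ => by rw [smul_eq_mul, hβ.symm]
  simp only [metricTrace, h]
  simp

theorem endTrace_eq (A : V → V) :
    endTrace b A = metricTrace b β fun a c => β (A a) c := by
  simp only [endTrace, metricTrace]
  refine Finset.sum_congr rfl fun i _ => ?_
  have h : ∀ j, β (A (b i)) (b j) = ∑ l, b.repr (A (b i)) l * β (b l) (b j) := by
    intro j
    conv_lhs => rw [← b.sum_repr (A (b i)), hβ.sum_left]
    simp only [hβ.bilin.smul_left, smul_eq_mul]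
  simp only [h, smul_eq_mul, Finset.mul_sum]
  rw [Finset.sum_comm]
  rw [← Finset.sum_congr rfl fun l _ => Finset.sum_congr rfl fun j _ =>
    (by rw [hβ.symm (b j)]; ring : b.repr (A (b i)) l *
      ((Matrix.of fun r s => β (b r) (b s))⁻¹ i j * β (b j) (b l)) = _)]
  simp only [← Finset.mul_sum, hβ.gram_inv_mul b]
  simp

omit hβ in
theorem metricTrace_scale {r : ℝ} (hr : r ≠ 0) (T : V → V → W) {β' : V → V → ℝ}
    (h : ∀ v w, β' v w = r * β v w) (hdet : (Matrix.of fun r s => β (b r) (b s)).det ≠ 0) :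
    metricTrace b β' T = r⁻¹ • metricTrace b β T := by
  have h1 : (Matrix.of fun i j => β' (b i) (b j)) = r • Matrix.of fun i j => β (b i) (b j) := by
    ext i j
    simp [h]
  have h2 : (r • Matrix.of fun i j => β (b i) (b j))⁻¹ =
      r⁻¹ • (Matrix.of fun i j => β (b i) (b j))⁻¹ := by
    refine Matrix.inv_eq_left_inv ?_
    rw [Matrix.smul_mul, Matrix.mul_smul, smul_smul, inv_mul_cancel₀ hr, one_smul,
      Matrix.nonsing_inv_mul _ (isUnit_iff_ne_zero.2 hdet)]
  simp only [metricTrace, h1, h2, Matrix.smul_apply, smul_assoc, Finset.smul_sum]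

/-- On a line, a bilinear map is determined by its trace. -/
theorem eq_zero_of_metricTrace_eq_zero (b : Module.Basis (Fin 1) ℝ V) {T : V → V → W}
    (hT : IsBilinearMap ℝ T) (h : metricTrace b β T = 0) (v w : V) : T v w = 0 := by
  have h1 := hβ.gram_inv_mul b 0 0
  simp only [Fin.sum_univ_one, if_true] at h1
  have h2 : T (b 0) (b 0) = 0 := by
    simp only [metricTrace, Fin.sum_univ_one] at h
    refine (smul_eq_zero.1 h).resolve_left fun h0 => ?_
    rw [h0, zero_mul] at h1
    exact zero_ne_one h1
  rw [← b.sum_repr v, ← b.sum_repr w]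
  simp [hT.smul_left, hT.smul_right, h2]

end IsScalarProduct

section EndTrace

variable (b : Module.Basis (Fin k) ℝ V)

theorem endTrace_add (A A' : V → V) :
    (endTrace b fun u => A u + A' u) = endTrace b A + endTrace b A' := by
  simp [endTrace, Finset.sum_add_distrib]

theorem endTrace_sub (A A' : V → V) :
    (endTrace b fun u => A u - A' u) = endTrace b A - endTrace b A' := by
  simp [endTrace, Finset.sum_sub_distrib]

theorem endTrace_smul (r : ℝ) (A : V → V) :
    (endTrace b fun u => r • A u) = r * endTrace b A := by
  simp [endTrace, Finset.mul_sum]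

theorem endTrace_id : (endTrace b fun u => u) = k := by
  simp [endTrace]

theorem endTrace_rankOne (φ : V →ₗ[ℝ] ℝ) (z : V) : (endTrace b fun u => φ u • z) = φ z := by
  conv_rhs => rw [← b.sum_repr z, map_sum]
  simp only [endTrace, map_smul, Finsupp.smul_apply, smul_eq_mul]
  exact Finset.sum_congr rfl fun i _ => mul_comm _ _

end EndTrace

end LinearAlgebra

/-! ### Comparing two Weyl structures -/

section Comparison

variable {m : ℕ} {M : Type*} [TopologicalSpace M] [ChartedSpace (EuclideanSpace ℝ (Fin m)) M]
  [IsManifold (𝓡 m) ∞ M]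

theorem isScalarProduct_inner (g : RiemMetric m M) (x : M) :
    IsScalarProduct (fun v w : TangentSpace (𝓡 m) x => g.inner x v w) where
  bilin :=
    { add_left := fun v w z => by simp
      smul_left := fun r v w => by simp
      add_right := fun v w z => by simp
      smul_right := fun r v w => by simp }
  symm := g.symm x
  pos := g.pos x

namespace WeylStructure

variable {c : ConformalStructure m M} (D D' : WeylStructure c) (g : c.metrics)

theorem gaugeForm_spec {Y Z : ∀ x : M, TangentSpace (𝓡 m) x} {x : M} (hY : FieldDiffAt Y x)
    (hZ : FieldDiffAt Z x) (v : TangentSpace (𝓡 m) x) :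
    mvfderiv (𝓡 m) (fun y => g.1.inner y (Y y) (Z y)) x v =
      g.1.inner x (D.cov Y x v) (Z x) + g.1.inner x (Y x) (D.cov Z x v)
        + D.gaugeForm g x v * g.1.inner x (Y x) (Z x) :=
  Classical.choose_spec (D.conformal g) Y Z x hY hZ v

theorem cov_congr {Y Z : ∀ x : M, TangentSpace (𝓡 m) x} {x : M} (hY : FieldDiffAt Y x)
    (hZ : FieldDiffAt Z x) (h : ∀ᶠ y in 𝓝 x, Y y = Z y) : D.cov Y x = D.cov Z x :=
  D.cov.isCovariantDerivativeOnUniv.congr_of_eventuallyEq hY hZ univ_mem h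

theorem cov_add {Y Z : ∀ x : M, TangentSpace (𝓡 m) x} {x : M} (hY : FieldDiffAt Y x)
    (hZ : FieldDiffAt Z x) (v : TangentSpace (𝓡 m) x) :
    D.cov (fun y => Y y + Z y) x v = D.cov Y x v + D.cov Z x v := by
  have := D.cov.isCovariantDerivativeOnUniv.add hY hZ
  exact congrArg (fun L => L v) this

theorem cov_smul {f : M → ℝ} {Z : ∀ x : M, TangentSpace (𝓡 m) x} {x : M}
    (hf : MDifferentiableAt (𝓡 m) 𝓘(ℝ) f x) (hZ : FieldDiffAt Z x) (v : TangentSpace (𝓡 m) x) :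
    D.cov (fun y => f y • Z y) x v = f x • D.cov Z x v + mvfderiv (𝓡 m) f x v • Z x := by
  have := D.cov.isCovariantDerivativeOnUniv.leibniz hZ hf
  exact congrArg (fun L => L v) this

theorem cov_const_smul (r : ℝ) {Z : ∀ x : M, TangentSpace (𝓡 m) x} {x : M}
    (hZ : FieldDiffAt Z x) (v : TangentSpace (𝓡 m) x) :
    D.cov (fun y => r • Z y) x v = r • D.cov Z x v := by
  rw [D.cov_smul (f := fun _ => r) mdifferentiableAt_const hZ, mvfderiv_const]
  simp

theorem cov_sub {Y Z : ∀ x : M, TangentSpace (𝓡 m) x} {x : M} (hY : SmoothField m Y x)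
    (hZ : SmoothField m Z x) (v : TangentSpace (𝓡 m) x) :
    D.cov (fun y => Y y - Z y) x v = D.cov Y x v - D.cov Z x v := by
  have h1 := D.cov_add (SmoothField.fieldDiffAt (hY.sub hZ)) hZ.fieldDiffAt v
  rw [eq_sub_iff_add_eq, ← h1]
  congr 2
  funext y
  exact sub_add_cancel _ _

theorem mlieBracket_eq {Y Z : ∀ x : M, TangentSpace (𝓡 m) x} {x : M} (hY : FieldDiffAt Y x)
    (hZ : FieldDiffAt Z x) :
    VectorField.mlieBracket (𝓡 m) Y Z x = D.cov Z x (Y x) - D.cov Y x (Z x) :=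
  (D.cov.torsion_eq_zero_iff.1 D.torsion_free hY hZ).symm

/-- Smooth Weyl structures differentiate smooth fields to smooth fields: a field that is smooth
near a point agrees near this point with a globally smooth one. -/
theorem cov_smoothAlong [T2Space M] {n : ℕ} {N : Type*} [TopologicalSpace N]
    [ChartedSpace (EuclideanSpace ℝ (Fin n)) N] [IsManifold (𝓡 n) ∞ N] {f : N → M} {p : N}
    (hf : ContMDiff (𝓡 n) (𝓡 m) ∞ f)
    {Y : ∀ x : M, TangentSpace (𝓡 m) x} {Z : ∀ q : N, TangentSpace (𝓡 m) (f q)}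
    (hY : SmoothField m Y (f p)) (hZ : SmoothAlong n f Z p) :
    SmoothAlong n f (fun q => D.cov Y (f q) (Z q)) p := by
  obtain ⟨U, hU, hUo, hxU⟩ := eventually_nhds_iff.1 hY
  obtain ⟨ψ, -, hψ⟩ := (SmoothBumpFunction.nhds_basis_tsupport (I := 𝓡 m) (f p)).mem_iff.1
    (hUo.mem_nhds hxU)
  have h1 : ContMDiff (𝓡 m) ((𝓡 m).prod 𝓘(ℝ, EuclideanSpace ℝ (Fin m))) ∞
      (fun y => (⟨y, ψ y • Y y⟩ : TangentBundle (𝓡 m) M)) :=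
    ContMDiffOn.smul_section_of_tsupport (s := Y) (ψ := ψ) (u := U) ψ.contMDiff.contMDiffOn hUo hψ
      fun y hy => (hU y hy).contMDiffWithinAt
  have h2 := D.smooth.contMDiff.contMDiff (σ := fun y => ψ y • Y y) (h1.contMDiffOn.of_le (by simp))
  rw [contMDiffOn_univ] at h2
  have h3 : SmoothAlong n f (fun q => D.cov (fun y => ψ y • Y y) (f q) (Z q)) p := by
    filter_upwards [hZ] with q hq
    exact ContMDiffAt.clm_bundle_apply (F₁ := EuclideanSpace ℝ (Fin m))
      (F₂ := EuclideanSpace ℝ (Fin m)) (h2.contMDiffAt.comp q (hf q)) hq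
  refine h3.congr ?_
  have h4 : ∀ᶠ y in 𝓝 (f p), D.cov Y y = D.cov (fun y => ψ y • Y y) y := by
    have hn : ∀ᶠ y in 𝓝 (f p), SmoothField m Y y := hY.near
    filter_upwards [hn, ψ.eventuallyEq_one.eventually_nhds] with y hy1 hy2
    refine D.cov_congr hy1.fieldDiffAt (h1.mdifferentiableAt (by simp)) ?_
    filter_upwards [hy2] with z hz
    simp [hz]
  filter_upwards [hf.continuous.continuousAt.eventually h4] with q hq
  rw [hq]

theorem cov_smoothField [T2Space M] {Y Z : ∀ x : M, TangentSpace (𝓡 m) x} {x : M}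
    (hY : SmoothField m Y x) (hZ : SmoothField m Z x) :
    SmoothField m (fun y => D.cov Y y (Z y)) x :=
  D.cov_smoothAlong (f := fun y : M => y) contMDiff_id hY hZ

/-- The 1-form `θ` of the conformal change from the Weyl structure `D` to `D'`, so that
`D'_v Y = D_v Y + θ(v) Y + θ(Y) v - g(v, Y) θ^♯`. -/
def lee (x : M) : TangentSpace (𝓡 m) x →L[ℝ] ℝ :=
  (1 / 2 : ℝ) • (D.gaugeForm g x - D'.gaugeForm g x)

/-- The vector field dual, with respect to `g`, to the 1-form `D.lee D' g`. -/
def leeVec (x : M) : TangentSpace (𝓡 m) x :=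
  metricTrace (stdBasis m x) (fun v w => g.1.inner x v w) fun a b => D.lee D' g x a • b

theorem gaugeForm_eq_sub (x : M) (v : TangentSpace (𝓡 m) x) :
    D'.gaugeForm g x v = D.gaugeForm g x v - 2 * D.lee D' g x v := by
  simp [lee]

theorem inner_leeVec (x : M) (v : TangentSpace (𝓡 m) x) :
    g.1.inner x (D.leeVec D' g x) v = D.lee D' g x v :=
  (isScalarProduct_inner g.1 x).metricTrace_smul_apply (stdBasis m x)
    (D.lee D' g x).toLinearMap v

/-- The difference of two Weyl structures. The difference tensor is symmetric since both
connections are torsion-free, and its metric part is `θ ⊗ g`; these two properties determine it,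
as in the uniqueness of the Levi-Civita connection. -/
theorem cov_change {Y : ∀ x : M, TangentSpace (𝓡 m) x} {x : M} (hY : FieldDiffAt Y x)
    (v : TangentSpace (𝓡 m) x) :
    D'.cov Y x v = D.cov Y x v + D.lee D' g x v • Y x + D.lee D' g x (Y x) • v
      - g.1.inner x v (Y x) • D.leeVec D' g x := by
  let A := CovariantDerivative.difference D'.cov D.cov x
  have hA : ∀ {Z : ∀ x : M, TangentSpace (𝓡 m) x}, FieldDiffAt Z x →
      ∀ w, A (Z x) w = D'.cov Z x w - D.cov Z x w := by
    intro Z hZ w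
    exact congrArg (fun L => L w) (IsCovariantDerivativeOn.difference_apply
      D'.cov.isCovariantDerivativeOnUniv D.cov.isCovariantDerivativeOnUniv (Set.mem_univ x) hZ)
  have hext : ∀ v : TangentSpace (𝓡 m) x,
      FieldDiffAt (FiberBundle.extend (EuclideanSpace ℝ (Fin m)) v) x :=
    fun v => (SmoothField.extend v).fieldDiffAt
  have hsymm : ∀ v w, A v w = A w v := by
    intro v w
    have h1 := D.mlieBracket_eq (hext v) (hext w)
    rw [D'.mlieBracket_eq (hext v) (hext w)] at h1
    have h2 := hA (hext v) w
    have h3 := hA (hext w) v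
    simp only [FiberBundle.extend_apply_self] at h1 h2 h3
    rw [h2, h3, sub_eq_sub_iff_add_eq_add]
    rw [sub_eq_sub_iff_add_eq_add] at h1
    rw [add_comm, ← h1, add_comm]
  have hmet : ∀ u v w, g.1.inner x (A v u) w + g.1.inner x v (A w u) =
      2 * D.lee D' g x u * g.1.inner x v w := by
    intro u v w
    have h1 := D.gaugeForm_spec g (hext v) (hext w) u
    rw [D'.gaugeForm_spec g (hext v) (hext w) u, D.gaugeForm_eq_sub D' g] at h1
    have h2 := hA (hext v) u
    have h3 := hA (hext w) u
    simp only [FiberBundle.extend_apply_self] at h1 h2 h3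
    rw [h2, h3, map_sub, map_sub, sub_apply]
    linarith
  have hAv := hA hY v
  rw [eq_comm, sub_eq_iff_eq_add] at hAv
  rw [hAv]
  suffices h : A (Y x) v = D.lee D' g x v • Y x + D.lee D' g x (Y x) • v
      - g.1.inner x v (Y x) • D.leeVec D' g x by rw [h]; abel
  refine (isScalarProduct_inner g.1 x).eq_of_forall fun z => ?_
  simp only [map_add, map_sub, map_smul, add_apply, sub_apply, smul_apply, smul_eq_mul,
    inner_leeVec]
  have h1 := hmet v (Y x) z
  have h2 := hmet (Y x) z v
  have h3 := hmet z v (Y x)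
  simp only [hsymm z v, hsymm z (Y x), hsymm v (Y x)] at h1 h2 h3
  rw [g.1.symm x z v] at h2
  linarith [g.1.symm x (A (Y x) v) z, g.1.symm x v (Y x), g.1.symm x (Y x) (A v z),
    g.1.symm x (A (Y x) z) v, g.1.symm x z v, g.1.symm x (Y x) z, g.1.symm x z (A v (Y x))]

theorem lee_apply_eq {Y : ∀ x : M, TangentSpace (𝓡 m) x} {x : M} (hY : FieldDiffAt Y x)
    (v : TangentSpace (𝓡 m) x) :
    D.lee D' g x v * g.1.inner x (Y x) (Y x) =
      g.1.inner x (D'.cov Y x v) (Y x) - g.1.inner x (D.cov Y x v) (Y x) := by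
  rw [D.cov_change D' g hY v]
  simp only [map_add, map_sub, map_smul, add_apply, sub_apply, smul_apply, smul_eq_mul,
    inner_leeVec]
  ring

theorem exists_smoothField_pos (hm : 0 < m) (x : M) :
    ∃ Y : ∀ x : M, TangentSpace (𝓡 m) x, SmoothField m Y x ∧ 0 < g.1.inner x (Y x) (Y x) := by
  refine ⟨FiberBundle.extend (EuclideanSpace ℝ (Fin m)) (stdBasis m x ⟨0, hm⟩),
    SmoothField.extend _, ?_⟩
  rw [FiberBundle.extend_apply_self]
  exact g.1.pos _ _ ((stdBasis m x).ne_zero _)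

/-- The dual of the 1-form of a conformal change is smooth: if `Y` is a local field without zeros,
then `D'_Y Y - D_Y Y = 2 θ(Y) Y - g(Y, Y) θ^♯` determines it. -/
theorem leeVec_smooth [T2Space M] (hm : 0 < m) (x : M) : SmoothField m (D.leeVec D' g) x := by
  obtain ⟨Y, hY, hpos⟩ := exists_smoothField_pos g hm x
  have hr : SmoothFun m (fun y => (g.1.inner y (Y y) (Y y))⁻¹) x := (hY.inner g.1 hY).inv hpos.ne'
  have hA : SmoothField m (fun y => D'.cov Y y (Y y) - D.cov Y y (Y y)) x :=
    (D'.cov_smoothField hY hY).sub (D.cov_smoothField hY hY)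
  have hth : SmoothFun m (fun y => g.1.inner y (D'.cov Y y (Y y) - D.cov Y y (Y y)) (Y y)) x :=
    hA.inner g.1 hY
  have hB : SmoothField m (fun y => (g.1.inner y (Y y) (Y y))⁻¹ •
      ((2 * ((g.1.inner y (Y y) (Y y))⁻¹ *
        g.1.inner y (D'.cov Y y (Y y) - D.cov Y y (Y y)) (Y y))) • Y y -
        (D'.cov Y y (Y y) - D.cov Y y (Y y)))) x :=
    SmoothAlong.smul hr ((SmoothAlong.smul ((SmoothFun.const 2).mul (hr.mul hth)) hY).sub hA)
  refine hB.congr ?_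
  have hn : ∀ᶠ y in 𝓝 x, SmoothField m Y y := hY.near
  have hp : ∀ᶠ y in 𝓝 x, 0 < g.1.inner y (Y y) (Y y) :=
    (hY.inner g.1 hY).mdiffAt.continuousAt.eventually_const_lt hpos
  filter_upwards [hn, hp] with y hy hpy
  have h1 := D.lee_apply_eq D' g hy.fieldDiffAt (Y y)
  rw [map_sub, sub_apply, ← h1, mul_comm _ (g.1.inner y (Y y) (Y y)), inv_mul_cancel_left₀ hpy.ne',
    D.cov_change D' g hy.fieldDiffAt (Y y)]
  have h2 : (2 * D.lee D' g y (Y y)) • Y y - (D.cov Y y (Y y) + D.lee D' g y (Y y) • Y y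
      + D.lee D' g y (Y y) • Y y - g.1.inner y (Y y) (Y y) • D.leeVec D' g y - D.cov Y y (Y y)) =
      g.1.inner y (Y y) (Y y) • D.leeVec D' g y := by
    module
  rw [h2, inv_smul_smul₀ hpy.ne']

theorem gaugeForm_smooth [T2Space M] (hm : 0 < m) {V : ∀ x : M, TangentSpace (𝓡 m) x} {x : M}
    (hV : SmoothField m V x) : SmoothFun m (fun y => D.gaugeForm g y (V y)) x := by
  obtain ⟨Y, hY, hpos⟩ := exists_smoothField_pos g hm x
  have hr : SmoothFun m (fun y => (g.1.inner y (Y y) (Y y))⁻¹) x := (hY.inner g.1 hY).inv hpos.ne'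
  have h1 : SmoothFun m (fun y => mvfderiv (𝓡 m) (fun y => g.1.inner y (Y y) (Y y)) y (V y)) x :=
    (hY.inner g.1 hY).mvfderiv hV
  have h2 : SmoothFun m (fun y => g.1.inner y (D.cov Y y (V y)) (Y y)) x :=
    (D.cov_smoothField hY hV).inner g.1 hY
  refine (hr.mul (h1.sub ((SmoothFun.const 2).mul h2))).congr ?_
  have hn : ∀ᶠ y in 𝓝 x, SmoothField m Y y := hY.near
  have hp : ∀ᶠ y in 𝓝 x, 0 < g.1.inner y (Y y) (Y y) :=
    (hY.inner g.1 hY).mdiffAt.continuousAt.eventually_const_lt hpos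
  filter_upwards [hn, hp] with y hy hpy
  rw [D.gaugeForm_spec g hy.fieldDiffAt hy.fieldDiffAt (V y), g.1.symm y (Y y) (D.cov Y y (V y)),
    eq_inv_mul_iff_mul_eq₀ hpy.ne']
  ring

/-- The vector `(∇_u θ)^♯`. Since `g` itself is not parallel, this is `∇_u θ^♯ + α(u) θ^♯`. -/
def covLeeVec (x : M) (u : TangentSpace (𝓡 m) x) : TangentSpace (𝓡 m) x :=
  D.cov (D.leeVec D' g) x u + D.gaugeForm g x u • D.leeVec D' g x

theorem mvfderiv_lee [T2Space M] (hm : 0 < m) {W : ∀ x : M, TangentSpace (𝓡 m) x} {x : M}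
    (hW : FieldDiffAt W x) (u : TangentSpace (𝓡 m) x) :
    mvfderiv (𝓡 m) (fun y => D.lee D' g y (W y)) x u =
      g.1.inner x (D.covLeeVec D' g x u) (W x) + D.lee D' g x (D.cov W x u) := by
  simp only [← inner_leeVec]
  rw [D.gaugeForm_spec g (D.leeVec_smooth D' g hm x).fieldDiffAt hW u]
  simp only [covLeeVec, map_add, map_smul, add_apply, smul_apply, smul_eq_mul]
  ring

end WeylStructure

end Comparison

/-! ### Curvature under a change of Weyl structure -/

section CurvatureChange

variable {m : ℕ} {M : Type*} [TopologicalSpace M] [ChartedSpace (EuclideanSpace ℝ (Fin m)) M]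
  [IsManifold (𝓡 m) ∞ M] [T2Space M]

namespace WeylStructure

variable {c : ConformalStructure m M} (D D' : WeylStructure c) (g : c.metrics)

/-- The second derivatives of two Weyl structures, before the commutator is taken: this is
`cov_change` applied twice. -/
theorem cov_cov_change (hm : 0 < m) {V W : ∀ x : M, TangentSpace (𝓡 m) x} {x : M}
    (hV : SmoothField m V x) (hW : SmoothField m W x) (u : TangentSpace (𝓡 m) x) :
    D'.cov (fun y => D'.cov W y (V y)) x u =
      D.cov (fun y => D.cov W y (V y)) x u
      + (g.1.inner x (D.covLeeVec D' g x u) (V x) + D.lee D' g x (D.cov V x u)) • W x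
      + D.lee D' g x (V x) • D.cov W x u
      + (g.1.inner x (D.covLeeVec D' g x u) (W x) + D.lee D' g x (D.cov W x u)) • V x
      + D.lee D' g x (W x) • D.cov V x u
      - (g.1.inner x (D.cov V x u) (W x) + g.1.inner x (V x) (D.cov W x u)) • D.leeVec D' g x
      - g.1.inner x (V x) (W x) • D.covLeeVec D' g x u
      + D.lee D' g x u • D'.cov W x (V x) + D.lee D' g x (D'.cov W x (V x)) • u
      - g.1.inner x u (D'.cov W x (V x)) • D.leeVec D' g x := by
  have ht := D.leeVec_smooth D' g hm x
  have hP : SmoothField m (fun y => D.cov W y (V y)) x := D.cov_smoothField hW hV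
  have hP' : SmoothField m (fun y => D'.cov W y (V y)) x := D'.cov_smoothField hW hV
  have hθ : ∀ {Z : ∀ x : M, TangentSpace (𝓡 m) x}, SmoothField m Z x →
      SmoothFun m (fun y => D.lee D' g y (Z y)) x := by
    intro Z hZ
    simp only [← inner_leeVec]
    exact ht.inner g.1 hZ
  have hvw : SmoothFun m (fun y => g.1.inner y (V y) (W y)) x := hV.inner g.1 hW
  have h1 : SmoothField m (fun y => D.lee D' g y (V y) • W y) x := SmoothAlong.smul (hθ hV) hW
  have h2 : SmoothField m (fun y => D.lee D' g y (W y) • V y) x := SmoothAlong.smul (hθ hW) hV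
  have h3 : SmoothField m (fun y => g.1.inner y (V y) (W y) • D.leeVec D' g y) x :=
    SmoothAlong.smul hvw ht
  have h01 : SmoothField m (fun y => D.cov W y (V y) + D.lee D' g y (V y) • W y) x := hP.add h1
  have h012 : SmoothField m (fun y => D.cov W y (V y) + D.lee D' g y (V y) • W y
      + D.lee D' g y (W y) • V y) x := h01.add h2
  have h0123 : SmoothField m (fun y => D.cov W y (V y) + D.lee D' g y (V y) • W y
      + D.lee D' g y (W y) • V y - g.1.inner y (V y) (W y) • D.leeVec D' g y) x := h012.sub h3
  rw [D.cov_change D' g hP'.fieldDiffAt u]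
  have heq : D.cov (fun y => D'.cov W y (V y)) x = D.cov (fun y => D.cov W y (V y)
      + D.lee D' g y (V y) • W y + D.lee D' g y (W y) • V y
      - g.1.inner y (V y) (W y) • D.leeVec D' g y) x := by
    refine D.cov_congr hP'.fieldDiffAt h0123.fieldDiffAt ?_
    have hn : ∀ᶠ y in 𝓝 x, SmoothField m W y := hW.near
    filter_upwards [hn] with y hy
    exact D.cov_change D' g hy.fieldDiffAt (V y)
  rw [heq, D.cov_sub h012 h3, D.cov_add h01.fieldDiffAt h2.fieldDiffAt,
    D.cov_add hP.fieldDiffAt h1.fieldDiffAt, D.cov_smul (hθ hV).mdiffAt hW.fieldDiffAt,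
    D.cov_smul (hθ hW).mdiffAt hV.fieldDiffAt, D.cov_smul hvw.mdiffAt ht.fieldDiffAt,
    D.mvfderiv_lee D' g hm hV.fieldDiffAt, D.mvfderiv_lee D' g hm hW.fieldDiffAt,
    D.gaugeForm_spec g hV.fieldDiffAt hW.fieldDiffAt]
  have hK : D.cov (D.leeVec D' g) x u =
      D.covLeeVec D' g x u - D.gaugeForm g x u • D.leeVec D' g x := by
    simp [covLeeVec]
  rw [hK]
  module

/-- The curvatures of two Weyl structures. Only `∇θ` and terms quadratic in `θ` occur. -/
theorem curvature_change (hm : 0 < m) (x : M) (u v w : TangentSpace (𝓡 m) x) :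
    D'.curvature x u v w = D.curvature x u v w
      + (g.1.inner x (D.covLeeVec D' g x u) v - g.1.inner x (D.covLeeVec D' g x v) u) • w
      + g.1.inner x (D.covLeeVec D' g x u) w • v - g.1.inner x (D.covLeeVec D' g x v) w • u
      - g.1.inner x v w • D.covLeeVec D' g x u + g.1.inner x u w • D.covLeeVec D' g x v
      + (D.lee D' g x v * D.lee D' g x w) • u - (D.lee D' g x u * D.lee D' g x w) • v
      - D.lee D' g x (D.leeVec D' g x) • (g.1.inner x v w • u - g.1.inner x u w • v)
      + (D.lee D' g x u * g.1.inner x v w - D.lee D' g x v * g.1.inner x u w)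
        • D.leeVec D' g x := by
  have hext : ∀ v : TangentSpace (𝓡 m) x,
      SmoothField m (FiberBundle.extend (EuclideanSpace ℝ (Fin m)) v) x :=
    fun v => SmoothField.extend v
  have hU := hext u
  have hV := hext v
  have hW := hext w
  simp only [curvature]
  rw [D.mlieBracket_eq hU.fieldDiffAt hV.fieldDiffAt, D.cov_cov_change D' g hm hV hW,
    D.cov_cov_change D' g hm hU hW]
  simp only [D.cov_change D' g hW.fieldDiffAt, FiberBundle.extend_apply_self]
  simp only [map_add, map_sub, map_smul, sub_apply, smul_eq_mul]
  rw [show g.1.inner x u (D.leeVec D' g x) = D.lee D' g x u by rw [g.1.symm, inner_leeVec],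
    show g.1.inner x v (D.leeVec D' g x) = D.lee D' g x v by rw [g.1.symm, inner_leeVec],
    g.1.symm x v u]
  module

end WeylStructure

end CurvatureChange

/-! ### The Schouten-Weyl tensor under a change of Weyl structure -/

section SchoutenChange

variable {m : ℕ} {M : Type*} [TopologicalSpace M] [ChartedSpace (EuclideanSpace ℝ (Fin m)) M]
  [IsManifold (𝓡 m) ∞ M]

/-- An extension of `v ∈ T_x M` to a vector field that is smooth near `x` and depends linearly on
`v`. It agrees near `x` with `FiberBundle.extend`, which is linear in `v` only near `x`. -/
def linExtend {x : M} (v : TangentSpace (𝓡 m) x) (y : M) : TangentSpace (𝓡 m) y :=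
  (trivializationAt (EuclideanSpace ℝ (Fin m)) (fun x : M => TangentSpace (𝓡 m) x) x).symmL ℝ y
    ((trivializationAt (EuclideanSpace ℝ (Fin m)) (fun x : M => TangentSpace (𝓡 m) x) x)
      ⟨x, v⟩).2

theorem linExtend_add {x : M} (v w : TangentSpace (𝓡 m) x) :
    linExtend (v + w) = fun y => linExtend v y + linExtend w y := by
  funext y
  simp only [linExtend]
  rw [((trivializationAt (EuclideanSpace ℝ (Fin m)) (fun x : M => TangentSpace (𝓡 m) x) x).linear ℝ
    (FiberBundle.mem_baseSet_trivializationAt' x)).map_add, map_add]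

theorem linExtend_smul {x : M} (r : ℝ) (v : TangentSpace (𝓡 m) x) :
    linExtend (r • v) = fun y => r • linExtend v y := by
  funext y
  simp only [linExtend]
  rw [((trivializationAt (EuclideanSpace ℝ (Fin m)) (fun x : M => TangentSpace (𝓡 m) x) x).linear ℝ
    (FiberBundle.mem_baseSet_trivializationAt' x)).map_smul, map_smul]

theorem extend_eq_linExtend {x : M} (v : TangentSpace (𝓡 m) x) :
    ∀ᶠ y in 𝓝 x, FiberBundle.extend (EuclideanSpace ℝ (Fin m)) v y = linExtend v y := by
  filter_upwards [(trivializationAt (EuclideanSpace ℝ (Fin m))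
    (fun x : M => TangentSpace (𝓡 m) x) x).open_baseSet.mem_nhds
      (FiberBundle.mem_baseSet_trivializationAt' x)] with y hy
  simp only [FiberBundle.extend, linExtend]
  exact (Trivialization.symmL_apply (R := ℝ) _ hy _).symm

@[simp]
theorem linExtend_self {x : M} (v : TangentSpace (𝓡 m) x) : linExtend v x = v := by
  rw [← (extend_eq_linExtend v).self_of_nhds, FiberBundle.extend_apply_self]

theorem SmoothField.linExtend {x : M} (v : TangentSpace (𝓡 m) x) :
    SmoothField m (linExtend v) x :=
  (SmoothField.extend v).congr ((extend_eq_linExtend v).mono fun _ h => h.symm)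

/-- On orthogonal pairs, removing the trace has no effect. -/
theorem symTraceFree_of_orthogonal (g : RiemMetric m M) (x : M)
    (A : TangentSpace (𝓡 m) x → TangentSpace (𝓡 m) x → ℝ) {v w : TangentSpace (𝓡 m) x}
    (hvw : g.inner x v w = 0) : symTraceFree g x A v w = (A v w + A w v) / 2 := by
  simp [symTraceFree, hvw]

variable [T2Space M]

namespace WeylStructure

variable {c : ConformalStructure m M} (D D' : WeylStructure c) (g : c.metrics)

theorem curvature_swap (x : M) (u v w : TangentSpace (𝓡 m) x) :
    D.curvature x u v w = -D.curvature x v u w := by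
  simp only [curvature]
  rw [VectorField.mlieBracket_swap_apply, map_neg]
  abel

theorem curvature_eq_linExtend (x : M) (u v w : TangentSpace (𝓡 m) x) :
    D.curvature x u v w =
      D.cov (fun y => D.cov (linExtend w) y (linExtend v y)) x u
        - D.cov (fun y => D.cov (linExtend w) y (linExtend u y)) x v
        - D.cov (linExtend w) x (VectorField.mlieBracket (𝓡 m) (linExtend u) (linExtend v) x) := by
  have key : ∀ u v : TangentSpace (𝓡 m) x,
      D.cov (fun y => D.cov (FiberBundle.extend (EuclideanSpace ℝ (Fin m)) w) y
        (FiberBundle.extend (EuclideanSpace ℝ (Fin m)) v y)) x =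
      D.cov (fun y => D.cov (linExtend w) y (linExtend v y)) x := by
    intro u v
    refine D.cov_congr
      (SmoothField.fieldDiffAt (D.cov_smoothField (SmoothField.extend w) (SmoothField.extend v)))
      (SmoothField.fieldDiffAt
        (D.cov_smoothField (SmoothField.linExtend w) (SmoothField.linExtend v))) ?_
    have hn : ∀ᶠ y in 𝓝 x, SmoothField m
        (FiberBundle.extend (EuclideanSpace ℝ (Fin m)) w) y := (SmoothField.extend w).near
    have hn' : ∀ᶠ y in 𝓝 x, SmoothField m (linExtend w) y := (SmoothField.linExtend w).near
    filter_upwards [hn, hn', (extend_eq_linExtend w).eventually_nhds, extend_eq_linExtend v]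
      with y h1 h2 h3 h4
    rw [D.cov_congr h1.fieldDiffAt h2.fieldDiffAt h3, h4]
  simp only [curvature]
  rw [key u v, key v u, D.cov_congr (SmoothField.fieldDiffAt (SmoothField.extend w))
      (SmoothField.fieldDiffAt (SmoothField.linExtend w)) (extend_eq_linExtend w),
    Filter.EventuallyEq.mlieBracket_vectorField_eq (extend_eq_linExtend u) (extend_eq_linExtend v)]

theorem curvature_add_middle (x : M) (u v v' w : TangentSpace (𝓡 m) x) :
    D.curvature x u (v + v') w = D.curvature x u v w + D.curvature x u v' w := by
  have hext : ∀ v : TangentSpace (𝓡 m) x,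
      SmoothField m (linExtend v) x :=
    fun v => SmoothField.linExtend v
  have h1 := D.cov_smoothField (hext w) (hext v)
  have h2 := D.cov_smoothField (hext w) (hext v')
  simp only [curvature_eq_linExtend, linExtend_add, map_add]
  rw [D.cov_add h1.fieldDiffAt h2.fieldDiffAt]
  have h3 := VectorField.mlieBracket_add_right (I := 𝓡 m)
    (V := linExtend u) (hext v).fieldDiffAt
    (hext v').fieldDiffAt
  have h4 : VectorField.mlieBracket (𝓡 m) (linExtend u)
      (fun y => linExtend v y +
        linExtend v' y) x = _ := h3
  rw [h4, map_add]
  abel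

theorem curvature_smul_middle (x : M) (r : ℝ) (u v w : TangentSpace (𝓡 m) x) :
    D.curvature x u (r • v) w = r • D.curvature x u v w := by
  have hext : ∀ v : TangentSpace (𝓡 m) x,
      SmoothField m (linExtend v) x :=
    fun v => SmoothField.linExtend v
  have h1 := D.cov_smoothField (hext w) (hext v)
  simp only [curvature_eq_linExtend, linExtend_smul, map_smul]
  rw [D.cov_const_smul r h1.fieldDiffAt]
  have h3 := VectorField.mlieBracket_const_smul_right (I := 𝓡 m) (c := r)
    (V := linExtend u) (hext v).fieldDiffAt
  have h4 : VectorField.mlieBracket (𝓡 m) (linExtend u)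
      (fun y => r • linExtend v y) x = _ := h3
  rw [h4, map_smul]
  module

theorem curvature_add_right (x : M) (u v w w' : TangentSpace (𝓡 m) x) :
    D.curvature x u v (w + w') = D.curvature x u v w + D.curvature x u v w' := by
  have hext : ∀ v : TangentSpace (𝓡 m) x,
      SmoothField m (linExtend v) x :=
    fun v => SmoothField.linExtend v
  have key : ∀ u v : TangentSpace (𝓡 m) x,
      D.cov (fun y => D.cov (fun y => linExtend w y +
        linExtend w' y) y
          (linExtend v y)) x u =
      D.cov (fun y => D.cov (linExtend w) y
          (linExtend v y)) x u +
      D.cov (fun y => D.cov (linExtend w') y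
          (linExtend v y)) x u := by
    intro u v
    have h1 := D.cov_smoothField (hext w) (hext v)
    have h2 := D.cov_smoothField (hext w') (hext v)
    rw [← D.cov_add h1.fieldDiffAt h2.fieldDiffAt]
    refine congrArg (fun L => L u) (D.cov_congr (SmoothField.fieldDiffAt
      (D.cov_smoothField ((hext w).add (hext w')) (hext v)))
      (SmoothField.fieldDiffAt (h1.add h2)) ?_)
    have hn : ∀ᶠ y in 𝓝 x, SmoothField m (linExtend w) y :=
      (hext w).near
    have hn' : ∀ᶠ y in 𝓝 x, SmoothField m (linExtend w') y :=
      (hext w').near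
    filter_upwards [hn, hn'] with y hy hy'
    exact D.cov_add hy.fieldDiffAt hy'.fieldDiffAt _
  simp only [curvature_eq_linExtend, linExtend_add, key,
    D.cov_add (hext w).fieldDiffAt (hext w').fieldDiffAt]
  abel

theorem curvature_smul_right (x : M) (r : ℝ) (u v w : TangentSpace (𝓡 m) x) :
    D.curvature x u v (r • w) = r • D.curvature x u v w := by
  have hext : ∀ v : TangentSpace (𝓡 m) x,
      SmoothField m (linExtend v) x :=
    fun v => SmoothField.linExtend v
  have key : ∀ u v : TangentSpace (𝓡 m) x,
      D.cov (fun y => D.cov (fun y => r • linExtend w y) y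
          (linExtend v y)) x u =
      r • D.cov (fun y => D.cov (linExtend w) y
          (linExtend v y)) x u := by
    intro u v
    have h1 := D.cov_smoothField (hext w) (hext v)
    rw [← D.cov_const_smul r h1.fieldDiffAt]
    refine congrArg (fun L => L u) (D.cov_congr (SmoothField.fieldDiffAt
      (D.cov_smoothField ((hext w).const_smul r) (hext v)))
      (SmoothField.fieldDiffAt (h1.const_smul r)) ?_)
    have hn : ∀ᶠ y in 𝓝 x, SmoothField m (linExtend w) y :=
      (hext w).near
    filter_upwards [hn] with y hy
    exact D.cov_const_smul r hy.fieldDiffAt _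
  simp only [curvature_eq_linExtend, linExtend_smul, key, D.cov_const_smul r (hext w).fieldDiffAt]
  module

theorem isBilinearMap_ricci (x : M) : IsBilinearMap ℝ (D.ricci x) where
  add_left v v' w := by simp only [ricci, curvature_add_middle, endTrace_add]
  smul_left r v w := by simp only [ricci, curvature_smul_middle, endTrace_smul, smul_eq_mul]
  add_right v w w' := by simp only [ricci, curvature_add_right, endTrace_add]
  smul_right r v w := by simp only [ricci, curvature_smul_right, endTrace_smul, smul_eq_mul]

theorem isBilinearMap_faraday (x : M) : IsBilinearMap ℝ (D.faraday x) := by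
  have hswap : ∀ v w, D.faraday x v w = -D.faraday x w v := by
    intro v w
    simp only [faraday, D.curvature_swap x v w, ← neg_one_smul ℝ (D.curvature x w v _),
      endTrace_smul]
    ring
  have hadd : ∀ v w w', D.faraday x v (w + w') = D.faraday x v w + D.faraday x v w' := by
    intro v w w'
    simp only [faraday, curvature_add_middle, endTrace_add]
    ring
  have hsmul : ∀ (r : ℝ) v w, D.faraday x v (r • w) = r • D.faraday x v w := by
    intro r v w
    simp only [faraday, curvature_smul_middle, endTrace_smul, smul_eq_mul]
    ring
  exact
    { add_left := fun v v' w => by rw [hswap, hadd, hswap w v, hswap w v']; ring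
      smul_left := fun r v w => by rw [hswap, hsmul, hswap w v, smul_neg, neg_neg]
      add_right := hadd
      smul_right := hsmul }

/-- The covariant derivative `(∇_u θ)(v)` of the 1-form `θ` of the change from `D` to `D'`. -/
def covLee (x : M) : TangentSpace (𝓡 m) x →L[ℝ] TangentSpace (𝓡 m) x →L[ℝ] ℝ :=
  g.1.inner x ∘L (D.cov (D.leeVec D' g) x + (D.gaugeForm g x).smulRight (D.leeVec D' g x))

theorem inner_covLeeVec (x : M) (u v : TangentSpace (𝓡 m) x) :
    g.1.inner x (D.covLeeVec D' g x u) v = D.covLee D' g x u v :=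
  rfl

/-- The Ricci tensors of two Weyl structures, on orthogonal pairs. The trace of `∇θ` only enters
in the multiple of `g`, which is not seen on such pairs. -/
theorem ricci_change (hm : 0 < m) (x : M) {v w : TangentSpace (𝓡 m) x}
    (hvw : g.1.inner x v w = 0) :
    D'.ricci x v w = D.ricci x v w + D.covLee D' g x w v + (1 - m) * D.covLee D' g x v w
      + (m - 2) * (D.lee D' g x v * D.lee D' g x w) := by
  have h1 : ∀ z a, endTrace (stdBasis m x) (fun u => D.covLee D' g x u a • z)
      = D.covLee D' g x z a := fun z a =>
    endTrace_rankOne (stdBasis m x)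
      { toFun := fun u => D.covLee D' g x u a
        map_add' := fun u u' => by rw [map_add]; rfl
        map_smul' := fun r u => by rw [map_smul]; rfl } z
  have h2 : ∀ z a, endTrace (stdBasis m x) (fun u => g.1.inner x u a • z)
      = g.1.inner x z a := fun z a =>
    endTrace_rankOne (stdBasis m x)
      { toFun := fun u => g.1.inner x u a
        map_add' := fun u u' => by rw [map_add]; rfl
        map_smul' := fun r u => by rw [map_smul]; rfl } z
  have h3 : ∀ z, endTrace (stdBasis m x) (fun u => D.lee D' g x u • z)
      = D.lee D' g x z := fun z =>
    endTrace_rankOne (stdBasis m x) (D.lee D' g x).toLinearMap z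
  have h4 : ∀ u, D'.curvature x u v w = D.curvature x u v w
      + D.covLee D' g x u v • w - D.covLee D' g x v u • w
      + D.covLee D' g x u w • v - D.covLee D' g x v w • u + g.1.inner x u w • D.covLeeVec D' g x v
      + (D.lee D' g x v * D.lee D' g x w) • u - D.lee D' g x w • (D.lee D' g x u • v)
      + D.lee D' g x (D.leeVec D' g x) • (g.1.inner x u w • v)
      - D.lee D' g x v • (g.1.inner x u w • D.leeVec D' g x) := by
    intro u
    rw [D.curvature_change D' g hm, hvw]
    simp only [inner_covLeeVec, zero_smul, mul_zero, zero_sub, sub_zero]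
    module
  have h5 : endTrace (stdBasis m x) (fun u => D.covLee D' g x v u • w)
      = D.covLee D' g x v w :=
    endTrace_rankOne (stdBasis m x) (D.covLee D' g x v).toLinearMap w
  have h6 : ∀ r : ℝ, endTrace (stdBasis m x) (fun u => r • u) = r * m := fun r => by
    rw [endTrace_smul (stdBasis m x) r fun u => u, endTrace_id]
  simp only [ricci, h4, endTrace_add, endTrace_sub, h6, endTrace_smul, h1, h2, h3, h5,
    inner_covLeeVec, hvw, inner_leeVec]
  ring

/-- The Faraday form changes by the exterior derivative of `θ`. -/
theorem faraday_change (hm : 0 < m) (x : M) (v w : TangentSpace (𝓡 m) x) :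
    D'.faraday x v w = D.faraday x v w + D.covLee D' g x v w - D.covLee D' g x w v := by
  have h2 : ∀ z a, endTrace (stdBasis m x) (fun u => g.1.inner x a u • z)
      = g.1.inner x a z := fun z a =>
    endTrace_rankOne (stdBasis m x) (g.1.inner x a).toLinearMap z
  have h3 : ∀ z, endTrace (stdBasis m x) (fun u => D.lee D' g x u • z)
      = D.lee D' g x z := fun z =>
    endTrace_rankOne (stdBasis m x) (D.lee D' g x).toLinearMap z
  have h5 : ∀ a z, endTrace (stdBasis m x) (fun u => D.covLee D' g x a u • z)
      = D.covLee D' g x a z := fun a z =>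
    endTrace_rankOne (stdBasis m x) (D.covLee D' g x a).toLinearMap z
  have h4 : ∀ u, D'.curvature x v w u = D.curvature x v w u
      + (D.covLee D' g x v w - D.covLee D' g x w v) • u
      + D.covLee D' g x v u • w - D.covLee D' g x w u • v
      - g.1.inner x w u • D.covLeeVec D' g x v + g.1.inner x v u • D.covLeeVec D' g x w
      + D.lee D' g x w • (D.lee D' g x u • v) - D.lee D' g x v • (D.lee D' g x u • w)
      - D.lee D' g x (D.leeVec D' g x) • (g.1.inner x w u • v)
      + D.lee D' g x (D.leeVec D' g x) • (g.1.inner x v u • w)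
      + D.lee D' g x v • (g.1.inner x w u • D.leeVec D' g x)
      - D.lee D' g x w • (g.1.inner x v u • D.leeVec D' g x) := by
    intro u
    rw [D.curvature_change D' g hm]
    simp only [inner_covLeeVec]
    module
  have h6 : ∀ r : ℝ, endTrace (stdBasis m x) (fun u => r • u) = r * m := fun r => by
    rw [endTrace_smul (stdBasis m x) r fun u => u, endTrace_id]
  have h7 : ∀ a b, g.1.inner x a (D.covLeeVec D' g x b) = D.covLee D' g x b a := fun a b => by
    rw [g.1.symm, inner_covLeeVec]
  have h8 : ∀ a, g.1.inner x a (D.leeVec D' g x) = D.lee D' g x a := fun a => by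
    rw [g.1.symm, inner_leeVec]
  simp only [faraday, h4, endTrace_add, endTrace_sub, h6, endTrace_smul, h2, h3, h5, h7, h8]
  rw [g.1.symm x w v]
  have : (m : ℝ) ≠ 0 := by positivity
  field_simp
  ring

/-- The Hessians of the density of weight 1 that is represented by the constant 1 in terms of `g`.
The multiple of `g` in the last line is not seen on orthogonal pairs. -/
theorem hessL_change (hm : 0 < m) (x : M) (v w : TangentSpace (𝓡 m) x) :
    D'.hessL g (fun _ => 1) x v w = D.hessL g (fun _ => 1) x v w + D.covLee D' g x v w
      - D.lee D' g x v * D.lee D' g x w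
      + g.1.inner x v w * (D.lee D' g x (D.leeVec D' g x)
        - 1 / 2 * D.gaugeForm g x (D.leeVec D' g x)) := by
  have hY : SmoothField m (FiberBundle.extend (EuclideanSpace ℝ (Fin m)) w) x :=
    SmoothField.extend w
  have hα := D.gaugeForm_smooth g hm hY
  have hθ : SmoothFun m (fun y => D.lee D' g y
      (FiberBundle.extend (EuclideanSpace ℝ (Fin m)) w y)) x := by
    simp only [← inner_leeVec]
    exact (D.leeVec_smooth D' g hm x).inner g.1 hY
  have h1 : ∀ E : WeylStructure c, ∀ (y : M) (u : TangentSpace (𝓡 m) y),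
      E.covL g (fun _ => 1) y u = -(1 / 2) * E.gaugeForm g y u := by
    intro E y u
    simp only [covL, mvfderiv_const]
    simp
  have h2 : ∀ a b : ℝ, ∀ f : M → ℝ, SmoothFun m f x →
      ∀ k : M → ℝ, SmoothFun m k x →
      mvfderiv (𝓡 m) (fun y => a * f y + b * k y) x v =
        a * mvfderiv (𝓡 m) f x v + b * mvfderiv (𝓡 m) k x v := by
    intro a b f hf k hk
    rw [mvfderiv_fun_add ((SmoothFun.const a).mul hf).mdiffAt ((SmoothFun.const b).mul hk).mdiffAt,
      mvfderiv_fun_mul mdifferentiableAt_const hf.mdiffAt,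
      mvfderiv_fun_mul mdifferentiableAt_const hk.mdiffAt, mvfderiv_const, mvfderiv_const]
    simp
  simp only [hessL, h1]
  simp only [covL]
  have h3 : (fun y => -(1 / 2) * D'.gaugeForm g y
      (FiberBundle.extend (EuclideanSpace ℝ (Fin m)) w y)) =
      fun y => -(1 / 2) * D.gaugeForm g y (FiberBundle.extend (EuclideanSpace ℝ (Fin m)) w y)
        + 1 * D.lee D' g y (FiberBundle.extend (EuclideanSpace ℝ (Fin m)) w y) := by
    funext y
    rw [D.gaugeForm_eq_sub D' g]
    ring
  have h4 : (fun y => -(1 / 2) * D.gaugeForm g y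
      (FiberBundle.extend (EuclideanSpace ℝ (Fin m)) w y)) =
      fun y => -(1 / 2) * D.gaugeForm g y (FiberBundle.extend (EuclideanSpace ℝ (Fin m)) w y)
        + 0 * D.lee D' g y (FiberBundle.extend (EuclideanSpace ℝ (Fin m)) w y) := by
    funext y
    ring
  rw [h3, h4, h2 _ _ _ hα _ hθ, h2 _ _ _ hα _ hθ, D.mvfderiv_lee D' g hm hY.fieldDiffAt,
    D.cov_change D' g hY.fieldDiffAt]
  simp only [D.gaugeForm_eq_sub D' g, FiberBundle.extend_apply_self, map_add, map_sub, map_smul,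
    smul_eq_mul, inner_covLeeVec]
  ring

/-- On orthogonal pairs, the Schouten-Weyl tensor changes by `-∇θ + θ ⊗ θ`. The symmetric part of
`∇θ` comes from the Ricci tensor, or for `m = 2` from the Hessian, the antisymmetric one from the
Faraday form; neither the scalar curvature nor the metric plays a role on such pairs. -/
theorem schouten_change (S : RigidStructure c) (x : M) {v w : TangentSpace (𝓡 m) x}
    (hvw : g.1.inner x v w = 0) :
    D'.schouten S g x v w = D.schouten S g x v w - D.covLee D' g x v w
      + D.lee D' g x v * D.lee D' g x w := by
  have hm : 0 < m := by
    cases S <;> omega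
  have hwv : g.1.inner x w v = 0 := by rw [g.1.symm, hvw]
  simp only [schouten, hvw, D.faraday_change D' g hm]
  cases S with
  | ofDim h3 =>
    simp only [schoutenTraceFree, symTraceFree_of_orthogonal _ _ _ hvw,
      D.ricci_change D' g hm x hvw, D.ricci_change D' g hm x hwv]
    have : (m : ℝ) - 2 ≠ 0 := by
      have : (3 : ℝ) ≤ m := by exact_mod_cast h3
      linarith
    field_simp
    ring
  | ofMobius h2 𝓜 =>
    simp only [schoutenTraceFree, mobiusSchouten, symTraceFree_of_orthogonal _ _ _ hvw,
      D.hessL_change D' g hm, hvw, hwv]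
    ring

end WeylStructure

end SchoutenChange

/-! ### The pull-back connection along a map -/

section PullBackConnection

variable {m n : ℕ} {M : Type*} [TopologicalSpace M] [ChartedSpace (EuclideanSpace ℝ (Fin m)) M]
  [IsManifold (𝓡 m) ∞ M]
  {N : Type*} [TopologicalSpace N] [ChartedSpace (EuclideanSpace ℝ (Fin n)) N]
  [IsManifold (𝓡 n) ∞ N]

variable {f : N → M} {p : N}

/-- Induction principle for smooth sections along a map: every such section is near the given
point a combination of pull-backs of vector fields, with smooth coefficients. -/
theorem SmoothAlong.induction (hf : ContMDiff (𝓡 n) (𝓡 m) ∞ f)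
    {P : (∀ q : N, TangentSpace (𝓡 m) (f q)) → Prop}
    (hadd : ∀ Z Z', SmoothAlong n f Z p → SmoothAlong n f Z' p → P Z → P Z' →
      P fun q => Z q + Z' q)
    (hsmul : ∀ h Z, SmoothFun n h p → SmoothAlong n f Z p → P Z → P fun q => h q • Z q)
    (hcomp : ∀ Y : ∀ x : M, TangentSpace (𝓡 m) x, SmoothField m Y (f p) → P fun q => Y (f q))
    (hcongr : ∀ Z Z', SmoothAlong n f Z p → (∀ᶠ q in 𝓝 p, Z' q = Z q) → P Z → P Z')
    {Z : ∀ q : N, TangentSpace (𝓡 m) (f q)} (hZ : SmoothAlong n f Z p) : P Z := by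
  classical
  let e := trivializationAt (EuclideanSpace ℝ (Fin m)) (fun x : M => TangentSpace (𝓡 m) x) (f p)
  let b := (EuclideanSpace.basisFun (Fin m) ℝ).toBasis
  have he : f p ∈ e.baseSet := FiberBundle.mem_baseSet_trivializationAt' _
  have hE : ∀ i, SmoothField m (e.localFrame b i) (f p) := fun i => SmoothField.localFrame b i e he
  have hc : ∀ i, SmoothFun n (fun q => e.localFrameCoeff (𝓡 m) b i (f q) (Z q)) p :=
    fun i => hZ.coeff b i e he
  have hfp : ∀ᶠ q in 𝓝 p, ContMDiffAt (𝓡 n) (𝓡 m) ∞ f q := Eventually.of_forall fun q => hf q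
  have hs : ∀ s : Finset (Fin m), SmoothAlong n f
      (fun q => ∑ i ∈ s, e.localFrameCoeff (𝓡 m) b i (f q) (Z q) • e.localFrame b i (f q)) p :=
    fun s => SmoothAlong.sum hfp fun i _ => SmoothAlong.smul (hc i) (SmoothAlong.comp hf (hE i))
  have hP : ∀ s : Finset (Fin m),
      P fun q => ∑ i ∈ s, e.localFrameCoeff (𝓡 m) b i (f q) (Z q) • e.localFrame b i (f q) := by
    intro s
    induction s using Finset.induction_on with
    | empty =>
      simp only [Finset.sum_empty]
      exact hcomp (fun x => 0)
        (SmoothAlong.zero (f := fun y : M => y) (Eventually.of_forall fun y => contMDiffAt_id))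
    | insert a s ha ih =>
      simp only [Finset.sum_insert ha]
      exact hadd _ _ (SmoothAlong.smul (hc a) (SmoothAlong.comp hf (hE a))) (hs s)
        (hsmul _ _ (hc a) (SmoothAlong.comp hf (hE a)) (hcomp _ (hE a))) ih
  refine hcongr _ _ (hs Finset.univ) ?_ (hP Finset.univ)
  filter_upwards [hf.continuous.continuousAt.eventually_mem (e.open_baseSet.mem_nhds he)] with q hq
  have := e.eq_sum_localFrameCoeff_smul (I := 𝓡 m) (b := b)
    (s := FiberBundle.extend (EuclideanSpace ℝ (Fin m)) (Z q)) hq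
  rwa [FiberBundle.extend_apply_self] at this

theorem mvfderiv_congr {h k : N → ℝ} (hk : ∀ᶠ q in 𝓝 p, h q = k q) :
    mvfderiv (𝓡 n) h p = mvfderiv (𝓡 n) k p := by
  simp only [mvfderiv]
  rw [Filter.EventuallyEq.mfderiv_eq hk, hk.self_of_nhds]

namespace WeylStructure

variable {c : ConformalStructure m M} (D D' : WeylStructure c) (g : c.metrics)

variable {Z Z' : ∀ q : N, TangentSpace (𝓡 m) (f q)}

theorem covAlong_congr (h : ∀ᶠ q in 𝓝 p, Z q = Z' q) (v : TangentSpace (𝓡 n) p) :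
    D.covAlong f Z p v = D.covAlong f Z' p v := by
  simp only [covAlong]
  refine Finset.sum_congr rfl fun i _ => ?_
  rw [h.self_of_nhds, mvfderiv_congr (h.mono fun q hq => by rw [hq])]

theorem covAlong_add_vec (v w : TangentSpace (𝓡 n) p) :
    D.covAlong f Z p (v + w) = D.covAlong f Z p v + D.covAlong f Z p w := by
  simp only [covAlong, map_add, ← Finset.sum_add_distrib]
  refine Finset.sum_congr rfl fun i _ => ?_
  module

theorem covAlong_smul_vec (r : ℝ) (v : TangentSpace (𝓡 n) p) :
    D.covAlong f Z p (r • v) = r • D.covAlong f Z p v := by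
  simp only [covAlong, map_smul, Finset.smul_sum, smul_eq_mul]
  refine Finset.sum_congr rfl fun i _ => ?_
  module

theorem covAlong_add (hZ : SmoothAlong n f Z p) (hZ' : SmoothAlong n f Z' p)
    (v : TangentSpace (𝓡 n) p) :
    D.covAlong f (fun q => Z q + Z' q) p v = D.covAlong f Z p v + D.covAlong f Z' p v := by
  simp only [covAlong, map_add, ← Finset.sum_add_distrib]
  refine Finset.sum_congr rfl fun i _ => ?_
  have he := FiberBundle.mem_baseSet_trivializationAt' (F := EuclideanSpace ℝ (Fin m))
    (E := fun x : M => TangentSpace (𝓡 m) x) (f p)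
  rw [mvfderiv_fun_add (hZ.coeff _ i _ he).mdiffAt (hZ'.coeff _ i _ he).mdiffAt, add_apply]
  module

theorem covAlong_smul {h : N → ℝ} (hh : SmoothFun n h p) (hZ : SmoothAlong n f Z p)
    (v : TangentSpace (𝓡 n) p) :
    D.covAlong f (fun q => h q • Z q) p v =
      mvfderiv (𝓡 n) h p v • Z p + h p • D.covAlong f Z p v := by
  have he := FiberBundle.mem_baseSet_trivializationAt' (F := EuclideanSpace ℝ (Fin m))
    (E := fun x : M => TangentSpace (𝓡 m) x) (f p)
  have h1 := Trivialization.eq_sum_localFrameCoeff_smul (I := 𝓡 m)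
    (b := (EuclideanSpace.basisFun (Fin m) ℝ).toBasis)
    (s := FiberBundle.extend (EuclideanSpace ℝ (Fin m)) (Z p)) he
  rw [FiberBundle.extend_apply_self] at h1
  simp only [covAlong]
  conv_rhs => rw [h1]
  simp only [map_smul, Finset.smul_sum, ← Finset.sum_add_distrib, smul_eq_mul]
  refine Finset.sum_congr rfl fun i _ => ?_
  rw [mvfderiv_fun_mul hh.mdiffAt (hZ.coeff _ i _ he).mdiffAt]
  simp only [add_apply, smul_apply, smul_eq_mul]
  rw [← h1]
  module

theorem covAlong_const_smul (r : ℝ) (hZ : SmoothAlong n f Z p) (v : TangentSpace (𝓡 n) p) :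
    D.covAlong f (fun q => r • Z q) p v = r • D.covAlong f Z p v := by
  rw [D.covAlong_smul (SmoothFun.const r) hZ, mvfderiv_const]
  simp

theorem covAlong_sub (hZ : SmoothAlong n f Z p) (hZ' : SmoothAlong n f Z' p)
    (v : TangentSpace (𝓡 n) p) :
    D.covAlong f (fun q => Z q - Z' q) p v = D.covAlong f Z p v - D.covAlong f Z' p v := by
  rw [eq_sub_iff_add_eq, ← D.covAlong_add (hZ.sub hZ') hZ']
  simp only [sub_add_cancel]

theorem covAlong_zero (v : TangentSpace (𝓡 n) p) :
    D.covAlong f (fun _ => 0) p v = 0 := by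
  simp [covAlong, mvfderiv_const]

theorem covAlong_sum (hf : ContMDiff (𝓡 n) (𝓡 m) ∞ f) {κ : Type*} {s : Finset κ}
    {Z : κ → ∀ q : N, TangentSpace (𝓡 m) (f q)}
    (hZ : ∀ i ∈ s, SmoothAlong n f (Z i) p) (v : TangentSpace (𝓡 n) p) :
    D.covAlong f (fun q => ∑ i ∈ s, Z i q) p v = ∑ i ∈ s, D.covAlong f (Z i) p v := by
  classical
  induction s using Finset.induction_on with
  | empty => simp [covAlong_zero]
  | insert a s ha ih =>
    simp only [Finset.sum_insert ha]
    rw [D.covAlong_add (hZ a (by simp)) (SmoothAlong.sum (Eventually.of_forall fun q => hf q)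
      fun i hi => hZ i (by simp [hi])), ih fun i hi => hZ i (by simp [hi])]

theorem covAlong_comp (hf : ContMDiff (𝓡 n) (𝓡 m) ∞ f) {Y : ∀ x : M, TangentSpace (𝓡 m) x}
    (hY : SmoothField m Y (f p)) (v : TangentSpace (𝓡 n) p) :
    D.covAlong f (fun q => Y (f q)) p v = D.cov Y (f p) (dmap f p v) := by
  classical
  let e := trivializationAt (EuclideanSpace ℝ (Fin m)) (fun x : M => TangentSpace (𝓡 m) x) (f p)
  let b := (EuclideanSpace.basisFun (Fin m) ℝ).toBasis
  have he : f p ∈ e.baseSet := FiberBundle.mem_baseSet_trivializationAt' _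
  have hE : ∀ i, SmoothField m (e.localFrame b i) (f p) := fun i => SmoothField.localFrame b i e he
  have hc : ∀ i, SmoothFun m (fun y => e.localFrameCoeff (𝓡 m) b i y (Y y)) (f p) :=
    fun i => hY.coeff b i e he
  have hid : ∀ᶠ y in 𝓝 (f p), ContMDiffAt (𝓡 m) (𝓡 m) ∞ (fun y : M => y) y :=
    Eventually.of_forall fun y => contMDiffAt_id
  have hs : ∀ s : Finset (Fin m), SmoothField m
      (fun y => ∑ i ∈ s, e.localFrameCoeff (𝓡 m) b i y (Y y) • e.localFrame b i y) (f p) :=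
    fun s => SmoothAlong.sum hid fun i _ => SmoothAlong.smul (hc i) (hE i)
  have hcov : ∀ s : Finset (Fin m), ∀ u, D.cov
      (fun y => ∑ i ∈ s, e.localFrameCoeff (𝓡 m) b i y (Y y) • e.localFrame b i y) (f p) u =
      ∑ i ∈ s, (e.localFrameCoeff (𝓡 m) b i (f p) (Y (f p)) • D.cov (e.localFrame b i) (f p) u +
        mvfderiv (𝓡 m) (fun y => e.localFrameCoeff (𝓡 m) b i y (Y y)) (f p) u •
          e.localFrame b i (f p)) := by
    intro s u
    induction s using Finset.induction_on with
    | empty =>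
      simp only [Finset.sum_empty]
      have := D.cov_const_smul 0 hY.fieldDiffAt u
      simpa using this
    | insert a s ha ih =>
      simp only [Finset.sum_insert ha]
      rw [D.cov_add (SmoothField.fieldDiffAt (SmoothAlong.smul (hc a) (hE a)))
        (SmoothField.fieldDiffAt (hs s)), ih, D.cov_smul (hc a).mdiffAt (hE a).fieldDiffAt]
  have h1 : D.cov Y (f p) = D.cov (fun y => ∑ i, e.localFrameCoeff (𝓡 m) b i y (Y y) •
      e.localFrame b i y) (f p) :=
    D.cov_congr hY.fieldDiffAt (hs Finset.univ).fieldDiffAt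
      (e.eventually_eq_localFrame_sum_coeff_smul b he)
  rw [h1, hcov]
  simp only [covAlong]
  refine Finset.sum_congr rfl fun i _ => ?_
  have h2 := mvfderiv_comp_apply (g := fun y => e.localFrameCoeff (𝓡 m) b i y (Y y)) (f := f) p
    (hc i).mdiffAt (hf.mdifferentiable (by simp) p) v
  have h3 : mvfderiv (𝓡 n) (fun q => e.localFrameCoeff (𝓡 m) b i (f q) (Y (f q))) p v = _ := h2
  rw [add_comm]
  congr 1
  exact congrArg (fun r : ℝ => r • e.localFrame b i (f p)) h3

/-- The metric part of the pull-back connection. -/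
theorem mvfderiv_inner_along (hf : ContMDiff (𝓡 n) (𝓡 m) ∞ f) (hZ : SmoothAlong n f Z p)
    (hZ' : SmoothAlong n f Z' p) (v : TangentSpace (𝓡 n) p) :
    mvfderiv (𝓡 n) (fun q => g.1.inner (f q) (Z q) (Z' q)) p v =
      g.1.inner (f p) (D.covAlong f Z p v) (Z' p) + g.1.inner (f p) (Z p) (D.covAlong f Z' p v)
        + D.gaugeForm g (f p) (dmap f p v) * g.1.inner (f p) (Z p) (Z' p) := by
  -- The identity is additive and satisfies the Leibniz rule in each variable.
  have main : ∀ Z' : ∀ q : N, TangentSpace (𝓡 m) (f q), SmoothAlong n f Z' p →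
      (∀ Y : ∀ x : M, TangentSpace (𝓡 m) x, SmoothField m Y (f p) →
        mvfderiv (𝓡 n) (fun q => g.1.inner (f q) (Y (f q)) (Z' q)) p v =
        g.1.inner (f p) (D.covAlong f (fun q => Y (f q)) p v) (Z' p)
          + g.1.inner (f p) (Y (f p)) (D.covAlong f Z' p v)
          + D.gaugeForm g (f p) (dmap f p v) * g.1.inner (f p) (Y (f p)) (Z' p)) →
      ∀ Z : ∀ q : N, TangentSpace (𝓡 m) (f q), SmoothAlong n f Z p →
        mvfderiv (𝓡 n) (fun q => g.1.inner (f q) (Z q) (Z' q)) p v =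
        g.1.inner (f p) (D.covAlong f Z p v) (Z' p) + g.1.inner (f p) (Z p) (D.covAlong f Z' p v)
          + D.gaugeForm g (f p) (dmap f p v) * g.1.inner (f p) (Z p) (Z' p) := by
    intro Z' hZ' hY Z hZ
    refine SmoothAlong.induction hf (P := fun Z =>
      mvfderiv (𝓡 n) (fun q => g.1.inner (f q) (Z q) (Z' q)) p v =
        g.1.inner (f p) (D.covAlong f Z p v) (Z' p) + g.1.inner (f p) (Z p) (D.covAlong f Z' p v)
          + D.gaugeForm g (f p) (dmap f p v) * g.1.inner (f p) (Z p) (Z' p))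
      ?_ ?_ hY ?_ hZ
    · intro Z₁ Z₂ h1 h2 e1 e2
      simp only [map_add, add_apply]
      rw [mvfderiv_fun_add (h1.inner g.1 hZ').mdiffAt (h2.inner g.1 hZ').mdiffAt,
        D.covAlong_add h1 h2, add_apply, e1, e2, map_add, add_apply]
      ring
    · intro h Z₁ hh h1 e1
      simp only [map_smul, smul_apply, smul_eq_mul]
      rw [mvfderiv_fun_mul hh.mdiffAt (h1.inner g.1 hZ').mdiffAt,
        D.covAlong_smul hh h1]
      simp only [map_smul, smul_apply, map_add, add_apply, e1, smul_eq_mul]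
      ring
    · intro Z₁ Z₂ h1 h2 e1
      rw [D.covAlong_congr h2, h2.self_of_nhds, ← e1]
      have h3 : ∀ᶠ q in 𝓝 p, g.1.inner (f q) (Z₂ q) (Z' q) = g.1.inner (f q) (Z₁ q) (Z' q) :=
        h2.mono fun q hq => by rw [hq]
      exact congrArg (fun L => L v) (mvfderiv_congr h3)
  have hsymm : ∀ q (a b : TangentSpace (𝓡 m) (f q)), g.1.inner (f q) a b = g.1.inner (f q) b a :=
    fun q => g.1.symm (f q)
  refine main Z' hZ' (fun Y hY => ?_) Z hZ
  have hYf : SmoothAlong n f (fun q => Y (f q)) p := SmoothAlong.comp hf hY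
  have h2 := main (fun q => Y (f q)) hYf (fun X hX => ?_) Z' hZ'
  · have h3 : (fun q => g.1.inner (f q) (Y (f q)) (Z' q)) =
        fun q => g.1.inner (f q) (Z' q) (Y (f q)) := funext fun q => hsymm q _ _
    rw [h3, h2, hsymm p (Y (f p)), hsymm p (Y (f p)), hsymm p (Z' p)]
    ring
  · rw [D.covAlong_comp hf hX, D.covAlong_comp hf hY,
      ← D.gaugeForm_spec g hX.fieldDiffAt hY.fieldDiffAt]
    exact mvfderiv_comp_apply (g := fun y => g.1.inner y (X y) (Y y)) (f := f) p
      (SmoothAlong.inner (f := fun y : M => y) g.1 hX hY).mdiffAt (hf.mdifferentiable (by simp) p) v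

/-- Covariant derivatives of smooth sections are smooth. -/
theorem covAlong_smooth [T2Space M] (hf : ContMDiff (𝓡 n) (𝓡 m) ∞ f) (hZ : SmoothAlong n f Z p)
    {V : ∀ q : N, TangentSpace (𝓡 n) q} (hV : SmoothField n V p) :
    SmoothAlong n f (fun q => D.covAlong f Z q (V q)) p := by
  refine SmoothAlong.induction hf (P := fun Z =>
    SmoothAlong n f (fun q => D.covAlong f Z q (V q)) p) ?_ ?_ ?_ ?_ hZ
  · intro Z₁ Z₂ h1 h2 e1 e2
    refine (e1.add e2).congr ?_
    filter_upwards [h1.near, h2.near] with q hq1 hq2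
    exact D.covAlong_add hq1 hq2 (V q)
  · intro h Z₁ hh h1 e1
    refine ((SmoothAlong.smul (hh.mvfderiv hV) h1).add (SmoothAlong.smul hh e1)).congr ?_
    filter_upwards [h1.near, hh.near] with q hq1 hq2
    exact D.covAlong_smul hq2 hq1 (V q)
  · intro Y hY
    refine (D.cov_smoothAlong hf hY (SmoothAlong.push hf hV)).congr ?_
    have hn : ∀ᶠ y in 𝓝 (f p), SmoothField m Y y := hY.near
    filter_upwards [hf.continuous.continuousAt.eventually hn] with q hq
    exact D.covAlong_comp hf hq (V q)
  · intro Z₁ Z₂ h1 h2 e1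
    refine e1.congr ?_
    filter_upwards [h2.eventually_nhds] with q hq
    exact D.covAlong_congr hq (V q)

/-- The pull-back connections of two Weyl structures. -/
theorem covAlong_change (Z : ∀ q : N, TangentSpace (𝓡 m) (f q)) (v : TangentSpace (𝓡 n) p) :
    D'.covAlong f Z p v = D.covAlong f Z p v + D.lee D' g (f p) (dmap f p v) • Z p
      + D.lee D' g (f p) (Z p) • dmap f p v
      - g.1.inner (f p) (dmap f p v) (Z p) • D.leeVec D' g (f p) := by
  have he := FiberBundle.mem_baseSet_trivializationAt' (F := EuclideanSpace ℝ (Fin m))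
    (E := fun x : M => TangentSpace (𝓡 m) x) (f p)
  have h1 := Trivialization.eq_sum_localFrameCoeff_smul (I := 𝓡 m)
    (b := (EuclideanSpace.basisFun (Fin m) ℝ).toBasis)
    (s := FiberBundle.extend (EuclideanSpace ℝ (Fin m)) (Z p)) he
  rw [FiberBundle.extend_apply_self] at h1
  simp only [covAlong]
  conv_rhs =>
    rw [show D.lee D' g (f p) (dmap f p v) • Z p = _ from congrArg _ h1,
      show D.lee D' g (f p) (Z p) = _ from congrArg _ h1,
      show g.1.inner (f p) (dmap f p v) (Z p) = _ from congrArg _ h1]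
  simp only [map_sum, Finset.smul_sum, Finset.sum_smul, map_smul, ← Finset.sum_add_distrib,
    ← Finset.sum_sub_distrib]
  refine Finset.sum_congr rfl fun i _ => ?_
  rw [D.cov_change D' g (SmoothField.fieldDiffAt (SmoothField.localFrame _ i _ he))]
  simp only [smul_eq_mul]
  module

end WeylStructure

end PullBackConnection

/-! ### Symmetry of the second derivative of a map -/

section Symmetry

variable {m n : ℕ} {M : Type*} [TopologicalSpace M] [ChartedSpace (EuclideanSpace ℝ (Fin m)) M]
  [IsManifold (𝓡 m) ∞ M]
  {N : Type*} [TopologicalSpace N] [ChartedSpace (EuclideanSpace ℝ (Fin n)) N]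
  [IsManifold (𝓡 n) ∞ N]

variable {f : N → M} {p : N}

/-- The components of `v ∈ T_p N` in the preferred chart at `p`. -/
def chartComponents (v : TangentSpace (𝓡 n) p) : EuclideanSpace ℝ (Fin n) :=
  ((trivializationAt (EuclideanSpace ℝ (Fin n)) (fun x : N => TangentSpace (𝓡 n) x) p) ⟨p, v⟩).2

theorem chartComponents_eq (v : TangentSpace (𝓡 n) p) :
    chartComponents v = mfderiv (𝓡 n) 𝓘(ℝ, EuclideanSpace ℝ (Fin n)) (extChartAt (𝓡 n) p) p v := by
  rw [← TangentBundle.continuousLinearMapAt_trivializationAt (mem_chart_source _ p)]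
  exact (congrFun (Trivialization.coe_linearMapAt_of_mem (R := ℝ)
    (trivializationAt (EuclideanSpace ℝ (Fin n)) (fun x : N => TangentSpace (𝓡 n) x) p)
    (FiberBundle.mem_baseSet_trivializationAt' p)) v).symm

/-- Near `p`, the field `linExtend v` is the coordinate field with the components of `v`. -/
theorem linExtend_eq_mfderivWithin (v : TangentSpace (𝓡 n) p) {y : EuclideanSpace ℝ (Fin n)}
    (hy : y ∈ (extChartAt (𝓡 n) p).target) :
    linExtend v ((extChartAt (𝓡 n) p).symm y) =
      mfderivWithin 𝓘(ℝ, EuclideanSpace ℝ (Fin n)) (𝓡 n) (extChartAt (𝓡 n) p).symm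
        (Set.range (𝓡 n)) y (chartComponents v) := by
  have h2 : (extChartAt (𝓡 n) p).symm y ∈ (chartAt (EuclideanSpace ℝ (Fin n)) p).source := by
    rw [← extChartAt_source (𝓡 n)]
    exact (extChartAt (𝓡 n) p).map_target hy
  have h3 := TangentBundle.symmL_trivializationAt (I := 𝓡 n) h2
  have h4 := (extChartAt (𝓡 n) p).right_inv hy
  simp only [linExtend]
  rw [h3]
  rw [h4]
  rfl

theorem mvfderiv_linExtend {h : N → ℝ} (v : TangentSpace (𝓡 n) p)
    {y : EuclideanSpace ℝ (Fin n)} (hy : y ∈ (extChartAt (𝓡 n) p).target)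
    (hh : MDifferentiableAt (𝓡 n) 𝓘(ℝ) h ((extChartAt (𝓡 n) p).symm y)) :
    mvfderiv (𝓡 n) h ((extChartAt (𝓡 n) p).symm y) (linExtend v ((extChartAt (𝓡 n) p).symm y)) =
      fderiv ℝ (h ∘ (extChartAt (𝓡 n) p).symm) y (chartComponents v) := by
  have h1 := mdifferentiableWithinAt_extChartAt_symm hy
  have h2 := mfderiv_comp_mfderivWithin y hh h1 (by simp [uniqueMDiffWithinAt_univ])
  rw [linExtend_eq_mfderivWithin v hy]
  have h3 : fderiv ℝ (h ∘ (extChartAt (𝓡 n) p).symm) y =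
      mfderivWithin 𝓘(ℝ, EuclideanSpace ℝ (Fin n)) 𝓘(ℝ) (h ∘ (extChartAt (𝓡 n) p).symm)
        (Set.range (𝓡 n)) y := by
    rw [mfderivWithin_eq_fderivWithin]
    simp
  rw [h3, h2]
  rfl

/-- Second derivatives in coordinates commute. -/
theorem mvfderiv_mvfderiv_linExtend_symm {h : N → ℝ} (hh : SmoothFun n h p)
    (v w : TangentSpace (𝓡 n) p) :
    mvfderiv (𝓡 n) (fun q => mvfderiv (𝓡 n) h q (linExtend v q)) p w =
      mvfderiv (𝓡 n) (fun q => mvfderiv (𝓡 n) h q (linExtend w q)) p v := by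
  have hC : ContDiffAt ℝ ∞ (h ∘ (extChartAt (𝓡 n) p).symm) (extChartAt (𝓡 n) p p) := by
    have := (contMDiffAt_iff.1 hh.self_of_nhds).2
    simpa [contDiffWithinAt_univ, chartAt_self_eq, Function.comp_def] using this
  have h2 : ((2 : ℕ∞) : ℕ∞ω) ≤ ∞ := WithTop.coe_le_coe.2 le_top
  have hsymm := hC.isSymmSndFDerivAt (by simpa using h2)
  have hD : DifferentiableAt ℝ (fderiv ℝ (h ∘ (extChartAt (𝓡 n) p).symm))
      (extChartAt (𝓡 n) p p) :=
    (hC.fderiv_right (m := 1) (by rw [one_add_one_eq_two]; exact h2)).differentiableAt (by simp)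
  have key : ∀ v w : TangentSpace (𝓡 n) p,
      mvfderiv (𝓡 n) (fun q => mvfderiv (𝓡 n) h q (linExtend v q)) p w =
      fderiv ℝ (fderiv ℝ (h ∘ (extChartAt (𝓡 n) p).symm)) (extChartAt (𝓡 n) p p)
        (chartComponents w) (chartComponents v) := by
    intro v w
    have h1 : ∀ᶠ q in 𝓝 p, mvfderiv (𝓡 n) h q (linExtend v q) =
        ((fun y => fderiv ℝ (h ∘ (extChartAt (𝓡 n) p).symm) y (chartComponents v)) ∘
          extChartAt (𝓡 n) p) q := by
      filter_upwards [extChartAt_source_mem_nhds (I := 𝓡 n) p, hh.near] with q hq hq'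
      have h2 := mvfderiv_linExtend (h := h) v ((extChartAt (𝓡 n) p).map_source hq)
        (by rw [(extChartAt (𝓡 n) p).left_inv hq]; exact hq'.mdiffAt)
      rw [(extChartAt (𝓡 n) p).left_inv hq] at h2
      exact h2
    have hG : HasFDerivAt (fun y => fderiv ℝ (h ∘ (extChartAt (𝓡 n) p).symm) y (chartComponents v))
        ((fderiv ℝ (fderiv ℝ (h ∘ (extChartAt (𝓡 n) p).symm)) (extChartAt (𝓡 n) p p)).flip
          (chartComponents v)) (extChartAt (𝓡 n) p p) :=
      (ContinuousLinearMap.apply ℝ ℝ (chartComponents v)).hasFDerivAt.comp _ hD.hasFDerivAt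
    rw [mvfderiv_congr h1, mvfderiv_comp_apply p hG.differentiableAt.mdifferentiableAt
      (mdifferentiableAt_extChartAt (mem_chart_source _ p)), ← chartComponents_eq]
    simp only [mvfderiv, mfderiv_eq_fderiv, hG.fderiv]
    rfl
  rw [key, key, hsymm]

/-- Coordinate fields commute. -/
theorem mlieBracket_linExtend (v w : TangentSpace (𝓡 n) p) :
    VectorField.mlieBracket (𝓡 n) (linExtend v) (linExtend w) p = 0 := by
  have key : ∀ v : TangentSpace (𝓡 n) p,
      (VectorField.mpullbackWithin 𝓘(ℝ, EuclideanSpace ℝ (Fin n)) (𝓡 n) (extChartAt (𝓡 n) p).symm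
        (linExtend v) (Set.range (𝓡 n))) =ᶠ[𝓝 (extChartAt (𝓡 n) p p)]
      fun _ => chartComponents v := by
    intro v
    filter_upwards [(isOpen_extChartAt_target (I := 𝓡 n) p).mem_nhds (mem_extChartAt_target p)]
      with y hy
    rw [VectorField.mpullbackWithin_apply, linExtend_eq_mfderivWithin v hy]
    exact (isInvertible_mfderivWithin_extChartAt_symm hy).inverse_apply_self _
  rw [VectorField.mlieBracket, VectorField.mlieBracketWithin_apply]
  have h1 : VectorField.lieBracketWithin ℝ
      (VectorField.mpullbackWithin 𝓘(ℝ, EuclideanSpace ℝ (Fin n)) (𝓡 n) (extChartAt (𝓡 n) p).symm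
        (linExtend v) (Set.range (𝓡 n)))
      (VectorField.mpullbackWithin 𝓘(ℝ, EuclideanSpace ℝ (Fin n)) (𝓡 n) (extChartAt (𝓡 n) p).symm
        (linExtend w) (Set.range (𝓡 n)))
      ((extChartAt (𝓡 n) p).symm ⁻¹' Set.univ ∩ Set.range (𝓡 n)) (extChartAt (𝓡 n) p p) =
      VectorField.lieBracketWithin ℝ (fun _ => chartComponents v) (fun _ => chartComponents w)
        Set.univ (extChartAt (𝓡 n) p p) := by
    have h2 : (extChartAt (𝓡 n) p).symm ⁻¹' Set.univ ∩ Set.range (𝓡 n) = Set.univ := by simp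
    rw [h2]
    exact Filter.EventuallyEq.lieBracketWithin_vectorField_eq_of_mem
      (by simpa using key v) (by simpa using key w) (Set.mem_univ _)
  have h3 : VectorField.lieBracketWithin ℝ (fun _ => chartComponents v)
      (fun _ => chartComponents w) Set.univ (extChartAt (𝓡 n) p p) = 0 := by
    simp [VectorField.lieBracketWithin]
  have h4 := h1.trans h3
  exact (congrArg _ h4).trans (map_zero _)

/-- The frame coefficients of the image of a vector field are the derivatives of the coordinate
functions of the map. -/
theorem localFrameCoeff_push (hf : ContMDiff (𝓡 n) (𝓡 m) ∞ f) (i : Fin m)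
    (V : ∀ q : N, TangentSpace (𝓡 n) q) :
    ∀ᶠ q in 𝓝 p, (trivializationAt (EuclideanSpace ℝ (Fin m))
      (fun x : M => TangentSpace (𝓡 m) x) (f p)).localFrameCoeff (𝓡 m)
        (EuclideanSpace.basisFun (Fin m) ℝ).toBasis i (f q) (push (m := m) f V q) =
      mvfderiv (𝓡 n) (fun q => extChartAt (𝓡 m) (f p) (f q) i) q (V q) := by
  have hs : ∀ᶠ y in 𝓝 (f p), y ∈ (chartAt (EuclideanSpace ℝ (Fin m)) (f p)).source :=
    (chartAt _ (f p)).open_source.mem_nhds (mem_chart_source _ _)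
  filter_upwards [hf.continuous.continuousAt.eventually hs] with q hq
  have h1 := (trivializationAt (EuclideanSpace ℝ (Fin m))
    (fun x : M => TangentSpace (𝓡 m) x) (f p)).localFrameCoeff_apply_of_mem_baseSet (I := 𝓡 m)
      (EuclideanSpace.basisFun (Fin m) ℝ).toBasis (x := f q) (by simpa using hq)
      (FiberBundle.extend (EuclideanSpace ℝ (Fin m)) (push (m := m) f V q)) i
  rw [FiberBundle.extend_apply_self] at h1
  have h2 : MDifferentiableAt (𝓡 m) 𝓘(ℝ) (fun y => extChartAt (𝓡 m) (f p) y i) (f q) :=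
    (EuclideanSpace.proj (𝕜 := ℝ) i).differentiableAt.mdifferentiableAt.comp (f q)
      (mdifferentiableAt_extChartAt hq)
  have h3 := mvfderiv_comp_apply (g := fun y => extChartAt (𝓡 m) (f p) y i) (f := f) q h2
    (hf.mdifferentiable (by simp) q) (V q)
  have h4 := mvfderiv_comp_apply (g := fun z : EuclideanSpace ℝ (Fin m) => z i)
    (f := extChartAt (𝓡 m) (f p)) (f q)
    (EuclideanSpace.proj (𝕜 := ℝ) i).differentiableAt.mdifferentiableAt
    (mdifferentiableAt_extChartAt hq) (dmap (m := m) f q (V q))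
  have h5 : mvfderiv (𝓡 n) (fun q => extChartAt (𝓡 m) (f p) (f q) i) q (V q) = _ := h3
  have h6 : mvfderiv (𝓡 m) (fun y => extChartAt (𝓡 m) (f p) y i) (f q)
    (dmap (m := m) f q (V q)) = _ := h4
  have hb : f q ∈ (trivializationAt (EuclideanSpace ℝ (Fin m))
      (fun x : M => TangentSpace (𝓡 m) x) (f p)).baseSet := by simpa using hq
  have h7 := (trivializationAt (EuclideanSpace ℝ (Fin m))
    (fun x : M => TangentSpace (𝓡 m) x) (f p)).continuousLinearMapAt_apply_of_mem (R := ℝ) hb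
      (dmap (m := m) f q (V q))
  rw [TangentBundle.continuousLinearMapAt_trivializationAt hq] at h7
  have h8 : ∀ u : EuclideanSpace ℝ (Fin m),
      mvfderiv 𝓘(ℝ, EuclideanSpace ℝ (Fin m)) (fun z : EuclideanSpace ℝ (Fin m) => z i)
        (extChartAt (𝓡 m) (f p) (f q)) u = u i := by
    intro u
    let pr : EuclideanSpace ℝ (Fin m) →L[ℝ] ℝ := EuclideanSpace.proj i
    have := pr.fderiv (x := extChartAt (𝓡 m) (f p) (f q))
    rw [← mfderiv_eq_fderiv] at this
    exact congrArg (fun L => L u) this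
  have h9 := h5.trans (h6.trans ((h8 _).trans
    (congrArg (fun u : EuclideanSpace ℝ (Fin m) => u i) h7)))
  rw [h1, h9]
  simp [Bundle.Trivialization.basisAt, push]

namespace WeylStructure

variable {c : ConformalStructure m M} (D : WeylStructure c)

theorem covAlong_push_linExtend (hf : ContMDiff (𝓡 n) (𝓡 m) ∞ f) (v w : TangentSpace (𝓡 n) p) :
    D.covAlong f (push f (linExtend v)) p w =
      ∑ i, mvfderiv (𝓡 n) (fun q => mvfderiv (𝓡 n)
          (fun q => extChartAt (𝓡 m) (f p) (f q) i) q (linExtend v q)) p w •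
        (trivializationAt (EuclideanSpace ℝ (Fin m)) (fun x : M => TangentSpace (𝓡 m) x)
          (f p)).localFrame (EuclideanSpace.basisFun (Fin m) ℝ).toBasis i (f p)
      + D.cov (linExtend (dmap f p v)) (f p) (dmap f p w) := by
  have hE : SmoothField m (linExtend (dmap (m := m) f p v)) (f p) := SmoothField.linExtend _
  rw [← D.covAlong_comp hf hE]
  simp only [covAlong, ← Finset.sum_add_distrib]
  refine Finset.sum_congr rfl fun i _ => ?_
  rw [mvfderiv_congr (localFrameCoeff_push hf i (linExtend v))]
  have h1 : ∀ᶠ q in 𝓝 p, (trivializationAt (EuclideanSpace ℝ (Fin m))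
      (fun x : M => TangentSpace (𝓡 m) x) (f p)).localFrameCoeff (𝓡 m)
        (EuclideanSpace.basisFun (Fin m) ℝ).toBasis i (f q)
          (linExtend (dmap (m := m) f p v) (f q)) =
      (EuclideanSpace.basisFun (Fin m) ℝ).toBasis.repr
        (chartComponents (dmap (m := m) f p v)) i := by
    have hs : ∀ᶠ y in 𝓝 (f p), y ∈ (trivializationAt (EuclideanSpace ℝ (Fin m))
      (fun x : M => TangentSpace (𝓡 m) x) (f p)).baseSet :=
      (trivializationAt (EuclideanSpace ℝ (Fin m))
        (fun x : M => TangentSpace (𝓡 m) x) (f p)).open_baseSet.mem_nhds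
        (FiberBundle.mem_baseSet_trivializationAt' _)
    filter_upwards [hf.continuous.continuousAt.eventually hs] with q hq
    have h1 := (trivializationAt (EuclideanSpace ℝ (Fin m))
      (fun x : M => TangentSpace (𝓡 m) x) (f p)).localFrameCoeff_eq_coeff (I := 𝓡 m)
      (b := (EuclideanSpace.basisFun (Fin m) ℝ).toBasis) (s := linExtend (dmap (m := m) f p v))
      (i := i) hq
    rw [h1]
    simp only [linExtend]
    rw [Trivialization.symmL_apply (R := ℝ) _ hq, Trivialization.apply_mk_symm _ hq]
    rfl
  rw [mvfderiv_congr h1, mvfderiv_const]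
  simp only [push, linExtend_self]
  simp

/-- The second derivative of a map is symmetric, since Weyl structures are torsion-free. -/
theorem covAlong_push_symm (hf : ContMDiff (𝓡 n) (𝓡 m) ∞ f) (v w : TangentSpace (𝓡 n) p) :
    D.covAlong f (push f (linExtend v)) p w = D.covAlong f (push f (linExtend w)) p v := by
  rw [D.covAlong_push_linExtend hf, D.covAlong_push_linExtend hf]
  congr 1
  · refine Finset.sum_congr rfl fun i _ => ?_
    have hs : ∀ᶠ y in 𝓝 (f p), y ∈ (chartAt (EuclideanSpace ℝ (Fin m)) (f p)).source :=
      (chartAt _ (f p)).open_source.mem_nhds (mem_chart_source _ _)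
    have hh : SmoothFun n (fun q => extChartAt (𝓡 m) (f p) (f q) i) p := by
      filter_upwards [hf.continuous.continuousAt.eventually hs] with q hq
      exact (EuclideanSpace.proj (𝕜 := ℝ) i).contDiff.contDiffAt.contMDiffAt.comp q
        ((contMDiffAt_extChartAt' hq).comp q (hf q))
    rw [mvfderiv_mvfderiv_linExtend_symm hh]
  · have h1 := D.mlieBracket_eq (x := f p)
      (SmoothField.fieldDiffAt (SmoothField.linExtend (dmap (m := m) f p v)))
      (SmoothField.fieldDiffAt (SmoothField.linExtend (dmap (m := m) f p w)))
    rw [mlieBracket_linExtend, linExtend_self, linExtend_self, eq_comm, sub_eq_zero] at h1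
    exact h1.symm

end WeylStructure

end Symmetry

/-! ### Tangential and normal components -/

section Components

variable {m n : ℕ} {M : Type*} [TopologicalSpace M] [ChartedSpace (EuclideanSpace ℝ (Fin m)) M]
  [IsManifold (𝓡 m) ∞ M]
  {N : Type*} [TopologicalSpace N] [ChartedSpace (EuclideanSpace ℝ (Fin n)) N]
  [IsManifold (𝓡 n) ∞ N]

/-- Immersions: the differential is injective at every point. -/
abbrev InjectiveDifferential (n m : ℕ) {M : Type*} [TopologicalSpace M]
    [ChartedSpace (EuclideanSpace ℝ (Fin m)) M] {N : Type*} [TopologicalSpace N]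
    [ChartedSpace (EuclideanSpace ℝ (Fin n)) N] (ι : N → M) : Prop :=
  ∀ p : N, Function.Injective (mfderiv (𝓡 n) (𝓡 m) ι p)

/-- The vector `ξ ∈ T_{ι p} M` is orthogonal to `T_p N`. -/
def IsNormal (n : ℕ) (g : RiemMetric m M) {N : Type*} [TopologicalSpace N]
    [ChartedSpace (EuclideanSpace ℝ (Fin n)) N] (ι : N → M) (p : N)
    (ξ : TangentSpace (𝓡 m) (ι p)) : Prop :=
  ∀ v : TangentSpace (𝓡 n) p, g.inner (ι p) ξ (dmap ι p v) = 0

variable {ι : N → M} (hι' : InjectiveDifferential n m ι) (g : RiemMetric m M)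
  {p : N}

include hι'

theorem isScalarProduct_inducedMetric (p : N) : IsScalarProduct (inducedMetric (n := n) g ι p) where
  bilin :=
    { add_left := fun v w z => by simp [inducedMetric]
      smul_left := fun r v w => by simp [inducedMetric]
      add_right := fun v w z => by simp [inducedMetric]
      smul_right := fun r v w => by simp [inducedMetric] }
  symm v w := g.symm _ _ _
  pos v hv := g.pos _ _ fun h => hv (hι' p (by rw [h, map_zero]))

/-- The tangential part is characterized by its products with tangent vectors. -/
theorem inducedMetric_tangentPart (u : TangentSpace (𝓡 m) (ι p)) (v : TangentSpace (𝓡 n) p) :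
    inducedMetric g ι p (tangentPart g ι p u) v = g.inner (ι p) u (dmap ι p v) :=
  (isScalarProduct_inducedMetric hι' g p).metricTrace_smul_apply (stdBasis n p)
    ((g.inner (ι p) u).toLinearMap ∘ₗ (dmap (m := m) ι p).toLinearMap) v

theorem tangentPart_eq {u : TangentSpace (𝓡 m) (ι p)} {t : TangentSpace (𝓡 n) p}
    (h : ∀ v, inducedMetric g ι p t v = g.inner (ι p) u (dmap ι p v)) :
    tangentPart g ι p u = t :=
  (isScalarProduct_inducedMetric hι' g p).eq_of_forall fun v => by
    rw [inducedMetric_tangentPart hι', h]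

omit hι' in
theorem tangentPart_add (u u' : TangentSpace (𝓡 m) (ι p)) :
    tangentPart (n := n) g ι p (u + u') = tangentPart g ι p u + tangentPart g ι p u' := by
  simp only [tangentPart, map_add, add_apply, add_smul, IsScalarProduct.metricTrace_add]

omit hι' in
theorem tangentPart_smul (r : ℝ) (u : TangentSpace (𝓡 m) (ι p)) :
    tangentPart (n := n) g ι p (r • u) = r • tangentPart g ι p u := by
  simp only [tangentPart, map_smul, smul_apply, smul_eq_mul, mul_smul,
    IsScalarProduct.metricTrace_smul]

omit hι' in
theorem tangentPart_sub (u u' : TangentSpace (𝓡 m) (ι p)) :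
    tangentPart (n := n) g ι p (u - u') = tangentPart g ι p u - tangentPart g ι p u' := by
  simp only [tangentPart, map_sub, sub_apply, sub_smul, IsScalarProduct.metricTrace_sub]

theorem tangentPart_dmap (v : TangentSpace (𝓡 n) p) :
    tangentPart g ι p (dmap ι p v) = v :=
  tangentPart_eq hι' g fun _ => rfl

theorem isNormal_normalPart (u : TangentSpace (𝓡 m) (ι p)) :
    IsNormal n g ι p (normalPart (n := n) g ι p u) := by
  intro v
  simp only [normalPart, map_sub, sub_apply]
  rw [← inducedMetric_tangentPart hι' g u v]
  exact sub_self _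

omit hι' in
theorem normalPart_add (u u' : TangentSpace (𝓡 m) (ι p)) :
    normalPart (n := n) g ι p (u + u') =
      normalPart (n := n) g ι p u + normalPart (n := n) g ι p u' := by
  simp only [normalPart, tangentPart_add, map_add]
  abel

omit hι' in
theorem normalPart_sub (u u' : TangentSpace (𝓡 m) (ι p)) :
    normalPart (n := n) g ι p (u - u') =
      normalPart (n := n) g ι p u - normalPart (n := n) g ι p u' := by
  simp only [normalPart, tangentPart_sub, map_sub]
  abel

omit hι' in
theorem normalPart_smul (r : ℝ) (u : TangentSpace (𝓡 m) (ι p)) :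
    normalPart (n := n) g ι p (r • u) = r • normalPart (n := n) g ι p u := by
  simp only [normalPart, tangentPart_smul, map_smul, smul_sub]

/-- The normal component, as a linear map. -/
def normalPartₗ (n : ℕ) (g : RiemMetric m M) {N : Type*} [TopologicalSpace N]
    [ChartedSpace (EuclideanSpace ℝ (Fin n)) N] [IsManifold (𝓡 n) ∞ N] (ι : N → M) (p : N) :
    TangentSpace (𝓡 m) (ι p) →ₗ[ℝ] TangentSpace (𝓡 m) (ι p) where
  toFun := normalPart (n := n) g ι p
  map_add' := normalPart_add g
  map_smul' := normalPart_smul g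

theorem normalPart_dmap (v : TangentSpace (𝓡 n) p) :
    normalPart (n := n) g ι p (dmap ι p v) = 0 := by
  simp only [normalPart, tangentPart_dmap hι' g, sub_self]

theorem normalPart_of_isNormal {ξ : TangentSpace (𝓡 m) (ι p)} (h : IsNormal n g ι p ξ) :
    normalPart (n := n) g ι p ξ = ξ := by
  have : tangentPart (n := n) g ι p ξ = 0 :=
    tangentPart_eq hι' g fun v => by rw [h v]; simp [inducedMetric]
  simp [normalPart, this]

omit hι' in
theorem inner_normalPart {ξ : TangentSpace (𝓡 m) (ι p)} (h : IsNormal n g ι p ξ)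
    (u : TangentSpace (𝓡 m) (ι p)) :
    g.inner (ι p) ξ (normalPart (n := n) g ι p u) = g.inner (ι p) ξ u := by
  simp only [normalPart, map_sub, h _, sub_zero]

omit hι' in
theorem inner_normalPart_left {ξ : TangentSpace (𝓡 m) (ι p)} (h : IsNormal n g ι p ξ)
    (u : TangentSpace (𝓡 m) (ι p)) :
    g.inner (ι p) (normalPart (n := n) g ι p u) ξ = g.inner (ι p) u ξ := by
  rw [g.symm, inner_normalPart g h, g.symm]

omit hι' in
/-- The inverse of a matrix of smooth functions is smooth. -/
theorem SmoothFun.matrix_inv {k : ℕ} {A : N → Matrix (Fin k) (Fin k) ℝ}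
    (hA : ∀ i j, SmoothFun n (fun q => A q i j) p) (hdet : (A p).det ≠ 0) (i j : Fin k) :
    SmoothFun n (fun q => (A q)⁻¹ i j) p := by
  have key : ∀ B : N → Matrix (Fin k) (Fin k) ℝ, (∀ i j, SmoothFun n (fun q => B q i j) p) →
      SmoothFun n (fun q => (B q).det) p := by
    intro B hB
    simp only [Matrix.det_apply, Units.smul_def, zsmul_eq_mul]
    exact SmoothFun.sum fun σ _ => (SmoothFun.const _).mul (SmoothFun.prod fun l _ => hB _ _)
  have h1 : ∀ q, (A q)⁻¹ i j = ((A q).det)⁻¹ * (A q).adjugate i j := by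
    intro q
    rw [Matrix.inv_def, Matrix.smul_apply, Ring.inverse_eq_inv', smul_eq_mul]
  simp only [h1, Matrix.adjugate_apply]
  refine ((key A hA).inv hdet).mul (key _ fun r s => ?_)
  by_cases hr : r = j
  · subst hr
    simp only [Matrix.updateRow_self]
    exact SmoothFun.const _
  · simp only [Matrix.updateRow_ne hr]
    exact hA r s

/-- The trace over `N` of a smooth family of bilinear maps is smooth. -/
theorem metricTrace_smoothAlong {k : ℕ} {M' : Type*} [TopologicalSpace M']
    [ChartedSpace (EuclideanSpace ℝ (Fin k)) M'] [IsManifold (𝓡 k) ∞ M']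
    (hι : ContMDiff (𝓡 n) (𝓡 m) ∞ ι) {f : N → M'} (hf : ContMDiff (𝓡 n) (𝓡 k) ∞ f)
    {T : ∀ q : N, TangentSpace (𝓡 n) q → TangentSpace (𝓡 n) q → TangentSpace (𝓡 k) (f q)}
    (hT : ∀ q, IsBilinearMap ℝ (T q))
    (hs : ∀ V W : ∀ q : N, TangentSpace (𝓡 n) q, SmoothField n V p → SmoothField n W p →
      SmoothAlong n f (fun q => T q (V q) (W q)) p) :
    SmoothAlong n f (fun q => metricTrace (stdBasis n q) (inducedMetric g ι q) (T q)) p := by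
  let e := trivializationAt (EuclideanSpace ℝ (Fin n)) (fun x : N => TangentSpace (𝓡 n) x) p
  let b := (EuclideanSpace.basisFun (Fin n) ℝ).toBasis
  have he : p ∈ e.baseSet := FiberBundle.mem_baseSet_trivializationAt' p
  have hE : ∀ i, SmoothField n (e.localFrame b i) p := fun i => SmoothField.localFrame b i e he
  have hG : ∀ i j, SmoothFun n (fun q => (Matrix.of fun r s =>
      inducedMetric g ι q (e.localFrame b r q) (e.localFrame b s q))⁻¹ i j) p := by
    refine SmoothFun.matrix_inv (fun i j =>
      (SmoothAlong.push hι (hE i)).inner g (SmoothAlong.push hι (hE j))) ?_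
    have := (isScalarProduct_inducedMetric hι' g p).gram_det_ne_zero (e.basisAt b he)
    simpa only [e.localFrame_apply_of_mem_baseSet b he] using this
  have h1 : SmoothAlong n f (fun q => ∑ i, ∑ j, (Matrix.of fun r s =>
      inducedMetric g ι q (e.localFrame b r q) (e.localFrame b s q))⁻¹ i j •
        T q (e.localFrame b i q) (e.localFrame b j q)) p :=
    SmoothAlong.sum (Eventually.of_forall fun q => hf q) fun i _ =>
      SmoothAlong.sum (Eventually.of_forall fun q => hf q) fun j _ =>
        SmoothAlong.smul (hG i j) (hs _ _ (hE i) (hE j))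
  refine h1.congr ?_
  filter_upwards [e.open_baseSet.mem_nhds he] with q hq
  rw [← (isScalarProduct_inducedMetric hι' g q).metricTrace_basis (stdBasis n q)
    (e.basisAt b hq) (hT q)]
  simp only [metricTrace, e.localFrame_apply_of_mem_baseSet b hq]

theorem tangentPart_smooth (hι : ContMDiff (𝓡 n) (𝓡 m) ∞ ι)
    {Z : ∀ q : N, TangentSpace (𝓡 m) (ι q)} (hZ : SmoothAlong n ι Z p) :
    SmoothField n (fun q => tangentPart g ι q (Z q)) p := by
  refine metricTrace_smoothAlong hι' g hι (f := fun q : N => q) contMDiff_id (fun q => ?_)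
    fun V W hV hW => SmoothAlong.smul (hZ.inner g (SmoothAlong.push hι hV)) hW
  exact
    { add_left := fun v w z => by simp only [map_add, add_smul]
      smul_left := fun r v w => by simp only [map_smul, smul_eq_mul, mul_smul]
      add_right := fun v w z => by rw [smul_add]
      smul_right := fun r v w => by rw [smul_comm] }

theorem normalPart_smooth (hι : ContMDiff (𝓡 n) (𝓡 m) ∞ ι)
    {Z : ∀ q : N, TangentSpace (𝓡 m) (ι q)} (hZ : SmoothAlong n ι Z p) :
    SmoothAlong n ι (fun q => normalPart (n := n) g ι q (Z q)) p :=
  hZ.sub (SmoothAlong.push hι (tangentPart_smooth hι' g hι hZ))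

omit hι' in
theorem isNormal_smul (r : ℝ) {ξ : TangentSpace (𝓡 m) (ι p)} (h : IsNormal n g ι p ξ) :
    IsNormal n g ι p (r • ξ) := fun v => by
  rw [map_smul, smul_apply, h v, smul_zero]

omit hι' in
theorem isNormal_metricTrace {T : TangentSpace (𝓡 n) p → TangentSpace (𝓡 n) p →
      TangentSpace (𝓡 m) (ι p)} (h : ∀ v w, IsNormal n g ι p (T v w)) :
    IsNormal n g ι p (metricTrace (stdBasis n p) (inducedMetric g ι p) T) := fun v => by
  rw [g.symm]
  have := IsScalarProduct.map_metricTrace (β := inducedMetric g ι p) (stdBasis n p)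
    (g.inner (ι p) (dmap ι p v)).toLinearMap T
  refine this.trans ?_
  have h2 : ∀ a c, g.inner (ι p) (dmap ι p v) (T a c) = 0 := fun a c => by rw [g.symm, h a c v]
  simp [metricTrace, h2]

theorem normalExtend_smooth (hι : ContMDiff (𝓡 n) (𝓡 m) ∞ ι) (ξ : TangentSpace (𝓡 m) (ι p)) :
    SmoothAlong n ι (normalExtend (n := n) g ι p ξ) p :=
  normalPart_smooth hι' g hι (SmoothAlong.comp hι (SmoothField.extend ξ))

theorem isNormal_normalExtend (ξ : TangentSpace (𝓡 m) (ι p)) (q : N) :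
    IsNormal n g ι q (normalExtend (n := n) g ι p ξ q) :=
  isNormal_normalPart hι' g _

theorem normalExtend_self {ξ : TangentSpace (𝓡 m) (ι p)} (h : IsNormal n g ι p ξ) :
    normalExtend (n := n) g ι p ξ p = ξ := by
  rw [normalExtend, FiberBundle.extend_apply_self, normalPart_of_isNormal hι' g h]

end Components

/-! ### The fundamental form and the mean curvature -/

section FundamentalForm

variable {m n : ℕ} {M : Type*} [TopologicalSpace M] [ChartedSpace (EuclideanSpace ℝ (Fin m)) M]
  [IsManifold (𝓡 m) ∞ M]
  {N : Type*} [TopologicalSpace N] [ChartedSpace (EuclideanSpace ℝ (Fin n)) N]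
  [IsManifold (𝓡 n) ∞ N]

namespace WeylStructure

variable {c : ConformalStructure m M} (D : WeylStructure c) (g : c.metrics)
  {ι : N → M} (hι : ContMDiff (𝓡 n) (𝓡 m) ∞ ι) (hι' : InjectiveDifferential n m ι) {p : N}

include hι hι'

/-- The normal component of `∇_v W` depends on the tangent field `W` only through its value. -/
theorem normalPart_covAlong_push {W : ∀ q : N, TangentSpace (𝓡 n) q} (hW : SmoothField n W p)
    (v : TangentSpace (𝓡 n) p) :
    normalPart (n := n) g.1 ι p (D.covAlong ι (push ι W) p v) =
      D.fundamentalForm g ι p v (W p) := by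
  let e := trivializationAt (EuclideanSpace ℝ (Fin n)) (fun x : N => TangentSpace (𝓡 n) x) p
  let b := (EuclideanSpace.basisFun (Fin n) ℝ).toBasis
  have he : p ∈ e.baseSet := FiberBundle.mem_baseSet_trivializationAt' p
  have hE : ∀ i, SmoothField n (e.localFrame b i) p := fun i => SmoothField.localFrame b i e he
  have key : ∀ W : ∀ q : N, TangentSpace (𝓡 n) q, SmoothField n W p →
      normalPart (n := n) g.1 ι p (D.covAlong ι (push ι W) p v) =
        ∑ i, e.localFrameCoeff (𝓡 n) b i p (W p) •
          normalPart (n := n) g.1 ι p (D.covAlong ι (push ι (e.localFrame b i)) p v) := by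
    intro W hW
    have hc : ∀ i, SmoothFun n (fun q => e.localFrameCoeff (𝓡 n) b i q (W q)) p :=
      fun i => hW.coeff b i e he
    have h1 : ∀ᶠ q in 𝓝 p, push (m := m) ι W q = ∑ i, e.localFrameCoeff (𝓡 n) b i q (W q) •
        push (m := m) ι (e.localFrame b i) q := by
      filter_upwards [e.open_baseSet.mem_nhds he] with q hq
      have := e.eq_sum_localFrameCoeff_smul (I := 𝓡 n) (b := b) (s := W) hq
      simp only [push]
      conv_lhs => rw [this]
      simp only [map_sum, map_smul]
    rw [D.covAlong_congr h1, D.covAlong_sum hι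
      fun i _ => SmoothAlong.smul (hc i) (SmoothAlong.push hι (hE i))]
    have h2 : ∀ u, normalPart (n := n) g.1 ι p u = normalPartₗ n g.1 ι p u := fun u => rfl
    simp only [h2, map_sum]
    refine Finset.sum_congr rfl fun i _ => ?_
    rw [D.covAlong_smul (hc i) (SmoothAlong.push hι (hE i)), map_add, map_smul, map_smul,
      ← h2 (push ι _ p), push, normalPart_dmap hι', smul_zero, zero_add]
  rw [fundamentalForm, key W hW, key _ (SmoothField.extend (W p)), FiberBundle.extend_apply_self]

theorem isBilinearMap_fundamentalForm (p : N) :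
    IsBilinearMap ℝ (D.fundamentalForm (n := n) g ι p) := by
  have h : ∀ v w, D.fundamentalForm (n := n) g ι p v w =
      normalPart (n := n) g.1 ι p (D.covAlong ι (push ι (linExtend w)) p v) := fun v w => by
    rw [D.normalPart_covAlong_push g hι hι' (SmoothField.linExtend w), linExtend_self]
  have hp : ∀ w : TangentSpace (𝓡 n) p, SmoothAlong n ι (push (m := m) ι (linExtend w)) p :=
    fun w => SmoothAlong.push hι (SmoothField.linExtend w)
  exact
    { add_left := fun v v' w => by simp only [h, covAlong_add_vec, normalPart_add]
      smul_left := fun r v w => by simp only [h, covAlong_smul_vec, normalPart_smul]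
      add_right := fun v w w' => by
        simp only [h, linExtend_add]
        rw [← normalPart_add, ← D.covAlong_add (hp w) (hp w')]
        congr 3
        funext q
        exact map_add _ _ _
      smul_right := fun r v w => by
        simp only [h, linExtend_smul]
        rw [← normalPart_smul, ← D.covAlong_const_smul r (hp w)]
        congr 3
        funext q
        exact map_smul _ _ _ }

theorem fundamentalForm_symm (v w : TangentSpace (𝓡 n) p) :
    D.fundamentalForm g ι p v w = D.fundamentalForm g ι p w v := by
  have h : ∀ v w, D.fundamentalForm (n := n) g ι p v w =
      normalPart (n := n) g.1 ι p (D.covAlong ι (push ι (linExtend w)) p v) := fun v w => by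
    rw [D.normalPart_covAlong_push g hι hι' (SmoothField.linExtend w), linExtend_self]
  rw [h, h, D.covAlong_push_symm hι]

theorem fundamentalForm_smooth [T2Space M] {V W : ∀ q : N, TangentSpace (𝓡 n) q}
    (hV : SmoothField n V p) (hW : SmoothField n W p) :
    SmoothAlong n ι (fun q => D.fundamentalForm g ι q (V q) (W q)) p := by
  refine (normalPart_smooth hι' g.1 hι
    (D.covAlong_smooth hι (SmoothAlong.push hι hW) hV)).congr ?_
  have hn : ∀ᶠ q in 𝓝 p, SmoothField n W q := hW.near
  filter_upwards [hn] with q hq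
  exact (D.normalPart_covAlong_push g hι hι' hq (V q)).symm

omit hι in
theorem isNormal_fundamentalForm (v w : TangentSpace (𝓡 n) p) :
    IsNormal n g.1 ι p (D.fundamentalForm g ι p v w) :=
  isNormal_normalPart hι' g.1 _

omit hι hι' in
/-- The mean curvature vector `(1/n) tr B`. -/
def meanVec (n : ℕ) {M : Type*} [TopologicalSpace M] [ChartedSpace (EuclideanSpace ℝ (Fin m)) M]
    [IsManifold (𝓡 m) ∞ M] {c : ConformalStructure m M} (D : WeylStructure c) (g : c.metrics)
    {N : Type*} [TopologicalSpace N] [ChartedSpace (EuclideanSpace ℝ (Fin n)) N]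
    [IsManifold (𝓡 n) ∞ N] (ι : N → M) (p : N) : TangentSpace (𝓡 m) (ι p) :=
  (1 / (n : ℝ)) • metricTrace (stdBasis n p) (inducedMetric g.1 ι p) (D.fundamentalForm g ι p)

omit hι in
theorem isNormal_meanVec (p : N) : IsNormal n g.1 ι p (D.meanVec n g ι p) :=
  isNormal_smul g.1 _ (isNormal_metricTrace g.1 (D.isNormal_fundamentalForm g hι'))

theorem meanVec_smooth [T2Space M] (p : N) : SmoothAlong n ι (D.meanVec n g ι) p :=
  SmoothAlong.const_smul _ (metricTrace_smoothAlong hι' g.1 hι hι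
    (fun q => D.isBilinearMap_fundamentalForm g hι hι' q)
    fun _ _ hV hW => D.fundamentalForm_smooth g hι hι' hV hW)

omit hι hι' in
theorem fundamentalFormTraceFree_eq (v w : TangentSpace (𝓡 n) p) :
    D.fundamentalFormTraceFree g ι p v w =
      D.fundamentalForm g ι p v w - inducedMetric g.1 ι p v w • D.meanVec n g ι p := by
  rw [fundamentalFormTraceFree, meanVec, smul_smul, mul_one_div]

theorem isBilinearMap_fundamentalFormTraceFree (p : N) :
    IsBilinearMap ℝ (D.fundamentalFormTraceFree (n := n) g ι p) := by
  have h1 := D.isBilinearMap_fundamentalForm g hι hι' p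
  have h2 := (isScalarProduct_inducedMetric hι' g.1 p).bilin
  exact
    { add_left := fun v v' w => by
        simp only [fundamentalFormTraceFree_eq, h1.add_left, h2.add_left]; module
      smul_left := fun r v w => by
        simp only [fundamentalFormTraceFree_eq, h1.smul_left, h2.smul_left, smul_eq_mul]; module
      add_right := fun v w w' => by
        simp only [fundamentalFormTraceFree_eq, h1.add_right, h2.add_right]; module
      smul_right := fun r v w => by
        simp only [fundamentalFormTraceFree_eq, h1.smul_right, h2.smul_right, smul_eq_mul]
        module }

theorem fundamentalFormTraceFree_symm (v w : TangentSpace (𝓡 n) p) :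
    D.fundamentalFormTraceFree g ι p v w = D.fundamentalFormTraceFree g ι p w v := by
  simp only [fundamentalFormTraceFree_eq]
  rw [D.fundamentalForm_symm g hι hι', (isScalarProduct_inducedMetric hι' g.1 p).symm]

omit hι in
theorem isNormal_fundamentalFormTraceFree (v w : TangentSpace (𝓡 n) p) :
    IsNormal n g.1 ι p (D.fundamentalFormTraceFree g ι p v w) := fun u => by
  rw [fundamentalFormTraceFree_eq, map_sub, map_smul, sub_apply, smul_apply,
    D.isNormal_fundamentalForm g hι' v w u, D.isNormal_meanVec g hι' p u]
  simp

theorem fundamentalFormTraceFree_smooth [T2Space M] {V W : ∀ q : N, TangentSpace (𝓡 n) q}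
    (hV : SmoothField n V p) (hW : SmoothField n W p) :
    SmoothAlong n ι (fun q => D.fundamentalFormTraceFree g ι q (V q) (W q)) p := by
  simp only [fundamentalFormTraceFree_eq]
  exact (D.fundamentalForm_smooth g hι hι' hV hW).sub (SmoothAlong.smul
    ((SmoothAlong.push hι hV).inner g.1 (SmoothAlong.push hι hW)) (D.meanVec_smooth g hι hι' p))

omit hι in
theorem metricTrace_inducedMetric_smul (z : TangentSpace (𝓡 m) (ι p)) :
    (metricTrace (stdBasis n p) (inducedMetric g.1 ι p)
      fun a b => inducedMetric g.1 ι p a b • z) = (n : ℝ) • z := by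
  have h := IsScalarProduct.map_metricTrace (β := inducedMetric g.1 ι p) (stdBasis n p)
    (LinearMap.toSpanSingleton ℝ _ z) (inducedMetric g.1 ι p)
  rw [(isScalarProduct_inducedMetric hι' g.1 p).metricTrace_self] at h
  exact h.symm

omit hι in
theorem metricTrace_fundamentalFormTraceFree (p : N) :
    metricTrace (stdBasis n p) (inducedMetric g.1 ι p) (D.fundamentalFormTraceFree g ι p) = 0 := by
  rcases Nat.eq_zero_or_pos n with rfl | hn
  · simp [metricTrace]
  · have h : D.fundamentalFormTraceFree (n := n) g ι p = fun v w =>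
        D.fundamentalForm g ι p v w - inducedMetric g.1 ι p v w • D.meanVec n g ι p :=
      funext fun v => funext fun w => D.fundamentalFormTraceFree_eq g v w
    rw [h, IsScalarProduct.metricTrace_sub, metricTrace_inducedMetric_smul g hι', meanVec,
      smul_smul, mul_one_div_cancel (by positivity), one_smul]
    exact sub_self _

/-- The Weingarten equation. -/
theorem inner_covAlong_normal {Ξ : ∀ q : N, TangentSpace (𝓡 m) (ι q)} (hΞ : SmoothAlong n ι Ξ p)
    (hn : ∀ q, IsNormal n g.1 ι q (Ξ q)) (v w : TangentSpace (𝓡 n) p) :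
    g.1.inner (ι p) (D.covAlong ι Ξ p v) (dmap ι p w) =
      -g.1.inner (ι p) (Ξ p) (D.fundamentalForm g ι p v w) := by
  have hW := SmoothField.extend w
  have h1 := D.mvfderiv_inner_along g hι hΞ (SmoothAlong.push hι hW) v
  have h2 : (fun q => g.1.inner (ι q) (Ξ q)
      (push (m := m) ι (FiberBundle.extend (EuclideanSpace ℝ (Fin n)) w) q)) = fun _ => 0 :=
    funext fun q => hn q _
  rw [h2, mvfderiv_const] at h1
  simp only [push, hn p _, FiberBundle.extend_apply_self, mul_zero, add_zero] at h1
  rw [fundamentalForm, inner_normalPart g.1 (hn p)]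
  simp only [zero_apply] at h1
  exact eq_neg_of_add_eq_zero_left h1.symm

/-- The mean curvature, defined by differentiating normal fields, is dual to the mean curvature vector, by the
Weingarten equation. -/
theorem meanCurvature_eq {ξ : TangentSpace (𝓡 m) (ι p)} (hξ : IsNormal n g.1 ι p ξ) :
    D.meanCurvature (n := n) g ι p ξ = g.1.inner (ι p) (D.meanVec n g ι p) ξ := by
  have h1 : ∀ a b : TangentSpace (𝓡 n) p, inducedMetric g.1 ι p (tangentPart g.1 ι p
      (D.covAlong ι (normalExtend (n := n) g.1 ι p ξ) p a)) b =
      (-1 : ℝ) • g.1.inner (ι p) ξ (D.fundamentalForm g ι p a b) := by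
    intro a b
    rw [inducedMetric_tangentPart hι', D.inner_covAlong_normal g hι hι'
      (normalExtend_smooth hι' g.1 hι ξ) (isNormal_normalExtend hι' g.1 ξ),
      normalExtend_self hι' g.1 hξ]
    simp
  have h2 := IsScalarProduct.map_metricTrace (β := inducedMetric g.1 ι p) (stdBasis n p)
    (g.1.inner (ι p) ξ).toLinearMap (D.fundamentalForm g ι p)
  have h3 : g.1.inner (ι p) ξ (metricTrace (stdBasis n p) (inducedMetric g.1 ι p)
    (D.fundamentalForm g ι p)) = _ := h2
  rw [meanCurvature, (isScalarProduct_inducedMetric hι' g.1 p).endTrace_eq]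
  simp only [h1, IsScalarProduct.metricTrace_smul]
  rw [g.1.symm, meanVec, map_smul, h3]
  simp only [smul_eq_mul]
  ring_nf
  rfl

/-- The covariant derivative of the mean curvature, in terms of the mean curvature vector. -/
theorem covMeanCurvature_eq [T2Space M] (X : TangentSpace (𝓡 n) p)
    {ξ : TangentSpace (𝓡 m) (ι p)} (hξ : IsNormal n g.1 ι p ξ) :
    D.covMeanCurvature (n := n) g ι p X ξ =
      g.1.inner (ι p) (D.covAlong ι (D.meanVec n g ι) p X) ξ
        + D.gaugeForm g (ι p) (dmap ι p X) * g.1.inner (ι p) (D.meanVec n g ι p) ξ := by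
  have h1 : (fun q => D.meanCurvature (n := n) g ι q (normalExtend (n := n) g.1 ι p ξ q)) =
      fun q => g.1.inner (ι q) (D.meanVec n g ι q) (normalExtend (n := n) g.1 ι p ξ q) :=
    funext fun q => D.meanCurvature_eq g hι hι' (isNormal_normalExtend hι' g.1 ξ q)
  simp only [covMeanCurvature]
  rw [h1, D.mvfderiv_inner_along g hι (D.meanVec_smooth g hι hι' p)
    (normalExtend_smooth hι' g.1 hι ξ), normalExtend_self hι' g.1 hξ, covNormal,
    D.meanCurvature_eq g hι hι' (isNormal_normalPart hι' g.1 _),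
    inner_normalPart g.1 (D.isNormal_meanVec g hι' p)]
  ring

end WeylStructure

end FundamentalForm

/-! ### Submanifold invariants under a change of Weyl structure -/

section SubmanifoldChange

variable {m n : ℕ} {M : Type*} [TopologicalSpace M] [ChartedSpace (EuclideanSpace ℝ (Fin m)) M]
  [IsManifold (𝓡 m) ∞ M]
  {N : Type*} [TopologicalSpace N] [ChartedSpace (EuclideanSpace ℝ (Fin n)) N]
  [IsManifold (𝓡 n) ∞ N]

namespace WeylStructure

variable {c : ConformalStructure m M} (D D' : WeylStructure c) (g : c.metrics)
  {ι : N → M} (hι : ContMDiff (𝓡 n) (𝓡 m) ∞ ι) (hι' : InjectiveDifferential n m ι) {p : N}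

/-- The tangential part of the dual of the 1-form of a change of Weyl structure. -/
def leeTangent (n : ℕ) {M : Type*} [TopologicalSpace M] [ChartedSpace (EuclideanSpace ℝ (Fin m)) M]
    [IsManifold (𝓡 m) ∞ M] {c : ConformalStructure m M} (D D' : WeylStructure c) (g : c.metrics)
    {N : Type*} [TopologicalSpace N] [ChartedSpace (EuclideanSpace ℝ (Fin n)) N]
    [IsManifold (𝓡 n) ∞ N] (ι : N → M) (p : N) : TangentSpace (𝓡 n) p :=
  tangentPart g.1 ι p (D.leeVec D' g (ι p))

include hι'

theorem inducedMetric_leeTangent (v : TangentSpace (𝓡 n) p) :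
    inducedMetric g.1 ι p (D.leeTangent n D' g ι p) v = D.lee D' g (ι p) (dmap ι p v) := by
  rw [leeTangent, inducedMetric_tangentPart hι', inner_leeVec]

/-- Only the term `-g(v, w) θ^♯` of `cov_change` has a normal component. -/
theorem fundamentalForm_change (v w : TangentSpace (𝓡 n) p) :
    D'.fundamentalForm g ι p v w = D.fundamentalForm g ι p v w
      - inducedMetric g.1 ι p v w • normalPart (n := n) g.1 ι p (D.leeVec D' g (ι p)) := by
  simp only [fundamentalForm, D.covAlong_change D' g, normalPart_add, normalPart_sub,
    normalPart_smul, normalPart_dmap hι', push, FiberBundle.extend_apply_self, inducedMetric]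
  module

theorem meanVec_change (hn : n ≠ 0) (p : N) :
    D'.meanVec n g ι p = D.meanVec n g ι p
      - normalPart (n := n) g.1 ι p (D.leeVec D' g (ι p)) := by
  have h : D'.fundamentalForm (n := n) g ι p = fun v w => D.fundamentalForm g ι p v w
      - inducedMetric g.1 ι p v w • normalPart (n := n) g.1 ι p (D.leeVec D' g (ι p)) :=
    funext fun v => funext fun w => D.fundamentalForm_change D' g hι' v w
  rw [meanVec, h, IsScalarProduct.metricTrace_sub, metricTrace_inducedMetric_smul g hι', smul_sub,
    smul_smul, one_div_mul_cancel (by exact_mod_cast hn), one_smul, meanVec]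

/-- The trace-free part of the fundamental form is the same for all Weyl structures. -/
theorem fundamentalFormTraceFree_change (hn : n ≠ 0) (v w : TangentSpace (𝓡 n) p) :
    D'.fundamentalFormTraceFree g ι p v w = D.fundamentalFormTraceFree g ι p v w := by
  simp only [fundamentalFormTraceFree_eq, D.fundamentalForm_change D' g hι',
    D.meanVec_change D' g hι' hn]
  module

theorem covTangent_change (V : ∀ q : N, TangentSpace (𝓡 n) q) (u : TangentSpace (𝓡 n) p) :
    D'.covTangent g ι V p u = D.covTangent g ι V p u
      + D.lee D' g (ι p) (dmap ι p u) • V p + D.lee D' g (ι p) (dmap ι p (V p)) • u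
      - inducedMetric g.1 ι p u (V p) • D.leeTangent n D' g ι p := by
  simp only [covTangent, D.covAlong_change D' g, tangentPart_add, tangentPart_sub,
    tangentPart_smul, tangentPart_dmap hι', push, leeTangent, inducedMetric]

theorem covNormal_change {Z : ∀ q : N, TangentSpace (𝓡 m) (ι q)} (hZ : IsNormal n g.1 ι p (Z p))
    (u : TangentSpace (𝓡 n) p) :
    D'.covNormal g ι Z p u = D.covNormal g ι Z p u
      + D.lee D' g (ι p) (dmap ι p u) • Z p := by
  have h : g.1.inner (ι p) (dmap ι p u) (Z p) = 0 := by rw [g.1.symm, hZ u]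
  simp only [covNormal, D.covAlong_change D' g, normalPart_add, normalPart_sub,
    normalPart_smul, normalPart_dmap hι', h, normalPart_of_isNormal hι' g.1 hZ]
  module

include hι

/-- The covariant derivatives of `B₀`. The coefficient of `θ(u)` is `1` for the normal bundle, minus
`1` for each of the two arguments of `B₀`. -/
theorem covFundamentalFormTraceFree_change (hn : n ≠ 0) (u v w : TangentSpace (𝓡 n) p) :
    D'.covFundamentalFormTraceFree g ι p u v w = D.covFundamentalFormTraceFree g ι p u v w
      + inducedMetric g.1 ι p u v • D.fundamentalFormTraceFree g ι p (D.leeTangent n D' g ι p) w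
      + inducedMetric g.1 ι p u w • D.fundamentalFormTraceFree g ι p v (D.leeTangent n D' g ι p)
      - D.lee D' g (ι p) (dmap ι p u) • D.fundamentalFormTraceFree g ι p v w
      - D.lee D' g (ι p) (dmap ι p v) • D.fundamentalFormTraceFree g ι p u w
      - D.lee D' g (ι p) (dmap ι p w) • D.fundamentalFormTraceFree g ι p v u := by
  have hb := D.isBilinearMap_fundamentalFormTraceFree g hι hι' p
  have hsl : ∀ a b z, D.fundamentalFormTraceFree (n := n) g ι p (a - b) z =
      D.fundamentalFormTraceFree g ι p a z - D.fundamentalFormTraceFree g ι p b z :=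
    fun a b z => map_sub (hb.toLinearMap.flip z) a b
  have hsr : ∀ a b z, D.fundamentalFormTraceFree (n := n) g ι p z (a - b) =
      D.fundamentalFormTraceFree g ι p z a - D.fundamentalFormTraceFree g ι p z b :=
    fun a b z => map_sub (hb.toLinearMap z) a b
  simp only [covFundamentalFormTraceFree, D.fundamentalFormTraceFree_change D' g hι' hn]
  rw [D.covNormal_change D' g hι' (D.isNormal_fundamentalFormTraceFree g hι' _ _),
    D.covTangent_change D' g hι', D.covTangent_change D' g hι']
  simp only [FiberBundle.extend_apply_self, hsl, hsr, hb.add_left, hb.add_right, hb.smul_left,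
    hb.smul_right]
  module

/-- The codifferential of `B₀` changes by `(n - 1) B₀(v, τ)`, with `τ` the tangential part of
`θ^♯`: in the trace of `covFundamentalFormTraceFree_change`, the term with `g(u, w)` contributes the
factor `n`, the one with a trace of `B₀` vanishes, and the other three sum up to the factor `-1`. -/
theorem codiffFundamentalForm_change (hn : n ≠ 0) (v : TangentSpace (𝓡 n) p)
    (ξ : TangentSpace (𝓡 m) (ι p)) :
    D'.codiffFundamentalForm (n := n) g ι p v ξ = D.codiffFundamentalForm (n := n) g ι p v ξ
      + ((n : ℝ) - 1) *
        g.1.inner (ι p) (D.fundamentalFormTraceFree g ι p v (D.leeTangent n D' g ι p)) ξ := by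
  have hb := D.isBilinearMap_fundamentalFormTraceFree g hι hι' p
  have hβ := isScalarProduct_inducedMetric hι' g.1 p
  have h1 := hβ.metricTrace_left (stdBasis n p) v
    (hb.toLinearMap (D.leeTangent n D' g ι p))
  have h2 := metricTrace_inducedMetric_smul g hι'
    (D.fundamentalFormTraceFree g ι p v (D.leeTangent n D' g ι p))
  have h3 := hβ.metricTrace_left (stdBasis n p) (D.leeTangent n D' g ι p) (hb.toLinearMap v)
  have h4 := D.metricTrace_fundamentalFormTraceFree g hι' p
  have h5 := hβ.metricTrace_right (stdBasis n p) (D.leeTangent n D' g ι p) (hb.toLinearMap v)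
  have hto : ∀ a b, hb.toLinearMap a b = D.fundamentalFormTraceFree (n := n) g ι p a b :=
    fun _ _ => rfl
  simp only [hto] at h1 h3 h5
  have key : (metricTrace (stdBasis n p) (inducedMetric g.1 ι p) fun a b =>
      D'.covFundamentalFormTraceFree g ι p a v b) =
      (metricTrace (stdBasis n p) (inducedMetric g.1 ι p) fun a b =>
        D.covFundamentalFormTraceFree g ι p a v b)
      + ((n : ℝ) - 1) • D.fundamentalFormTraceFree g ι p v (D.leeTangent n D' g ι p) := by
    simp only [D.covFundamentalFormTraceFree_change D' g hι hι' hn, IsScalarProduct.metricTrace_add,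
      IsScalarProduct.metricTrace_sub, IsScalarProduct.metricTrace_smul,
      ← D.inducedMetric_leeTangent D' g hι', hβ.symm _ v]
    rw [h1, h2, h3, h5]
    have h6 : (metricTrace (stdBasis n p) (inducedMetric g.1 ι p) fun a b =>
      D.fundamentalFormTraceFree g ι p a b) = 0 := h4
    rw [h6, D.fundamentalFormTraceFree_symm g hι hι' _ v]
    module
  simp only [codiffFundamentalForm]
  rw [key, map_add, map_smul]
  simp

/-- The derivative of the mean curvature changes by `-∇θ + θ ⊗ θ` and by `B₀(X, τ)`, with `τ` the
tangential part of `θ^♯`. The last term appears since only the normal part of `θ^♯` is subtracted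
from the mean curvature vector, and the derivative of `τ` has the normal component `B(X, τ)`.
The difference `θ(X) H` of `B(X, τ)` and `B₀(X, τ)` cancels against the term `-θ(X) H` in the
change of the connection on `ν*`; applied to `θ^♯`, this term yields `θ ⊗ θ`. -/
theorem covMeanCurvature_change [T2Space M] (hm : 0 < m) (hn : n ≠ 0) (X : TangentSpace (𝓡 n) p)
    {ξ : TangentSpace (𝓡 m) (ι p)} (hξ : IsNormal n g.1 ι p ξ) :
    D'.covMeanCurvature (n := n) g ι p X ξ = D.covMeanCurvature (n := n) g ι p X ξ
      - D.covLee D' g (ι p) (dmap ι p X) ξ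
      + D.lee D' g (ι p) (dmap ι p X) * D.lee D' g (ι p) ξ
      + g.1.inner (ι p)
        (D.fundamentalFormTraceFree g ι p X (D.leeTangent n D' g ι p)) ξ := by
  have hθ : SmoothField m (D.leeVec D' g) (ι p) := D.leeVec_smooth D' g hm (ι p)
  have hθι : SmoothAlong n ι (fun q => D.leeVec D' g (ι q)) p := SmoothAlong.comp hι hθ
  have hτ : SmoothField n (D.leeTangent n D' g ι) p := tangentPart_smooth hι' g.1 hι hθι
  have hH := D.meanVec_smooth g hι hι' p
  -- The new mean curvature vector is `H - θ^♯ + τ`, with `τ` the tangential part of `θ^♯`.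
  have h1 : D'.meanVec n g ι = fun q => (D.meanVec n g ι q - D.leeVec D' g (ι q))
      + push ι (D.leeTangent n D' g ι) q := by
    funext q
    rw [D.meanVec_change D' g hι' hn]
    simp only [normalPart, push, leeTangent]
    abel
  have h2 : D'.covAlong ι (D'.meanVec n g ι) p X =
      D.covAlong ι (D.meanVec n g ι) p X - D.cov (D.leeVec D' g) (ι p) (dmap ι p X)
      + D.covAlong ι (push ι (D.leeTangent n D' g ι)) p X
      + D.lee D' g (ι p) (dmap ι p X) • D'.meanVec n g ι p
      + D.lee D' g (ι p) (D'.meanVec n g ι p) • dmap ι p X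
      - g.1.inner (ι p) (dmap ι p X) (D'.meanVec n g ι p) • D.leeVec D' g (ι p) := by
    rw [D.covAlong_change D' g]
    conv_lhs =>
      rw [show D.covAlong ι (D'.meanVec n g ι) p X = _ from
        congrArg (fun Z => D.covAlong ι Z p X) h1]
    rw [D.covAlong_add (hH.sub hθι) (SmoothAlong.push hι hτ), D.covAlong_sub hH hθι,
      D.covAlong_comp hι hθ]
  have h3 : g.1.inner (ι p) (dmap ι p X) ξ = 0 := by rw [g.1.symm, hξ X]
  have h4 : g.1.inner (ι p) (D'.meanVec n g ι p) ξ =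
      g.1.inner (ι p) (D.meanVec n g ι p) ξ - D.lee D' g (ι p) ξ := by
    rw [D.meanVec_change D' g hι' hn, map_sub, sub_apply, inner_normalPart_left g.1 hξ,
      inner_leeVec]
  have h5 : g.1.inner (ι p) (dmap ι p X) (D'.meanVec n g ι p) = 0 := by
    rw [g.1.symm, D'.isNormal_meanVec g hι' p X]
  have h6 : g.1.inner (ι p) (D.covAlong ι (push ι (D.leeTangent n D' g ι)) p X) ξ =
      g.1.inner (ι p) (D.fundamentalFormTraceFree g ι p X (D.leeTangent n D' g ι p)) ξ
      + D.lee D' g (ι p) (dmap ι p X) * g.1.inner (ι p) (D.meanVec n g ι p) ξ := by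
    rw [← inner_normalPart_left g.1 hξ, D.normalPart_covAlong_push g hι hι' hτ,
      fundamentalFormTraceFree_eq, (isScalarProduct_inducedMetric hι' g.1 p).symm X,
      D.inducedMetric_leeTangent D' g hι']
    simp
  have h7 : D.covLee D' g (ι p) (dmap ι p X) ξ =
      g.1.inner (ι p) (D.cov (D.leeVec D' g) (ι p) (dmap ι p X)) ξ
        + D.gaugeForm g (ι p) (dmap ι p X) * D.lee D' g (ι p) ξ := by
    rw [← inner_covLeeVec, covLeeVec, map_add, map_smul, add_apply, smul_apply, inner_leeVec,
      smul_eq_mul]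
  rw [D'.covMeanCurvature_eq g hι hι' X hξ, D.covMeanCurvature_eq g hι hι' X hξ, h2,
    D.gaugeForm_eq_sub D' g, h7]
  simp only [map_add, map_sub, map_smul, add_apply, sub_apply, smul_apply, smul_eq_mul, h3, h4, h5,
    h6]
  ring

/-- With respect to a fixed metric of the conformal class, the mixed Schouten-Weyl tensor is the
same for all Weyl structures. -/
theorem mixedSchoutenWeyl_change [T2Space M] (S : RigidStructure c) (X : TangentSpace (𝓡 n) p)
    {ξ : TangentSpace (𝓡 m) (ι p)} (hξ : IsNormal n g.1 ι p ξ) :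
    D'.mixedSchoutenWeyl g ι S p X ξ = D.mixedSchoutenWeyl g ι S p X ξ := by
  have hm : 0 < m := by
    cases S <;> omega
  have h3 : g.1.inner (ι p) (dmap ι p X) ξ = 0 := by rw [g.1.symm, hξ X]
  rcases eq_or_ne n 0 with hn | hn
  · subst hn
    have hX : X = 0 := Subsingleton.elim (α := EuclideanSpace ℝ (Fin 0)) X 0
    have hT : ∀ E : WeylStructure c, E.codiffFundamentalForm (n := 0) g ι p X ξ = 0 := fun E => by
      simp [codiffFundamentalForm, metricTrace]
    have hz : ∀ E : WeylStructure c, E.covMeanCurvature (n := 0) g ι p X ξ = 0 := fun E => by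
      rw [E.covMeanCurvature_eq g hι hι' X hξ, hX]
      have := E.covAlong_smul_vec (f := ι) (Z := E.meanVec 0 g ι) 0 (0 : TangentSpace (𝓡 0) p)
      rw [zero_smul, zero_smul] at this
      rw [this]
      simp
    simp only [mixedSchoutenWeyl, hT, hz]
    rw [D.schouten_change D' g S (ι p) h3, hX]
    simp
  · simp only [mixedSchoutenWeyl]
    rw [D.schouten_change D' g S (ι p) h3, D.covMeanCurvature_change D' g hι hι' hm hn X hξ,
      D.codiffFundamentalForm_change D' g hι hι' hn]
    split_ifs with h1
    · -- In dimension one `B₀` vanishes, being a multiple of its trace.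
      subst h1
      have h4 := (isScalarProduct_inducedMetric hι' g.1 p).eq_zero_of_metricTrace_eq_zero
        (stdBasis 1 p) (D.isBilinearMap_fundamentalFormTraceFree g hι hι' p)
        (D.metricTrace_fundamentalFormTraceFree g hι' p) X (D.leeTangent 1 D' g ι p)
      rw [h4, map_zero, zero_apply]
      ring
    · have : (n : ℝ) - 1 ≠ 0 := by
        rw [sub_ne_zero]
        exact_mod_cast h1
      field_simp
      ring

end WeylStructure

end SubmanifoldChange

/-! ### Bilinearity of the mixed Schouten-Weyl tensor -/

section Bilinearity

variable {m n : ℕ} {M : Type*} [TopologicalSpace M] [ChartedSpace (EuclideanSpace ℝ (Fin m)) M]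
  [IsManifold (𝓡 m) ∞ M] [T2Space M]
  {N : Type*} [TopologicalSpace N] [ChartedSpace (EuclideanSpace ℝ (Fin n)) N]
  [IsManifold (𝓡 n) ∞ N]

namespace WeylStructure

variable {c : ConformalStructure m M} (D : WeylStructure c) (g : c.metrics)
  {ι : N → M} (hι : ContMDiff (𝓡 n) (𝓡 m) ∞ ι) (hι' : InjectiveDifferential n m ι) {p : N}

/-- If there are Weyl structures, then for one of them the Schouten-Weyl tensor is given, on pairs
of orthogonal vectors, by a bilinear form that does not involve a choice of metric: any one if
`m ≥ 3`, and one with respect to which the Möbius structure is scalar if `m = 2`. -/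
theorem exists_schouten_eq (S : RigidStructure c) (h : Nonempty (WeylStructure c)) :
    ∃ (D : WeylStructure c) (s : ∀ x : M, TangentSpace (𝓡 m) x → TangentSpace (𝓡 m) x → ℝ),
      (∀ x, IsBilinearMap ℝ (s x)) ∧ ∀ (g : c.metrics) (x : M) (v w : TangentSpace (𝓡 m) x),
        g.1.inner x v w = 0 → D.schouten S g x v w = s x v w := by
  cases S with
  | ofDim hm =>
    obtain ⟨D⟩ := h
    refine ⟨D, fun x v w => (1 / ((m : ℝ) - 2)) * ((D.ricci x v w + D.ricci x w v) / 2)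
      - (1 / 2) * D.faraday x v w, fun x => ?_, fun g x v w hvw => ?_⟩
    · have h1 := D.isBilinearMap_ricci x
      have h2 := D.isBilinearMap_faraday x
      exact
        { add_left := fun v v' w => by
            simp only [h1.add_left, h1.add_right, h2.add_left]; ring
          smul_left := fun r v w => by
            simp only [h1.smul_left, h1.smul_right, h2.smul_left, smul_eq_mul]; ring
          add_right := fun v w w' => by
            simp only [h1.add_left, h1.add_right, h2.add_right]; ring
          smul_right := fun r v w => by
            simp only [h1.smul_left, h1.smul_right, h2.smul_right, smul_eq_mul]; ring }
    · simp only [schouten, schoutenTraceFree, symTraceFree_of_orthogonal _ _ _ hvw, hvw]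
      ring
  | ofMobius hm 𝓜 =>
    obtain ⟨D, h, -, -, hop⟩ := 𝓜.exists_weyl
    refine ⟨D, fun x v w => h x v w - (1 / 2) * D.faraday x v w, fun x => ?_,
      fun g x v w hvw => ?_⟩
    · have h2 := D.isBilinearMap_faraday x
      exact
        { add_left := fun v v' w => by
            simp only [map_add, add_apply, h2.add_left]; ring
          smul_left := fun r v w => by
            simp only [map_smul, smul_apply, h2.smul_left, smul_eq_mul]; ring
          add_right := fun v w w' => by
            simp only [map_add, h2.add_right]; ring
          smul_right := fun r v w => by
            simp only [map_smul, h2.smul_right, smul_eq_mul]; ring }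
    · have h1 := hop g (ContMDiffMap.const 1) x v w
      have h2 : ((ContMDiffMap.const 1 : C^∞⟮𝓡 m, M; 𝓘(ℝ), ℝ⟯) : M → ℝ) = fun _ => 1 := rfl
      rw [h2] at h1
      simp only [schouten, schoutenTraceFree, mobiusSchouten, h1, hvw]
      ring

include hι hι'

/-- The derivative of `B₀` can be computed with extensions that are linear in the vectors
extended, which makes its linearity visible. -/
theorem covFundamentalFormTraceFree_eq_linExtend (u v w : TangentSpace (𝓡 n) p) :
    D.covFundamentalFormTraceFree g ι p u v w =
      D.covNormal g ι (fun q => D.fundamentalFormTraceFree g ι q (linExtend v q)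
        (linExtend w q)) p u
      - D.fundamentalFormTraceFree g ι p (D.covTangent g ι (linExtend v) p u) w
      - D.fundamentalFormTraceFree g ι p v (D.covTangent g ι (linExtend w) p u) := by
  have h1 : ∀ v : TangentSpace (𝓡 n) p,
      D.covTangent g ι (FiberBundle.extend (EuclideanSpace ℝ (Fin n)) v) p u =
        D.covTangent g ι (linExtend v) p u := fun v => by
    have h : ∀ᶠ q in 𝓝 p, push (m := m) ι (FiberBundle.extend (EuclideanSpace ℝ (Fin n)) v) q =
        push (m := m) ι (linExtend v) q :=
      (extend_eq_linExtend v).mono fun q hq => congrArg _ hq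
    simp only [covTangent, D.covAlong_congr h]
  have h2 : ∀ᶠ q in 𝓝 p, D.fundamentalFormTraceFree g ι q
      (FiberBundle.extend (EuclideanSpace ℝ (Fin n)) v q)
      (FiberBundle.extend (EuclideanSpace ℝ (Fin n)) w q) =
      D.fundamentalFormTraceFree g ι q (linExtend v q) (linExtend w q) := by
    filter_upwards [extend_eq_linExtend v, extend_eq_linExtend w] with q hv hw
    rw [hv, hw]
  simp only [covFundamentalFormTraceFree, h1, covNormal, D.covAlong_congr h2]

theorem covFundamentalFormTraceFree_add_middle (u v v' w : TangentSpace (𝓡 n) p) :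
    D.covFundamentalFormTraceFree g ι p u (v + v') w =
      D.covFundamentalFormTraceFree g ι p u v w + D.covFundamentalFormTraceFree g ι p u v' w := by
  have hb := fun q => D.isBilinearMap_fundamentalFormTraceFree g hι hι' q
  have hs := fun v : TangentSpace (𝓡 n) p => D.fundamentalFormTraceFree_smooth g hι hι'
    (SmoothField.linExtend v) (SmoothField.linExtend w)
  have hp := fun v : TangentSpace (𝓡 n) p =>
    SmoothAlong.push (m := m) hι (SmoothField.linExtend v)
  have h1 : D.covTangent g ι (linExtend (v + v')) p u =
      D.covTangent g ι (linExtend v) p u + D.covTangent g ι (linExtend v') p u := by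
    simp only [covTangent]
    rw [← tangentPart_add, ← D.covAlong_add (hp v) (hp v'), linExtend_add]
    congr 3
    funext q
    exact map_add _ _ _
  rw [linExtend_add] at h1
  simp only [D.covFundamentalFormTraceFree_eq_linExtend g hι hι', h1, linExtend_add v v',
    (hb _).add_left, covNormal, D.covAlong_add (hs v) (hs v'), normalPart_add]
  abel

theorem covFundamentalFormTraceFree_smul_middle (r : ℝ) (u v w : TangentSpace (𝓡 n) p) :
    D.covFundamentalFormTraceFree g ι p u (r • v) w =
      r • D.covFundamentalFormTraceFree g ι p u v w := by
  have hb := fun q => D.isBilinearMap_fundamentalFormTraceFree g hι hι' q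
  have hs := D.fundamentalFormTraceFree_smooth g hι hι'
    (SmoothField.linExtend v) (SmoothField.linExtend w)
  have h1 : D.covTangent g ι (linExtend (r • v)) p u =
      r • D.covTangent g ι (linExtend v) p u := by
    simp only [covTangent]
    rw [← tangentPart_smul, ← D.covAlong_const_smul r
      (SmoothAlong.push (m := m) hι (SmoothField.linExtend v)), linExtend_smul]
    congr 3
    funext q
    exact map_smul _ _ _
  rw [linExtend_smul] at h1
  simp only [D.covFundamentalFormTraceFree_eq_linExtend g hι hι', h1, linExtend_smul r v,
    (hb _).smul_left, covNormal, D.covAlong_const_smul r hs, normalPart_smul, smul_sub]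

omit hι hι' in
theorem _root_.ConformalGeometry.isNormal_of_mem {ξ : TangentSpace (𝓡 m) (ι p)}
    (h : ξ ∈ normalSpace (n := n) c ι p) : IsNormal n g.1 ι p ξ :=
  h g.1 g.2

/-- The mixed Schouten-Weyl tensor is bilinear, if the Schouten-Weyl tensor is bilinear on pairs of
orthogonal vectors. -/
theorem exists_mixedSchoutenWeyl_eq (S : RigidStructure c)
    {s : ∀ x : M, TangentSpace (𝓡 m) x → TangentSpace (𝓡 m) x → ℝ}
    (hs : ∀ x, IsBilinearMap ℝ (s x))
    (hD : ∀ (x : M) (v w : TangentSpace (𝓡 m) x),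
      g.1.inner x v w = 0 → D.schouten S g x v w = s x v w) (p : N) :
    ∃ μ : TangentSpace (𝓡 n) p →ₗ[ℝ] normalSpace (n := n) c ι p →ₗ[ℝ] ℝ,
      ∀ (X : TangentSpace (𝓡 n) p) (ξ : normalSpace (n := n) c ι p),
        D.mixedSchoutenWeyl g ι S p X ξ = μ X ξ := by
  have h1 : ∀ (X : TangentSpace (𝓡 n) p) (ξ : normalSpace (n := n) c ι p),
      D.mixedSchoutenWeyl g ι S p X ξ = s (ι p) (dmap ι p X) ξ
        - (g.1.inner (ι p) (D.covAlong ι (D.meanVec n g ι) p X) ξ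
        + D.gaugeForm g (ι p) (dmap ι p X) * g.1.inner (ι p) (D.meanVec n g ι p) ξ)
        + if n = 1 then 0 else (1 / ((n : ℝ) - 1)) *
          g.1.inner (ι p) (metricTrace (stdBasis n p) (inducedMetric g.1 ι p) fun a b =>
            D.covFundamentalFormTraceFree g ι p a X b) ξ := by
    intro X ξ
    have hξ := isNormal_of_mem g ξ.2
    rw [mixedSchoutenWeyl, D.covMeanCurvature_eq g hι hι' X hξ, hD _ _ _ (by rw [g.1.symm, hξ X]),
      codiffFundamentalForm]
  refine ⟨LinearMap.mk₂ ℝ (fun X ξ => D.mixedSchoutenWeyl g ι S p X ξ) ?_ ?_ ?_ ?_,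
    fun X ξ => rfl⟩
  · intro X X' ξ
    simp only [h1, map_add, (hs _).add_left, covAlong_add_vec, add_apply,
      D.covFundamentalFormTraceFree_add_middle g hι hι', IsScalarProduct.metricTrace_add]
    split_ifs <;> ring
  · intro r X ξ
    simp only [h1, map_smul, (hs _).smul_left, covAlong_smul_vec, smul_apply, smul_eq_mul,
      D.covFundamentalFormTraceFree_smul_middle g hι hι', IsScalarProduct.metricTrace_smul]
    split_ifs <;> ring
  · intro X ξ ξ'
    rw [h1, h1, h1]
    simp only [Submodule.coe_add, map_add, (hs _).add_right]
    split_ifs <;> ring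
  · intro r X ξ
    rw [h1, h1]
    simp only [Submodule.coe_smul, map_smul, (hs _).smul_right, smul_eq_mul]
    split_ifs <;> ring

end WeylStructure

end Bilinearity

/-! ### Independence of the metric -/

section Rescaling

variable {m n : ℕ} {M : Type*} [TopologicalSpace M] [ChartedSpace (EuclideanSpace ℝ (Fin m)) M]
  [IsManifold (𝓡 m) ∞ M]
  {N : Type*} [TopologicalSpace N] [ChartedSpace (EuclideanSpace ℝ (Fin n)) N]
  [IsManifold (𝓡 n) ∞ N]

variable {ι : N → M} (hι' : InjectiveDifferential n m ι) {g g' : RiemMetric m M} {u : M → ℝ}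
  (hg : ∀ (x : M) (v w : TangentSpace (𝓡 m) x),
    g'.inner x v w = Real.exp (2 * u x) * g.inner x v w)

include hι' hg

theorem tangentPart_rescale (p : N) (z : TangentSpace (𝓡 m) (ι p)) :
    tangentPart (n := n) g' ι p z = tangentPart g ι p z := by
  refine tangentPart_eq hι' g' fun v => ?_
  have h1 := inducedMetric_tangentPart hι' g z v
  simp only [inducedMetric] at h1 ⊢
  rw [hg, hg, h1]

theorem normalPart_rescale (p : N) (z : TangentSpace (𝓡 m) (ι p)) :
    normalPart (n := n) g' ι p z = normalPart (n := n) g ι p z := by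
  simp only [normalPart, tangentPart_rescale hι' hg]

theorem normalExtend_rescale (p : N) (z : TangentSpace (𝓡 m) (ι p)) :
    normalExtend (n := n) g' ι p z = normalExtend (n := n) g ι p z := by
  funext q
  simp only [normalExtend, normalPart_rescale hι' hg]

theorem metricTrace_rescale {W : Type*} [AddCommGroup W] [Module ℝ W] (p : N)
    (T : TangentSpace (𝓡 n) p → TangentSpace (𝓡 n) p → W) :
    metricTrace (stdBasis n p) (inducedMetric g' ι p) T =
      (Real.exp (2 * u (ι p)))⁻¹ • metricTrace (stdBasis n p) (inducedMetric g ι p) T :=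
  IsScalarProduct.metricTrace_scale (stdBasis n p) (Real.exp_ne_zero _) T
    (fun _ _ => hg (ι p) _ _)
    ((isScalarProduct_inducedMetric hι' g p).gram_det_ne_zero (stdBasis n p))

end Rescaling

section MetricIndependence

variable {m n : ℕ} {M : Type*} [TopologicalSpace M] [ChartedSpace (EuclideanSpace ℝ (Fin m)) M]
  [IsManifold (𝓡 m) ∞ M]
  {N : Type*} [TopologicalSpace N] [ChartedSpace (EuclideanSpace ℝ (Fin n)) N]
  [IsManifold (𝓡 n) ∞ N]

namespace WeylStructure

variable {c : ConformalStructure m M} (D : WeylStructure c) {g g' : c.metrics}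
  {ι : N → M} (hι' : InjectiveDifferential n m ι) {u : M → ℝ}
  (hg : ∀ (x : M) (v w : TangentSpace (𝓡 m) x),
    g'.1.inner x v w = Real.exp (2 * u x) * g.1.inner x v w)

include hι' hg

theorem fundamentalForm_rescale (p : N) :
    D.fundamentalForm (n := n) g' ι p = D.fundamentalForm g ι p := by
  funext v w
  simp only [fundamentalForm, normalPart_rescale hι' hg]

theorem fundamentalFormTraceFree_rescale (p : N) :
    D.fundamentalFormTraceFree (n := n) g' ι p = D.fundamentalFormTraceFree g ι p := by
  funext v w
  have h1 : inducedMetric g'.1 ι p v w =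
      Real.exp (2 * u (ι p)) * inducedMetric g.1 ι p v w := hg (ι p) _ _
  simp only [fundamentalFormTraceFree, D.fundamentalForm_rescale hι' hg,
    metricTrace_rescale hι' hg, h1, smul_smul]
  congr 2
  field_simp

theorem covMeanCurvature_rescale (p : N) (X : TangentSpace (𝓡 n) p)
    (ξ : TangentSpace (𝓡 m) (ι p)) :
    D.covMeanCurvature (n := n) g' ι p X ξ = D.covMeanCurvature (n := n) g ι p X ξ := by
  simp only [covMeanCurvature, meanCurvature, covNormal, normalExtend_rescale hι' hg,
    tangentPart_rescale hι' hg, normalPart_rescale hι' hg]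

theorem codiffFundamentalForm_rescale (p : N) (X : TangentSpace (𝓡 n) p)
    (ξ : TangentSpace (𝓡 m) (ι p)) :
    D.codiffFundamentalForm (n := n) g' ι p X ξ = D.codiffFundamentalForm (n := n) g ι p X ξ := by
  have h1 : D.covFundamentalFormTraceFree (n := n) g' ι p =
      D.covFundamentalFormTraceFree g ι p := by
    funext a v b
    simp only [covFundamentalFormTraceFree, covNormal, covTangent,
      D.fundamentalFormTraceFree_rescale hι' hg, tangentPart_rescale hι' hg,
      normalPart_rescale hι' hg]
  simp only [codiffFundamentalForm, h1, metricTrace_rescale hι' hg, hg, map_smul, smul_apply,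
    smul_eq_mul]
  field_simp

omit hg in
/-- The mixed Schouten-Weyl tensor does not depend on the metric of the conformal class in which
weighted quantities are written, if the Schouten-Weyl tensor has this property on pairs of
orthogonal vectors. -/
theorem mixedSchoutenWeyl_rescale (S : RigidStructure c)
    {s : ∀ x : M, TangentSpace (𝓡 m) x → TangentSpace (𝓡 m) x → ℝ}
    (hD : ∀ (g : c.metrics) (x : M) (v w : TangentSpace (𝓡 m) x),
      g.1.inner x v w = 0 → D.schouten S g x v w = s x v w) (g g' : c.metrics)
    (p : N) (X : TangentSpace (𝓡 n) p) {ξ : TangentSpace (𝓡 m) (ι p)}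
    (hξ : ξ ∈ normalSpace (n := n) c ι p) :
    D.mixedSchoutenWeyl g' ι S p X ξ = D.mixedSchoutenWeyl g ι S p X ξ := by
  have h1 : ∀ g : c.metrics, g.1.inner (ι p) (dmap ι p X) ξ = 0 := fun g => by
    rw [g.1.symm]
    exact hξ g.1 g.2 X
  obtain ⟨u, -, hg⟩ := (c.mem_iff g.1 g.2 g'.1).1 g'.2
  simp only [mixedSchoutenWeyl, D.covMeanCurvature_rescale hι' hg,
    D.codiffFundamentalForm_rescale hι' hg]
  rw [hD g _ _ _ (h1 g), hD g' _ _ _ (h1 g')]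

end WeylStructure

end MetricIndependence

end ConformalGeometry

end

theorem proposition4p8 {m n : ℕ}
    {M : Type*} [TopologicalSpace M] [ChartedSpace (EuclideanSpace ℝ (Fin m)) M]
    [IsManifold (𝓡 m) ∞ M] [T2Space M]
    {N : Type*} [TopologicalSpace N] [ChartedSpace (EuclideanSpace ℝ (Fin n)) N]
    [IsManifold (𝓡 n) ∞ N]
    (c : ConformalGeometry.ConformalStructure m M)
    (S : ConformalGeometry.RigidStructure c)
    (ι : N → M) (hι : ContMDiff (𝓡 n) (𝓡 m) ∞ ι)
    (hι' : ∀ p : N, Function.Injective (mfderiv (𝓡 n) (𝓡 m) ι p)) :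
    ∃ μ : ∀ p : N, TangentSpace (𝓡 n) p →ₗ[ℝ] ConformalGeometry.normalSpace (n := n) c ι p →ₗ[ℝ] ℝ,
      ∀ (D : ConformalGeometry.WeylStructure c) (g : c.metrics) (p : N)
        (X : TangentSpace (𝓡 n) p) (ξ : ConformalGeometry.normalSpace (n := n) c ι p),
        D.mixedSchoutenWeyl g ι S p X ξ = μ p X ξ := by
  by_cases h : Nonempty (ConformalGeometry.WeylStructure c)
  · obtain ⟨D₀, s, hs, hD₀⟩ := ConformalGeometry.WeylStructure.exists_schouten_eq S h
    obtain ⟨g₀, hg₀⟩ := c.nonempty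
    choose μ hμ using
      D₀.exists_mixedSchoutenWeyl_eq ⟨g₀, hg₀⟩ hι hι' S hs (fun x v w => hD₀ ⟨g₀, hg₀⟩ x v w)
    refine ⟨μ, fun D g p X ξ => ?_⟩
    rw [D₀.mixedSchoutenWeyl_change D g hι hι' S X (ConformalGeometry.isNormal_of_mem g ξ.2),
      D₀.mixedSchoutenWeyl_rescale hι' S hD₀ ⟨g₀, hg₀⟩ g p X ξ.2, hμ]
  · exact ⟨fun _ => 0, fun D => absurd ⟨D⟩ h⟩
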